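/- **Model.** Let $d\ge 1$ and $\Theta=[0,1]^d$. Outcomes are $Y(\theta)=\mu(\theta)+\sigma(\theta)\epsilon_\theta$, where the random variables $\epsilon_\theta$ live on a common probability space, depend measurably on $\theta$, and have mean $0$ and variance $1$ for every $\theta\in\Theta$. Assume: 1. $\mu$ is three times continuously differentiable on $\Theta$ and $-\nabla^2\mu(\theta)\succ 0$ for all $\theta\in\Theta$; 2. $\sigma$ is continuous on $\Theta$; 3. the ODE $\dot\theta=-\nabla\mu(\theta)$ has a unique solution for each initial condition, as long as the solution stays in $\Theta$ (a solution exists on a short time interval from each interior point of $\Theta$, and two solutions in $\Theta$ from the same point of $\Theta$ agree on every interval $[0,\tau]$ on which both are defined); 4. there are $a>0$ and $M_1>0$ with $\mathbb E|\epsilon_\theta|^{2+a}<M_1$ for all $\theta\in\Theta$. Let $\theta^*$ be the maximizer of $\mu$ over $\Theta$. **Algorithm.** Fix a real $k>1$, integers $m_1,m_2\ge 1$, $m=m_1+m_2$, an initial point $\theta^1\in\Theta$, and $\alpha_t=C_0/t$, $c_t=C_1/t^{\nu}$ with $C_0,C_1>0$ and $\frac16<\nu<\frac14$. Let $\Pi$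 be the Euclidean projection onto $\Theta$. In round $t=1,2,\dots$ draw $w^t$ uniformly from the unit sphere of $\mathbb R^d$ and put $$\theta^{\pm}=\Pi(\theta^t\pm c_tw^t),\qquad \theta^{++}=\Pi(\theta^t+kc_tw^t),\qquad \theta^{--}=\Pi(\theta^t-kc_tw^t).$$ Among $2m_1$ new customers, an $m_1$-element random subset receives $\theta^+$ and the others receive $\theta^-$; among $2m_2$ further new customers, an $m_2$-element random subset receives $\theta^{++}$ and the others receive $\theta^{--}$. The outcome of a customer who receives $\vartheta$ is the value of $Y(\vartheta)$ for an independent draw from the noise space. The directions $w^t$ are independent over $t$, the customers' draws are independent and identically distributed, the random subsets follow any predetermined design (an arbitrary joint law), and directions, draws and subsets are independent of each other. With $\bar\mu(\cdot)$ the four sample means of the round, $$g^t=\frac{-\bar\mu(\theta^{++})+k^3\bar\mu(\theta^+)-k^3\bar\mu(\theta^-)+\bar\mu(\theta^{--})}{2k(k^2-1)c_t}\,w^t,\qquad \hat\mu_t=\frac{-\bar\mu(\theta^{++})+k^2\bar\mu(\theta^+)+k^2\bar\mu(\theta^-)-\bar\mu(\theta^{--})}{2(k^2-1)},$$ and $\theta^{t+1}=\Pi(\theta^t+\alpha_tg^t)$.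 For a budget $T$ divisible by $2m$, the estimator is $\hat\mu(\hat\theta_T)=\frac{2m}{T}\sum_{t=1}^{T/(2m)}\hat\mu_t$. Its variance is understood as accumulated along the run, conditionally on the current iterate and direction in each round: $$\mathrm{Var}(\hat\mu(\hat\theta_T))=\frac{4m^2}{T^2}\sum_{t=1}^{T/(2m)}\mathrm{Var}\big(\hat\mu_t\,\big|\,\theta^t,w^t\big).$$ **Proposition.** Every $\hat\mu_t$ is square integrable and, with probability one, as $T\to\infty$ through the multiples of $2m$, $$T\cdot\mathrm{Var}(\hat\mu(\hat\theta_T))\to\frac{m}{(k^2-1)^2}\Big(\frac{k^4}{m_1}+\frac1{m_2}\Big)\sigma(\theta^*)^2 .$$ Moreover, the minimum of the factor $\frac{m}{(k^2-1)^2}\big(\frac{k^4}{x}+\frac1y\big)$ over real $x,y>0$ with $x+y=m$ equals $\frac{(k^2+1)^2}{(k^2-1)^2}$, and it is attained exactly at $x=\frac{k^2}{k^2+1}m$, $y=\frac{1}{k^2+1}m$. -/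

import Mathlib

open MeasureTheory ProbabilityTheory Filter Topology
open scoped ENNReal

namespace AdaptiveAB

noncomputable section

/-! ### The parameter space `[0,1]^d` -/

/-- `ℝ^d` with the Euclidean norm. -/
abbrev E (d : ℕ) : Type := EuclideanSpace ℝ (Fin d)

/-- The parameter space `Θ = [0,1]^d`. -/
def cube (d : ℕ) : Set (E d) := {x | ∀ i, x i ∈ Set.Icc (0 : ℝ) 1}

/-- The Euclidean projection onto `Θ`: every coordinate is clipped to `[0,1]`. -/
def proj {d : ℕ} (x : E d) : E d := WithLp.toLp 2 fun i => max 0 (min 1 (x i))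

theorem proj_mem_cube {d : ℕ} (x : E d) : proj x ∈ cube d := fun _ =>
  ⟨le_max_left _ _, max_le zero_le_one (min_le_left _ _)⟩

/-- `proj x` is a nearest point of `Θ` to `x`. -/
theorem norm_sub_proj_le {d : ℕ} (x y : E d) (hy : y ∈ cube d) : ‖x - proj x‖ ≤ ‖x - y‖ := by
  rw [EuclideanSpace.norm_eq, EuclideanSpace.norm_eq]
  refine Real.sqrt_le_sqrt (Finset.sum_le_sum fun i _ => ?_)
  have h := hy i
  simp only [PiLp.sub_apply, proj, Real.norm_eq_abs, sq_abs]
  rcases le_total (x i) 0 with h0 | h0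
  · rw [min_eq_right (by linarith), max_eq_left h0]; nlinarith [h.1, h.2]
  · rcases le_total (x i) 1 with h1 | h1
    · rw [min_eq_right h1, max_eq_right h0]; nlinarith [sq_nonneg (x i - y i)]
    · rw [min_eq_left h1, max_eq_right zero_le_one]; nlinarith [h.1, h.2]

/-- The uniform distribution on the unit sphere of `ℝ^d`: normalized surface measure. -/
def uniformSphere (d : ℕ) : Measure (Metric.sphere (0 : E d) 1) :=
  ((volume : Measure (E d)).toSphere Set.univ)⁻¹ • (volume : Measure (E d)).toSphere

/-! ### The outcome model `Y(θ) = μ(θ) + σ(θ) ε_θ` -/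

/-- The data of the outcome model. The random variables `ε_θ` live on a probability space
`(S, ρ)`; a customer is an independent draw of a point of `S`. -/
structure Model (d : ℕ) (S : Type*) where
  μ : E d → ℝ
  σ : E d → ℝ
  ε : E d → S → ℝ

/-- `Y(θ)`, as a random variable on `S`. -/
def Model.Y {d : ℕ} {S : Type*} (M : Model d S) (x : E d) (s : S) : ℝ :=
  M.μ x + M.σ x * M.ε x s

/-- The noise variables `ε_θ` depend measurably on `θ`, and for `θ ∈ Θ` they have mean zero and
variance one. -/
structure Model.IsStandardized {d : ℕ} {S : Type*} [MeasurableSpace S] (M : Model d S)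
    (ρ : Measure S) : Prop where
  measurable : Measurable (Function.uncurry M.ε)
  memLp : ∀ x ∈ cube d, MemLp (M.ε x) 2 ρ
  mean : ∀ x ∈ cube d, ∫ s, M.ε x s ∂ρ = 0
  variance : ∀ x ∈ cube d, Var[M.ε x; ρ] = 1

/-- `μ` is three times continuously differentiable on `Θ`, with negative definite Hessian. -/
def SmoothConcave {d : ℕ} (μ : E d → ℝ) : Prop :=
  ContDiffOn ℝ 3 μ (cube d) ∧
    ∀ x ∈ cube d, ∀ v : E d, v ≠ 0 → iteratedFDerivWithin ℝ 2 μ (cube d) x ![v, v] < 0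

/-- `γ` solves `γ' = -∇μ(γ)` in `Θ` on the time interval `[0, τ]`, starting from `x`. -/
def SolvesODE {d : ℕ} (μ : E d → ℝ) (γ : ℝ → E d) (x : E d) (τ : ℝ) : Prop :=
  γ 0 = x ∧ ∀ s ∈ Set.Icc (0 : ℝ) τ, γ s ∈ cube d ∧
    HasDerivWithinAt γ (-gradientWithin μ (cube d) (γ s)) (Set.Icc 0 τ) s

/-- The ordinary differential equation `γ' = -∇μ(γ)` on `Θ` has a unique solution for each initial
condition, for as long as it stays in `Θ`: solutions start at every interior point, and two
solutions from the same point of `Θ` agree on every interval on which both are defined. -/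
def ODEWellPosed {d : ℕ} (μ : E d → ℝ) : Prop :=
  (∀ x ∈ interior (cube d), ∃ τ > 0, ∃ γ, SolvesODE μ γ x τ) ∧
    ∀ x ∈ cube d, ∀ τ > 0, ∀ γ₁ γ₂, SolvesODE μ γ₁ x τ → SolvesODE μ γ₂ x τ →
      Set.EqOn γ₁ γ₂ (Set.Icc 0 τ)

/-- The `(2 + a)`-th absolute moments of `ε_θ` are bounded uniformly in `θ ∈ Θ`. -/
def UniformMoment {d : ℕ} {S : Type*} [MeasurableSpace S] (M : Model d S) (ρ : Measure S) : Prop :=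
  ∃ a > (0 : ℝ), ∃ M₁ > (0 : ℝ), ∀ x ∈ cube d,
    ∫⁻ s, ‖M.ε x s‖ₑ ^ (2 + a) ∂ρ < ENNReal.ofReal M₁

/-! ### The algorithm

Rounds are numbered `t = 1, 2, …`. A round uses `2 m₁ + 2 m₂` customers: the customers
`Sum.inl i`, `i : Fin (2 m₁)`, receive `θ⁺` or `θ⁻`, and the customers `Sum.inr i`,
`i : Fin (2 m₂)`, receive `θ⁺⁺` or `θ⁻⁻`. -/

/-- The parameters of the algorithm: `k`, step sizes `α_t`, half lengths `c_t` of the finite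
difference interval, subsample sizes and initial point. -/
structure Params (d : ℕ) where
  k : ℝ
  α : ℕ → ℝ
  c : ℕ → ℝ
  m₁ : ℕ
  m₂ : ℕ
  θ₀ : E d

namespace Params

variable {d : ℕ} (A : Params d)

/-- `m = m₁ + m₂`. -/
def m : ℕ := A.m₁ + A.m₂

/-- The customers of one round. -/
abbrev Customer : Type := Fin (2 * A.m₁) ⊕ Fin (2 * A.m₂)

end Params

/-- The randomness of one round: the direction, the two random subsets, and one
draw from `S` for each customer. -/
structure Round {d : ℕ} (A : Params d) (S : Type*) where
  w : Metric.sphere (0 : E d) 1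
  R₁ : Finset (Fin (2 * A.m₁))
  R₂ : Finset (Fin (2 * A.m₂))
  ξ : A.Customer → S

section OneRound

variable {d : ℕ} {S : Type*} (A : Params d) (M : Model d S) (t : ℕ) (x : E d) (z : Round A S)

/-- The evaluation point `x + r c_t w^t`, projected back to `Θ`. The points `θ⁺, θ⁻, θ⁺⁺, θ⁻⁻`
are obtained for `r = 1, -1, k, -k`. -/
def evalPoint (r : ℝ) : E d := proj (x + (r * A.c t) • (z.w : E d))

/-- Sample mean of the outcomes at `θ⁺`. -/
def barPlus : ℝ :=
  (∑ i ∈ z.R₁, M.Y (evalPoint A t x z 1) (z.ξ (Sum.inl i))) / A.m₁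

/-- Sample mean of the outcomes at `θ⁻`. -/
def barMinus : ℝ :=
  (∑ i ∈ z.R₁ᶜ, M.Y (evalPoint A t x z (-1)) (z.ξ (Sum.inl i))) / A.m₁

/-- Sample mean of the outcomes at `θ⁺⁺`. -/
def barPlusPlus : ℝ :=
  (∑ i ∈ z.R₂, M.Y (evalPoint A t x z A.k) (z.ξ (Sum.inr i))) / A.m₂

/-- Sample mean of the outcomes at `θ⁻⁻`. -/
def barMinusMinus : ℝ :=
  (∑ i ∈ z.R₂ᶜ, M.Y (evalPoint A t x z (-A.k)) (z.ξ (Sum.inr i))) / A.m₂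

/-- The gradient estimator `g^t`. -/
def gradEst : E d :=
  ((-barPlusPlus A M t x z + A.k ^ 3 * barPlus A M t x z - A.k ^ 3 * barMinus A M t x z
    + barMinusMinus A M t x z) / (2 * A.k * (A.k ^ 2 - 1) * A.c t)) • (z.w : E d)

/-- The function value estimator `μ̂_t`. -/
def valueEst : ℝ :=
  (-barPlusPlus A M t x z + A.k ^ 2 * barPlus A M t x z + A.k ^ 2 * barMinus A M t x z
    - barMinusMinus A M t x z) / (2 * (A.k ^ 2 - 1))

end OneRound

/-- The random inputs of the algorithm on a sample space `Ω`, round by round. -/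
structure Inputs {d : ℕ} (A : Params d) (S Ω : Type*) where
  w : ℕ → Ω → Metric.sphere (0 : E d) 1
  R₁ : ℕ → Ω → Finset (Fin (2 * A.m₁))
  R₂ : ℕ → Ω → Finset (Fin (2 * A.m₂))
  ξ : ℕ → A.Customer → Ω → S

/-- The probabilistic assumptions on the inputs: the directions are i.i.d. uniform on the unit
sphere, the customers are i.i.d. with law `ρ`, and the subsets, with `m₁` and `m₂` elements, follow
an arbitrary predetermined randomization design (any joint law); directions, customers and design
are independent of each other. -/
structure Inputs.IsRandomized {d : ℕ} {A : Params d} {S Ω : Type*} [MeasurableSpace S]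
    [MeasurableSpace Ω] (Z : Inputs A S Ω) (ρ : Measure S) (P : Measure Ω) : Prop where
  measurable_w : ∀ t, Measurable (Z.w t)
  measurable_R₁ : ∀ t, Measurable (Z.R₁ t)
  measurable_R₂ : ∀ t, Measurable (Z.R₂ t)
  measurable_ξ : ∀ t j, Measurable (Z.ξ t j)
  card_R₁ : ∀ t ω, (Z.R₁ t ω).card = A.m₁
  card_R₂ : ∀ t ω, (Z.R₂ t ω).card = A.m₂
  law_w : ∀ t, P.map (Z.w t) = uniformSphere d
  law_ξ : ∀ t j, P.map (Z.ξ t j) = ρ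
  indep_w : iIndepFun Z.w P
  indep_ξ : iIndepFun (fun p : ℕ × A.Customer => Z.ξ p.1 p.2) P
  indep_w_ξ : IndepFun (fun ω t => Z.w t ω) (fun ω (p : ℕ × A.Customer) => Z.ξ p.1 p.2 ω) P
  indep_design :
    IndepFun (fun ω => ((fun t => Z.w t ω), (fun p : ℕ × A.Customer => Z.ξ p.1 p.2 ω)))
      (fun ω t => (Z.R₁ t ω, Z.R₂ t ω)) P

section Run

variable {d : ℕ} {A : Params d} {S Ω : Type*} (Z : Inputs A S Ω) (M : Model d S)

/-- The randomness of round `t`. -/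
def Inputs.round (t : ℕ) (ω : Ω) : Round A S :=
  ⟨Z.w t ω, Z.R₁ t ω, Z.R₂ t ω, fun j => Z.ξ t j ω⟩

/-- The iterates: `θ^1` is the initial point and `θ^{t+1} = Π_Θ(θ^t + α_t g^t)` for `t ≥ 1`
(the index `0` is not used by the algorithm). -/
def iterate : ℕ → Ω → E d
  | 0, _ => A.θ₀
  | 1, _ => A.θ₀
  | t + 2, ω => proj (iterate (t + 1) ω +
      A.α (t + 1) • gradEst A M (t + 1) (iterate (t + 1) ω) (Z.round (t + 1) ω))

/-- The function value estimator `μ̂_t` of round `t`. -/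
def muHat (t : ℕ) (ω : Ω) : ℝ := valueEst A M t (iterate Z M t ω) (Z.round t ω)

/-- The final estimator `μ̂(θ̂_T) = ∑_{t=1}^{T/(2m)} (2m/T) μ̂_t`. -/
def finalEst (T : ℕ) (ω : Ω) : ℝ :=
  ∑ t ∈ Finset.Icc 1 (T / (2 * A.m)), (2 * A.m / T : ℝ) * muHat Z M t ω

/-- The σ-algebra generated by `(θ^t, w^t)`. -/
abbrev sigmaAlg (t : ℕ) : MeasurableSpace Ω :=
  MeasurableSpace.comap (fun ω => (iterate Z M t ω, Z.w t ω)) inferInstance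

/-- The variance of `μ̂(θ̂_T)`, accumulated along the run: the sum of the variances of the
summands `(2m/T) μ̂_t`, the one of round `t` being conditional on `(θ^t, w^t)`. -/
def varFinalEst [MeasurableSpace Ω] (P : Measure Ω) (T : ℕ) (ω : Ω) : ℝ :=
  ∑ t ∈ Finset.Icc 1 (T / (2 * A.m)),
    Var[fun ω' => (2 * A.m / T : ℝ) * muHat Z M t ω'; P | sigmaAlg Z M t] ω

end Run

end

end AdaptiveAB

namespace AdaptiveAB

noncomputable section

/-! ### The cube and concave functions on it -/

/-! Given the iterate and the direction, $\hat\mu_t$ is a weighted sum of independent outcomes. The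
subsets have fixed sizes, so its mean and variance do not depend on the design, and its conditional
variance is an explicit combination `combVar` of values of $\sigma^2$ at the four evaluation points
(`condVar_runComb`). Hence $T\cdot\mathrm{Var}$ is $2m$ times a time average of `combVar`. As
$c_t\to0$ and $\sigma$ is uniformly continuous, it remains to see that the run spends asymptotically
all its time near $\theta^*$. Let $D(x)=D\mu(x)(\theta^*-x)$. By strict concavity $D\ge0$ on the
cube, with equality only at $\theta^*$ (`SmoothConcave.deriv_pos`), so it suffices that the averages
of $D(\theta^t)$ tend to $0$ (`tendsto_average_of_tendsto_gap`). By Tonelli and Kronecker this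
follows from $\sum_t\alpha_t\,\mathbb E D(\theta^t)<\infty$; almost sure convergence of the iterates
is not needed.

The sum is bounded by a Lyapunov argument in expectation (`exists_expected_drift`). Clipping at the
boundary distorts the gradient estimator: its $i$-th component has mean
$\partial_i\mu(x)\,G_i(x_i)+O(c_t)$, where the gain $G_i$ depends on $c_t$ and on the distance of
$x_i$ to the boundary; mixed terms vanish by reflection symmetry. The plain squared distance is
therefore replaced by $V_c(x)=\sum_i\int_{\theta^*_i}^{x_i}2(v-\theta^*_i)/G_i(v)\,dv$, whose
gradient cancels the gain, so that the drift is $-2\alpha_tD(x)+O(\alpha_tc_t)$. Projection does not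
increase $V_c$.

Two further errors arise. The weights $1/G_i$ have Lipschitz constant $O(1/c)$ and the second moment
of $g^t$ is $O(1/c^2)$, giving $\alpha_t^2/c_t^3$. Passing from $V_{c_t}$ to $V_{c_{t+1}}$ costs
only $O(c_t-c_{t+1})$: the gains differ by $O((c_t-c_{t+1})/c_t)$, and only in boundary strips of
width $kc_t$. All three errors are summable for $0<\nu<1/4$ (`summable_step_sizes`). -/

theorem cube_eq_preimage (d : ℕ) :
    cube d = (EuclideanSpace.equiv (Fin d) ℝ).toHomeomorph ⁻¹'
      (Set.univ.pi fun _ => Set.Icc (0 : ℝ) 1) := by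
  ext x
  simp only [cube, Set.mem_ofPred_eq, Set.mem_preimage, Set.mem_univ_pi]
  rfl

theorem isCompact_cube (d : ℕ) : IsCompact (cube d) := by
  rw [cube_eq_preimage, Homeomorph.isCompact_preimage]
  exact isCompact_univ_pi fun _ => isCompact_Icc

theorem convex_cube (d : ℕ) : Convex ℝ (cube d) := by
  intro x hx y hy a b ha hb hab i
  simpa using convex_Icc (0 : ℝ) 1 (hx i) (hy i) ha hb hab

theorem interior_cube_nonempty (d : ℕ) : (interior (cube d)).Nonempty := by
  refine ⟨WithLp.toLp 2 fun _ => 1 / 2, ?_⟩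
  rw [cube_eq_preimage, ← Homeomorph.preimage_interior, interior_pi_set Set.finite_univ]
  simp only [Set.mem_preimage, Set.mem_univ_pi, interior_Icc]
  intro i
  change (1 / 2 : ℝ) ∈ Set.Ioo (0 : ℝ) 1
  norm_num

theorem uniqueDiffOn_cube (d : ℕ) : UniqueDiffOn ℝ (cube d) :=
  uniqueDiffOn_convex (convex_cube d) (interior_cube_nonempty d)

theorem continuous_proj {d : ℕ} : Continuous (proj : E d → E d) := by
  unfold proj
  fun_prop

theorem proj_eq_self {d : ℕ} {x : E d} (hx : x ∈ cube d) : proj x = x := by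
  ext i
  simp [proj, (hx i).1, (hx i).2]

theorem norm_proj_sub_le {d : ℕ} (x y : E d) : ‖proj x - proj y‖ ≤ ‖x - y‖ := by
  rw [EuclideanSpace.norm_eq, EuclideanSpace.norm_eq]
  refine Real.sqrt_le_sqrt (Finset.sum_le_sum fun i _ => ?_)
  simp only [PiLp.sub_apply, proj, Real.norm_eq_abs]
  refine pow_le_pow_left₀ (abs_nonneg _) ?_ 2
  rw [max_comm 0, max_comm 0]
  refine (abs_max_sub_max_le_abs _ _ _).trans ?_
  rw [min_comm 1, min_comm 1]
  exact abs_min_sub_min_le_max _ _ _ _ |>.trans (by simp)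

theorem norm_proj_sub_self_le {d : ℕ} {x : E d} (hx : x ∈ cube d) (h : E d) :
    ‖proj (x + h) - x‖ ≤ ‖h‖ := by
  have := norm_proj_sub_le (x + h) x
  rwa [proj_eq_self hx, add_sub_cancel_left] at this

/-- The derivative of `f` on the cube. -/
abbrev cubeDeriv {d : ℕ} (f : E d → ℝ) (x : E d) : E d →L[ℝ] ℝ := fderivWithin ℝ f (cube d) x

/-! ### First-order expansion and strict concavity on the cube. -/

namespace SmoothConcave

variable {d : ℕ} {f : E d → ℝ}

theorem continuousOn (hf : SmoothConcave f) : ContinuousOn f (cube d) := hf.1.continuousOn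

theorem hasFDerivWithinAt (hf : SmoothConcave f) {x : E d} (hx : x ∈ cube d) :
    HasFDerivWithinAt f (cubeDeriv f x) (cube d) x :=
  ((hf.1.differentiableOn (by norm_num)) x hx).hasFDerivWithinAt

theorem contDiffOn_cubeDeriv (hf : SmoothConcave f) : ContDiffOn ℝ 2 (cubeDeriv f) (cube d) :=
  hf.1.fderivWithin (uniqueDiffOn_cube d) (by norm_num)

theorem exists_lipschitz (hf : SmoothConcave f) :
    ∃ C : ℝ, 0 ≤ C ∧ ∀ x ∈ cube d, ∀ y ∈ cube d, ‖cubeDeriv f y - cubeDeriv f x‖ ≤ C * ‖y - x‖ := by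
  have hd := hf.contDiffOn_cubeDeriv
  have hc : ContinuousOn (fderivWithin ℝ (cubeDeriv f) (cube d)) (cube d) :=
    hd.continuousOn_fderivWithin (uniqueDiffOn_cube d) (by norm_num)
  obtain ⟨C, hC⟩ := (isCompact_cube d).exists_bound_of_continuousOn
    (E := E d →L[ℝ] E d →L[ℝ] ℝ) hc
  refine ⟨max C 0, le_max_right _ _, fun x hx y hy => ?_⟩
  exact (convex_cube d).norm_image_sub_le_of_norm_hasFDerivWithin_le
    (fun z hz => (hd.differentiableOn (by norm_num) z hz).hasFDerivWithinAt)
    (fun z hz => (hC z hz).trans (le_max_left _ _)) hx hy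

/-- This is the mean value inequality on the segment for `f` minus its linear part at `x`: along the
segment the derivative moves by at most `C * ‖y - x‖`. -/
theorem exists_taylor (hf : SmoothConcave f) :
    ∃ C : ℝ, 0 ≤ C ∧ ∀ x ∈ cube d, ∀ y ∈ cube d,
      |f y - f x - cubeDeriv f x (y - x)| ≤ C * ‖y - x‖ ^ 2 := by
  obtain ⟨C, hC0, hC⟩ := hf.exists_lipschitz
  refine ⟨C, hC0, fun x hx y hy => ?_⟩
  have hseg : segment ℝ x y ⊆ cube d := (convex_cube d).segment_subset hx hy
  have := (convex_segment x y).norm_image_sub_le_of_norm_hasFDerivWithin_le'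
    (f := f) (f' := cubeDeriv f) (φ := cubeDeriv f x) (C := C * ‖y - x‖)
    (fun z hz => (hf.hasFDerivWithinAt (hseg hz)).mono hseg)
    (fun z hz => ((hC x hx z (hseg hz)).trans
      (mul_le_mul_of_nonneg_left (norm_sub_le_of_mem_segment hz) hC0)))
    (left_mem_segment ℝ x y) (right_mem_segment ℝ x y)
  rw [Real.norm_eq_abs] at this
  linarith [sq ‖y - x‖]

/-- Along the segment from `x` to `a` the slope of `f` is nonnegative and is attained as a
derivative at an interior time `s`. The second derivative is negative, so the derivative at time `0`
is strictly larger. The argument also covers a maximizer on the boundary. -/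
theorem deriv_pos (hf : SmoothConcave f) {a : E d} (ha : a ∈ cube d)
    (hmax : IsMaxOn f (cube d) a) {x : E d} (hx : x ∈ cube d) (hxa : x ≠ a) :
    0 < cubeDeriv f x (a - x) := by
  set v := a - x with hv
  have hv0 : v ≠ 0 := sub_ne_zero.2 hxa.symm
  have hmem : ∀ s ∈ Set.Icc (0 : ℝ) 1, x + s • v ∈ cube d := fun s hs =>
    (convex_cube d).add_smul_sub_mem hx ha hs
  have hline : ∀ s : ℝ, HasDerivAt (fun s : ℝ => x + s • v) v s := fun s => by
    simpa using ((hasDerivAt_id s).smul_const v).const_add x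
  have h1 : ∀ s ∈ Set.Icc (0 : ℝ) 1,
      HasDerivWithinAt (fun s : ℝ => f (x + s • v)) (cubeDeriv f (x + s • v) v)
        (Set.Icc 0 1) s := fun s hs =>
    (hf.hasFDerivWithinAt (hmem s hs)).comp_hasDerivWithinAt s (hline s).hasDerivWithinAt hmem
  have h2 : ∀ s ∈ Set.Icc (0 : ℝ) 1,
      HasDerivWithinAt (fun s : ℝ => cubeDeriv f (x + s • v) v)
        (fderivWithin ℝ (cubeDeriv f) (cube d) (x + s • v) v v) (Set.Icc 0 1) s := fun s hs => by
    have := ((hf.contDiffOn_cubeDeriv.differentiableOn (by norm_num) _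
      (hmem s hs)).hasFDerivWithinAt).comp_hasDerivWithinAt s (hline s).hasDerivWithinAt hmem
    exact this.clm_apply (hasDerivWithinAt_const s _ v) |>.congr_deriv (by simp)
  have hneg : ∀ s ∈ Set.Icc (0 : ℝ) 1,
      fderivWithin ℝ (cubeDeriv f) (cube d) (x + s • v) v v < 0 := fun s hs => by
    have := hf.2 _ (hmem s hs) v hv0
    rwa [iteratedFDerivWithin_two_apply' f (uniqueDiffOn_cube d) (hmem s hs)] at this
  obtain ⟨s, hs, hs'⟩ := exists_hasDerivAt_eq_slope (fun s : ℝ => f (x + s • v))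
    (fun s => cubeDeriv f (x + s • v) v) one_pos (fun s hs => (h1 s hs).continuousWithinAt)
    (fun s hs => (h1 s (Set.Ioo_subset_Icc_self hs)).hasDerivAt (Icc_mem_nhds hs.1 hs.2))
  have hsub : Set.Icc (0 : ℝ) s ⊆ Set.Icc 0 1 := Set.Icc_subset_Icc_right hs.2.le
  obtain ⟨r, hr, hr'⟩ := exists_hasDerivAt_eq_slope (fun s : ℝ => cubeDeriv f (x + s • v) v)
    (fun s => fderivWithin ℝ (cubeDeriv f) (cube d) (x + s • v) v v) hs.1
    (fun r hr => ((h2 r (hsub hr)).mono hsub).continuousWithinAt)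
    (fun r hr => (h2 r (hsub (Set.Ioo_subset_Icc_self hr))).hasDerivAt
      (Icc_mem_nhds hr.1 (hr.2.trans hs.2)))
  have hr1 := hneg r (hsub (Set.Ioo_subset_Icc_self hr))
  have hxa' : f x ≤ f a := hmax hx
  simp only [one_smul, zero_smul, add_zero, sub_zero, div_one] at hs' hr'
  rw [hr', div_lt_iff₀ hs.1] at hr1
  have : x + v = a := by simp [hv]
  rw [this] at hs'
  linarith

end SmoothConcave

/-- A continuous function on a compact set is controlled, near its value at the only zero of a
nonnegative continuous function, by that function. -/
theorem exists_abs_sub_le_add_mul {X : Type*} [TopologicalSpace X] {s : Set X} (hs : IsCompact s)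
    {F D : X → ℝ} (hF : ContinuousOn F s) (hD : ContinuousOn D s) {a : X} (ha : a ∈ s)
    (hDa : ∀ x ∈ s, 0 ≤ D x) (hpos : ∀ x ∈ s, x ≠ a → 0 < D x) {δ : ℝ} (hδ : 0 < δ) :
    ∃ K : ℝ, 0 ≤ K ∧ ∀ x ∈ s, |F x - F a| ≤ δ + K * D x := by
  obtain ⟨U, hU, hUs⟩ := mem_nhdsWithin.1 ((hF a ha) (Metric.ball_mem_nhds (F a) hδ))
  obtain ⟨B, hB⟩ := hs.exists_bound_of_continuousOn hF
  have hsU : IsCompact (s \ U) := hs.diff hU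
  -- Away from `a` compactness gives `D` a positive lower bound `m`, and the crude bound `2 * B` on
  -- the variation of `F` is at most `2 * B / m * D x`.
  obtain ⟨m, hm, hmD⟩ : ∃ m : ℝ, 0 < m ∧ ∀ x ∈ s \ U, m ≤ D x := by
    rcases (s \ U).eq_empty_or_nonempty with he | hne
    · exact ⟨1, one_pos, by simp [he]⟩
    · obtain ⟨y, hy, hmin⟩ := hsU.exists_isMinOn hne (hD.mono Set.sdiff_subset)
      exact ⟨D y, hpos y hy.1 fun h => hy.2 (h ▸ hUs.1), fun x hx => hmin hx⟩
  have hB0 : 0 ≤ B := (norm_nonneg _).trans (hB a ha)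
  refine ⟨2 * B / m, by positivity, fun x hx => ?_⟩
  by_cases hxU : x ∈ U
  · have : |F x - F a| < δ := by simpa [Real.dist_eq] using hUs.2 ⟨hxU, hx⟩
    have := mul_nonneg (show 0 ≤ 2 * B / m by positivity) (hDa x hx)
    linarith
  · have h1 := abs_sub (F x) (F a)
    have h2 := hB x hx
    have h3 := hB a ha
    rw [Real.norm_eq_abs] at h2 h3
    have h4 : 2 * B ≤ 2 * B / m * D x := by
      rw [div_mul_eq_mul_div, le_div_iff₀ hm]
      exact mul_le_mul_of_nonneg_left (hmD x ⟨hx, hxU⟩) (by positivity)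
    linarith

/-! ### Clipped finite differences in one coordinate -/

/-- The projection of the real line onto `[0,1]`. -/
def clip (u : ℝ) : ℝ := max 0 (min 1 u)

theorem proj_apply {d : ℕ} (x : E d) (i : Fin d) : proj x i = clip (x i) := rfl

theorem clip_mem (u : ℝ) : clip u ∈ Set.Icc (0 : ℝ) 1 :=
  ⟨le_max_left _ _, max_le zero_le_one (min_le_left _ _)⟩

theorem clip_of_mem {u : ℝ} (hu : u ∈ Set.Icc (0 : ℝ) 1) : clip u = u := by
  simp [clip, hu.1, hu.2]

theorem abs_clip_sub_le (a b : ℝ) : |clip a - clip b| ≤ |a - b| := by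
  unfold clip
  rw [max_comm 0, max_comm 0]
  refine (abs_max_sub_max_le_abs _ _ _).trans ?_
  rw [min_comm 1, min_comm 1]
  exact abs_min_sub_min_le_max _ _ _ _ |>.trans (by simp)

theorem continuous_clip : Continuous clip := by
  unfold clip
  fun_prop

/-- The length of `[u - r, u + r]` after projection to `[0,1]`. -/
def spread (u r : ℝ) : ℝ := clip (u + r) - clip (u - r)

theorem spread_neg (u r : ℝ) : spread u (-r) = -spread u r := by
  simp [spread, sub_eq_add_neg]

theorem abs_spread_sub_le (u v r s : ℝ) :
    |spread u r - spread v s| ≤ 2 * |u - v| + 2 * |r - s| := by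
  have h1 := abs_clip_sub_le (u + r) (v + s)
  have h2 := abs_clip_sub_le (u - r) (v - s)
  have h3 : |u + r - (v + s)| ≤ |u - v| + |r - s| := by
    rw [show u + r - (v + s) = (u - v) + (r - s) by ring]; exact abs_add_le _ _
  have h4 : |u - r - (v - s)| ≤ |u - v| + |r - s| := by
    rw [show u - r - (v - s) = (u - v) - (r - s) by ring]; exact abs_sub _ _
  have h5 : |spread u r - spread v s|
      ≤ |clip (u + r) - clip (v + s)| + |clip (u - r) - clip (v - s)| := by
    rw [show spread u r - spread v s = (clip (u + r) - clip (v + s))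
      - (clip (u - r) - clip (v - s)) by unfold spread; ring]
    exact abs_sub _ _
  linarith

theorem abs_spread_le (u r : ℝ) : |spread u r| ≤ 2 * |r| := by
  have := abs_spread_sub_le u u r 0
  simpa [spread] using this

theorem continuous_spread : Continuous fun p : ℝ × ℝ => spread p.1 p.2 := by
  unfold spread
  have := continuous_clip
  fun_prop

/-- If both ends are clipped, the whole unit interval remains; otherwise an unclipped side alone
contributes `r`. -/
theorem min_le_spread {u r : ℝ} (hu : u ∈ Set.Icc (0 : ℝ) 1) (hr : 0 ≤ r) :
    min 1 r ≤ spread u r := by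
  obtain ⟨h0, h1⟩ := hu
  unfold spread clip
  rcases le_total 1 (u + r) with h2 | h2 <;> rcases le_total 0 (u - r) with h3 | h3 <;>
    rcases le_total 1 r with h4 | h4
  all_goals
    rw [min_eq_right (show u - r ≤ 1 by linarith)]
    first | rw [min_eq_left h2] | rw [min_eq_right h2]
    first | rw [max_eq_right h3] | rw [max_eq_left h3]
    rw [max_eq_right (by linarith)]
    first | rw [min_eq_left h4] | rw [min_eq_right h4]
    linarith

/-- Each one-sided length, as a function of `r`, is the minimum of `r` and the distance to an
endpoint: concave and zero at `0`. -/
theorem spread_mul_le {u r k : ℝ} (hu : u ∈ Set.Icc (0 : ℝ) 1) (hr : 0 ≤ r) (hk : 1 ≤ k) :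
    spread u (k * r) ≤ k * spread u r := by
  obtain ⟨h0, h1⟩ := hu
  have hkr : r ≤ k * r := le_mul_of_one_le_left hr hk
  have e1 : clip (u + k * r) - u ≤ k * (clip (u + r) - u) := by
    unfold clip
    rw [max_eq_right (le_min zero_le_one (by linarith)),
      max_eq_right (le_min zero_le_one (by linarith))]
    rcases le_total 1 (u + r) with h2 | h2
    · rw [min_eq_left h2]
      have : min 1 (u + k * r) ≤ 1 := min_le_left _ _
      nlinarith
    · rw [min_eq_right h2]
      have : min 1 (u + k * r) ≤ u + k * r := min_le_right _ _
      linarith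
  have e2 : u - clip (u - k * r) ≤ k * (u - clip (u - r)) := by
    unfold clip
    rw [min_eq_right (by linarith), min_eq_right (by linarith)]
    rcases le_total (u - r) 0 with h2 | h2
    · rw [max_eq_left h2]
      have : 0 ≤ max 0 (u - k * r) := le_max_left _ _
      nlinarith
    · rw [max_eq_right h2]
      have : u - k * r ≤ max 0 (u - k * r) := le_max_right _ _
      linarith
  unfold spread
  linarith

theorem spread_eq {u r : ℝ} (h0 : |r| ≤ u) (h1 : u ≤ 1 - |r|) : spread u r = 2 * r := by
  obtain ⟨h2, h3⟩ := abs_le.1 h0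
  have h4 := le_abs_self r
  have h5 := neg_abs_le r
  unfold spread
  rw [clip_of_mem ⟨by linarith, by linarith⟩, clip_of_mem ⟨by linarith, by linarith⟩]
  ring

/-- The contribution of one coordinate `u` of the iterate, and `s` of the direction, to the
gradient estimator of a linear function. -/
def diffQuot (k c u s : ℝ) : ℝ :=
  (k ^ 3 * spread u (c * s) - spread u (k * (c * s))) / (2 * k * (k ^ 2 - 1) * c)

/-- The constant in the estimates for `diffQuot`. -/
def diffBound (k : ℝ) : ℝ := (k ^ 3 + k) / (k * (k ^ 2 - 1))

/-! ### Size, regularity and positivity of the clipped difference quotient. -/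

section diffQuot

variable {k : ℝ}

theorem diffBound_pos (hk : 1 < k) : 0 < diffBound k := by
  have : 0 < k ^ 2 - 1 := by nlinarith
  unfold diffBound
  positivity

theorem diffQuot_neg (k c u s : ℝ) : diffQuot k c u (-s) = -diffQuot k c u s := by
  unfold diffQuot
  rw [mul_neg, mul_neg, spread_neg, spread_neg]
  ring

theorem continuous_diffQuot (k c : ℝ) : Continuous fun p : ℝ × ℝ => diffQuot k c p.1 p.2 := by
  unfold diffQuot
  have h1 := continuous_spread.comp (by fun_prop : Continuous fun p : ℝ × ℝ => (p.1, c * p.2))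
  have h2 := continuous_spread.comp
    (by fun_prop : Continuous fun p : ℝ × ℝ => (p.1, k * (c * p.2)))
  exact ((h1.const_mul _).sub h2).div_const _

theorem abs_diffQuot_sub_le (hk : 1 < k) {c : ℝ} (hc : 0 < c) (u v s : ℝ) :
    |diffQuot k c u s - diffQuot k c v s| ≤ diffBound k / c * |u - v| := by
  have hk2 : 0 < k ^ 2 - 1 := by nlinarith
  have hk0 : 0 < k := by linarith
  have hD : 0 < 2 * k * (k ^ 2 - 1) * c := by positivity
  unfold diffQuot
  rw [← sub_div, abs_div, abs_of_pos hD, div_le_iff₀ hD]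
  have h1 := abs_spread_sub_le u v (c * s) (c * s)
  have h2 := abs_spread_sub_le u v (k * (c * s)) (k * (c * s))
  simp only [sub_self, abs_zero, mul_zero, add_zero] at h1 h2
  have h3 : |k ^ 3 * spread u (c * s) - spread u (k * (c * s))
      - (k ^ 3 * spread v (c * s) - spread v (k * (c * s)))|
      ≤ k ^ 3 * |spread u (c * s) - spread v (c * s)|
        + |spread u (k * (c * s)) - spread v (k * (c * s))| := by
    rw [show k ^ 3 * spread u (c * s) - spread u (k * (c * s))
      - (k ^ 3 * spread v (c * s) - spread v (k * (c * s)))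
      = k ^ 3 * (spread u (c * s) - spread v (c * s))
        - (spread u (k * (c * s)) - spread v (k * (c * s))) by ring]
    refine (abs_sub _ _).trans ?_
    rw [abs_mul, abs_of_pos (show 0 < k ^ 3 by positivity)]
  have h4 : diffBound k / c * |u - v| * (2 * k * (k ^ 2 - 1) * c)
      = 2 * (k ^ 3 + k) * |u - v| := by
    unfold diffBound; field_simp
  rw [h4]
  have h5 : k ^ 3 * |spread u (c * s) - spread v (c * s)| ≤ k ^ 3 * (2 * |u - v|) :=
    mul_le_mul_of_nonneg_left h1 (by positivity)
  nlinarith [abs_nonneg (u - v)]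

theorem abs_diffQuot_le (hk : 1 < k) {c : ℝ} (hc : 0 < c) (u s : ℝ) :
    |diffQuot k c u s| ≤ diffBound k * |s| := by
  have hk2 : 0 < k ^ 2 - 1 := by nlinarith
  have hk0 : 0 < k := by linarith
  have hD : 0 < 2 * k * (k ^ 2 - 1) * c := by positivity
  unfold diffQuot
  rw [abs_div, abs_of_pos hD, div_le_iff₀ hD]
  have h1 := abs_spread_le u (c * s)
  have h2 := abs_spread_le u (k * (c * s))
  rw [abs_mul, abs_of_pos hc] at h1
  rw [abs_mul, abs_mul, abs_of_pos hc, abs_of_pos hk0] at h2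
  have h3 : diffBound k * |s| * (2 * k * (k ^ 2 - 1) * c) = k ^ 3 * (2 * (c * |s|))
      + 2 * (k * (c * |s|)) := by
    unfold diffBound; field_simp
  rw [h3]
  refine (abs_sub _ _).trans (add_le_add ?_ h2)
  rw [abs_mul, abs_of_pos (show 0 < k ^ 3 by positivity)]
  exact mul_le_mul_of_nonneg_left h1 (by positivity)

/-- The change splits into that of the numerator and that of the factor `1 / c`; each contributes at
most `2 * |s| * ((c - c') / c)`. -/
theorem abs_spread_div_sub_le {c c' : ℝ} (hc' : 0 < c') (h : c' ≤ c) (u s : ℝ) :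
    |spread u (c * s) / c - spread u (c' * s) / c'| ≤ 4 * |s| * ((c - c') / c) := by
  have hc : 0 < c := hc'.trans_le h
  have h1 := abs_spread_sub_le u u (c * s) (c' * s)
  have h2 := abs_spread_le u (c' * s)
  rw [sub_self, abs_zero, mul_zero, zero_add, ← sub_mul, abs_mul,
    abs_of_nonneg (sub_nonneg.2 h)] at h1
  rw [abs_mul, abs_of_pos hc'] at h2
  have e : spread u (c * s) / c - spread u (c' * s) / c'
      = (spread u (c * s) - spread u (c' * s)) / c - spread u (c' * s) * ((c - c') / (c * c')) := by
    field_simp; ring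
  rw [e]
  refine (abs_sub _ _).trans ?_
  rw [abs_div, abs_mul, abs_of_pos hc, abs_of_nonneg
    (div_nonneg (sub_nonneg.2 h) (by positivity) : 0 ≤ (c - c') / (c * c'))]
  have h3 : |spread u (c' * s)| * ((c - c') / (c * c'))
      ≤ 2 * (c' * |s|) * ((c - c') / (c * c')) :=
    mul_le_mul_of_nonneg_right h2 (div_nonneg (sub_nonneg.2 h) (by positivity))
  have h4 : |spread u (c * s) - spread u (c' * s)| / c ≤ 2 * ((c - c') * |s|) / c :=
    div_le_div_of_nonneg_right h1 hc.le
  have h5 : 2 * (c' * |s|) * ((c - c') / (c * c')) = 2 * |s| * ((c - c') / c) := by field_simp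
  have h6 : 2 * ((c - c') * |s|) / c = 2 * |s| * ((c - c') / c) := by ring
  linarith

theorem abs_diffQuot_sub_le_of_le (hk : 1 < k) {c c' : ℝ} (hc' : 0 < c') (h : c' ≤ c) (u s : ℝ) :
    |diffQuot k c u s - diffQuot k c' u s| ≤ 2 * diffBound k * |s| * ((c - c') / c) := by
  have hk2 : 0 < k ^ 2 - 1 := by nlinarith
  have hk0 : 0 < k := by linarith
  have hc : 0 < c := hc'.trans_le h
  have h1 := abs_spread_div_sub_le hc' h u s
  have h2 := abs_spread_div_sub_le hc' h u (k * s)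
  rw [abs_mul, abs_of_pos hk0] at h2
  have e : diffQuot k c u s - diffQuot k c' u s
      = (k ^ 3 * (spread u (c * s) / c - spread u (c' * s) / c')
        - (spread u (c * (k * s)) / c - spread u (c' * (k * s)) / c')) / (2 * k * (k ^ 2 - 1)) := by
    unfold diffQuot
    rw [mul_left_comm k c s, mul_left_comm k c' s]
    field_simp
    ring
  have hD : 0 < 2 * k * (k ^ 2 - 1) := by positivity
  rw [e, abs_div, abs_of_pos hD, div_le_iff₀ hD]
  refine (abs_sub _ _).trans ?_
  rw [abs_mul, abs_of_pos (show 0 < k ^ 3 by positivity)]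
  have h3 : 2 * diffBound k * |s| * ((c - c') / c) * (2 * k * (k ^ 2 - 1))
      = k ^ 3 * (4 * |s| * ((c - c') / c)) + 4 * (k * |s|) * ((c - c') / c) := by
    unfold diffBound; field_simp; ring
  rw [h3]
  exact add_le_add (mul_le_mul_of_nonneg_left h1 (by positivity)) h2

/-- Clipping cannot reverse the sign of the estimator: the outer difference is at most `k` times the
inner one, so the numerator keeps at least `(k ^ 3 - k)` times the inner spread. The bound `b`
covers early rounds, in which `c * s` may exceed the side length of the cube. -/
theorem le_diffQuot_mul (hk : 1 < k) {c b u : ℝ} (hc : 0 < c) (hcb : c ≤ b) (hb : 1 ≤ b)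
    (hu : u ∈ Set.Icc (0 : ℝ) 1) {s : ℝ} (hs : |s| ≤ 1) :
    s ^ 2 / (2 * b) ≤ diffQuot k c u s * s := by
  -- Both factors on the right are odd in `s`.
  wlog h : 0 ≤ s generalizing s
  · have := this (s := -s) (by rwa [abs_neg]) (by linarith)
    rwa [diffQuot_neg, neg_mul_neg, neg_sq] at this
  rw [abs_of_nonneg h] at hs
  have hk2 : 0 < k ^ 2 - 1 := by nlinarith
  have hk0 : 0 < k := by linarith
  have hcs : 0 ≤ c * s := by positivity
  have h1 := spread_mul_le hu hcs hk.le
  have h2 := min_le_spread hu hcs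
  have h3 : c * s / b ≤ min 1 (c * s) := by
    refine le_min ?_ ?_
    · rw [div_le_one (by linarith)]; nlinarith
    · exact div_le_self hcs hb
  have h4 : s / (2 * b) ≤ diffQuot k c u s := by
    unfold diffQuot
    rw [le_div_iff₀ (by positivity)]
    have e : s / (2 * b) * (2 * k * (k ^ 2 - 1) * c) = (k ^ 3 - k) * (c * s / b) := by
      field_simp
    have h5 : (k ^ 3 - k) * (c * s / b) ≤ (k ^ 3 - k) * spread u (c * s) :=
      mul_le_mul_of_nonneg_left (h3.trans h2) (by nlinarith)
    linarith
  calc s ^ 2 / (2 * b) = s / (2 * b) * s := by ring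
    _ ≤ _ := mul_le_mul_of_nonneg_right h4 h

theorem diffQuot_eq (hk : 1 < k) {c u s : ℝ} (hc : 0 < c) (hs : |s| ≤ 1)
    (h0 : k * c ≤ u) (h1 : u ≤ 1 - k * c) : diffQuot k c u s = s := by
  have hk2 : 0 < k ^ 2 - 1 := by nlinarith
  have hk0 : 0 < k := by linarith
  have e1 : |k * (c * s)| ≤ k * c := by
    rw [abs_mul, abs_mul, abs_of_pos hc, abs_of_pos hk0]
    nlinarith [mul_pos hk0 hc]
  have e2 : |c * s| ≤ k * c := by
    rw [abs_mul, abs_of_pos hc]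
    nlinarith
  unfold diffQuot
  rw [spread_eq (e2.trans h0) (by linarith), spread_eq (e1.trans h0) (by linarith)]
  field_simp

end diffQuot

/-! ### The gain of one coordinate -/

section gain

variable {W : Type*} [MeasurableSpace W]

/-- The factor by which the expected gradient estimator scales a partial derivative, for a random
coordinate `X` of the direction. -/
def gain (π : Measure W) (X : W → ℝ) (k c u : ℝ) : ℝ := ∫ w, diffQuot k c u (X w) * X w ∂π

variable {π : Measure W} [IsProbabilityMeasure π] {X : W → ℝ} (hX : Measurable X)
  (hX1 : ∀ w, |X w| ≤ 1) {k : ℝ} (hk : 1 < k)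
include hX hX1 hk

theorem integrable_gain {c : ℝ} (hc : 0 < c) (u : ℝ) :
    Integrable (fun w => diffQuot k c u (X w) * X w) π := by
  refine Integrable.of_bound (C := diffBound k) ?_ (ae_of_all _ fun w => ?_)
  · have := (continuous_diffQuot k c).measurable.comp (measurable_const (a := u) |>.prodMk hX)
    exact (this.mul hX).aestronglyMeasurable
  · rw [Real.norm_eq_abs, abs_mul]
    have h1 := abs_diffQuot_le hk hc u (X w)
    have h2 := hX1 w
    have h3 := diffBound_pos hk
    have h4 := abs_nonneg (X w)
    calc |diffQuot k c u (X w)| * |X w| ≤ diffBound k * |X w| * |X w| :=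
          mul_le_mul_of_nonneg_right h1 h4
      _ ≤ diffBound k * 1 * 1 := by gcongr
      _ = _ := by ring

theorem le_gain {c b u : ℝ} (hc : 0 < c) (hcb : c ≤ b) (hb : 1 ≤ b)
    (hu : u ∈ Set.Icc (0 : ℝ) 1) : (∫ w, X w ^ 2 ∂π) / (2 * b) ≤ gain π X k c u := by
  rw [← integral_div]
  refine integral_mono_of_nonneg (ae_of_all _ fun w => ?_) (integrable_gain hX hX1 hk hc u)
    (ae_of_all _ fun w => le_diffQuot_mul hk hc hcb hb hu (hX1 w))
  have : 0 ≤ X w ^ 2 := sq_nonneg _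
  change 0 ≤ X w ^ 2 / (2 * b)
  positivity

theorem abs_gain_sub_le {c : ℝ} (hc : 0 < c) (u v : ℝ) :
    |gain π X k c u - gain π X k c v| ≤ diffBound k / c * |u - v| := by
  unfold gain
  rw [← integral_sub (integrable_gain hX hX1 hk hc u) (integrable_gain hX hX1 hk hc v)]
  have := norm_integral_le_of_norm_le_const (μ := π)
    (f := fun w => diffQuot k c u (X w) * X w - diffQuot k c v (X w) * X w)
    (C := diffBound k / c * |u - v|) (ae_of_all _ fun w => ?_)
  · simpa using this
  · rw [← sub_mul, Real.norm_eq_abs, abs_mul]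
    have h1 := abs_diffQuot_sub_le hk hc u v (X w)
    calc _ ≤ |diffQuot k c u (X w) - diffQuot k c v (X w)| * 1 :=
          mul_le_mul_of_nonneg_left (hX1 w) (abs_nonneg _)
      _ ≤ _ := by rwa [mul_one]

theorem abs_gain_sub_le_of_le {c c' : ℝ} (hc' : 0 < c') (h : c' ≤ c) (u : ℝ) :
    |gain π X k c u - gain π X k c' u| ≤ 2 * diffBound k * ((c - c') / c) := by
  have hc : 0 < c := hc'.trans_le h
  unfold gain
  rw [← integral_sub (integrable_gain hX hX1 hk hc u) (integrable_gain hX hX1 hk hc' u)]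
  have := norm_integral_le_of_norm_le_const (μ := π)
    (f := fun w => diffQuot k c u (X w) * X w - diffQuot k c' u (X w) * X w)
    (C := 2 * diffBound k * ((c - c') / c)) (ae_of_all _ fun w => ?_)
  · simpa using this
  · rw [← sub_mul, Real.norm_eq_abs, abs_mul]
    have h1 := abs_diffQuot_sub_le_of_le hk hc' h u (X w)
    have h2 := diffBound_pos hk
    have h3 : 0 ≤ (c - c') / c := div_nonneg (sub_nonneg.2 h) hc.le
    calc _ ≤ |diffQuot k c u (X w) - diffQuot k c' u (X w)| * 1 :=
          mul_le_mul_of_nonneg_left (hX1 w) (abs_nonneg _)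
      _ ≤ 2 * diffBound k * |X w| * ((c - c') / c) := by rwa [mul_one]
      _ ≤ 2 * diffBound k * 1 * ((c - c') / c) := by gcongr; exact hX1 w
      _ = _ := by ring

-- Without clipping the quotient is exact, so the gain depends on `c` only within distance `k * c`
-- of the endpoints. `lyapunov_le_of_le` rests on this.
omit [IsProbabilityMeasure π] hX in
theorem gain_eq {c u : ℝ} (hc : 0 < c) (h0 : k * c ≤ u) (h1 : u ≤ 1 - k * c) :
    gain π X k c u = ∫ w, X w ^ 2 ∂π := by
  unfold gain
  refine integral_congr_ae (ae_of_all _ fun w => ?_)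
  change diffQuot k c u (X w) * X w = X w ^ 2
  rw [diffQuot_eq hk hc (hX1 w) h0 h1, sq]

end gain

/-! ### Weighted squared distances -/

section weightedSq

/-- The primitive of `2 (v - a) p v` that vanishes at `a`. -/
def weightedSq (p : ℝ → ℝ) (a u : ℝ) : ℝ := ∫ v in a..u, 2 * (v - a) * p v

variable {p : ℝ → ℝ} (hp : Continuous p)
include hp

theorem weightedSq_sub (a u v : ℝ) :
    weightedSq p a v - weightedSq p a u = ∫ z in u..v, 2 * (z - a) * p z := by
  have hi : ∀ b c, IntervalIntegrable (fun z => 2 * (z - a) * p z) volume b c := fun b c =>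
    (by fun_prop : Continuous fun z => 2 * (z - a) * p z).intervalIntegrable b c
  exact intervalIntegral.integral_interval_sub_left (hi _ _) (hi _ _)

theorem continuous_weightedSq (a : ℝ) : Continuous (weightedSq p a) :=
  intervalIntegral.continuous_primitive
    (fun b c => (by fun_prop : Continuous fun z => 2 * (z - a) * p z).intervalIntegrable b c) a

theorem weightedSq_le_of_le (hp0 : ∀ v, 0 ≤ p v) {a b u : ℝ} (hab : a ≤ b) (hbu : b ≤ u) :
    weightedSq p a b ≤ weightedSq p a u := by
  rw [← sub_nonneg, weightedSq_sub hp]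
  refine intervalIntegral.integral_nonneg hbu fun z hz => ?_
  have := hp0 z
  have : 0 ≤ z - a := by linarith [hz.1]
  positivity

theorem weightedSq_le_of_ge (hp0 : ∀ v, 0 ≤ p v) {a b u : ℝ} (hab : b ≤ a) (hbu : u ≤ b) :
    weightedSq p a b ≤ weightedSq p a u := by
  rw [← sub_nonneg, weightedSq_sub hp, intervalIntegral.integral_symm, ← intervalIntegral.integral_neg]
  refine intervalIntegral.integral_nonneg hbu fun z hz => ?_
  have := hp0 z
  have : 0 ≤ a - z := by linarith [hz.2]
  rw [show -(2 * (z - a) * p z) = 2 * (a - z) * p z by ring]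
  positivity

theorem weightedSq_nonneg (hp0 : ∀ v, 0 ≤ p v) (a u : ℝ) : 0 ≤ weightedSq p a u := by
  have h : weightedSq p a a = 0 := by simp [weightedSq]
  rcases le_total a u with hu | hu
  · rw [← h]; exact weightedSq_le_of_le hp hp0 le_rfl hu
  · rw [← h]; exact weightedSq_le_of_ge hp hp0 le_rfl hu

/-- For a nonnegative weight the primitive is monotone on each side of `a`, and clipping moves `u`
towards `a` without passing it. -/
theorem weightedSq_clip_le (hp0 : ∀ v, 0 ≤ p v) {a : ℝ} (ha : a ∈ Set.Icc (0 : ℝ) 1) (u : ℝ) :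
    weightedSq p a (clip u) ≤ weightedSq p a u := by
  rcases le_total u 0 with h0 | h0
  · have : clip u = 0 := by unfold clip; rw [min_eq_right (by linarith), max_eq_left h0]
    rw [this]
    exact weightedSq_le_of_ge hp hp0 ha.1 h0
  rcases le_total u 1 with h1 | h1
  · rw [clip_of_mem ⟨h0, h1⟩]
  · have : clip u = 1 := by unfold clip; rw [min_eq_left h1, max_eq_right zero_le_one]
    rw [this]
    exact weightedSq_le_of_le hp hp0 ha.2 h1

/-- A second-order bound without differentiating the weight: between `u` and `u + h` the integrand
`2 * (z - a) * p z` differs from its value at `u` by at most `2 * (B + L) * |h|`, since `|u - a| ≤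
1`. -/
theorem weightedSq_add_le {B L : ℝ} (hL : 0 ≤ L) (hpB : ∀ v, |p v| ≤ B)
    (hpL : ∀ u v, |p u - p v| ≤ L * |u - v|) {a u : ℝ} (ha : a ∈ Set.Icc (0 : ℝ) 1)
    (hu : u ∈ Set.Icc (0 : ℝ) 1) (h : ℝ) :
    weightedSq p a (u + h) ≤ weightedSq p a u + 2 * (u - a) * p u * h + 2 * (B + L) * h ^ 2 := by
  have hi : ∀ b c, IntervalIntegrable (fun z => 2 * (z - a) * p z) volume b c := fun b c =>
    (by fun_prop : Continuous fun z => 2 * (z - a) * p z).intervalIntegrable b c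
  have hB : 0 ≤ B := (abs_nonneg _).trans (hpB 0)
  have e : weightedSq p a (u + h) - weightedSq p a u - 2 * (u - a) * p u * h
      = ∫ z in u..(u + h), (2 * (z - a) * p z - 2 * (u - a) * p u) := by
    rw [weightedSq_sub hp, intervalIntegral.integral_sub (hi _ _) intervalIntegrable_const]
    simp
    ring
  have hb := intervalIntegral.norm_integral_le_of_norm_le_const (a := u) (b := u + h)
    (f := fun z => 2 * (z - a) * p z - 2 * (u - a) * p u) (C := 2 * (B + L) * |h|)
    (fun z hz => ?_)
  · rw [← e, Real.norm_eq_abs, add_sub_cancel_left] at hb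
    have hh : 2 * (B + L) * |h| * |h| = 2 * (B + L) * h ^ 2 := by rw [mul_assoc, abs_mul_abs_self, sq]
    linarith [le_abs_self (weightedSq p a (u + h) - weightedSq p a u - 2 * (u - a) * p u * h)]
  · have hzu : |z - u| ≤ |h| := by
      have h3 := Set.abs_sub_left_of_mem_uIcc (Set.uIoc_subset_uIcc hz)
      simpa using h3
    have hua : |u - a| ≤ 1 := abs_le.2 ⟨by linarith [hu.1, ha.2], by linarith [hu.2, ha.1]⟩
    rw [show 2 * (z - a) * p z - 2 * (u - a) * p u
      = 2 * ((z - u) * p z + (u - a) * (p z - p u)) by ring, Real.norm_eq_abs, abs_mul, abs_two]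
    have h1 : |(z - u) * p z| ≤ |h| * B := by
      rw [abs_mul]; exact mul_le_mul hzu (hpB z) (abs_nonneg _) (abs_nonneg _)
    have h2 : |(u - a) * (p z - p u)| ≤ 1 * (L * |h|) := by
      rw [abs_mul]
      exact mul_le_mul hua ((hpL z u).trans (mul_le_mul_of_nonneg_left hzu hL))
        (abs_nonneg _) zero_le_one
    linarith [abs_add_le ((z - u) * p z) ((u - a) * (p z - p u))]

/-- The weights differ only in two boundary strips of total measure at most `2 * l`, where the
integrands differ by at most `2 * M`. In the application `M` carries a factor `1 / c` and `l` a
factor `c`, which cancel. -/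
theorem weightedSq_le_add {q : ℝ → ℝ} (hq : Continuous q) {M l : ℝ} (hM : 0 ≤ M) (hl : 0 ≤ l)
    (hpq : ∀ v ∈ Set.Icc (0 : ℝ) 1, |q v - p v| ≤ M)
    (hpq' : ∀ v, l ≤ v → v ≤ 1 - l → q v = p v) {a u : ℝ} (ha : a ∈ Set.Icc (0 : ℝ) 1)
    (hu : u ∈ Set.Icc (0 : ℝ) 1) :
    weightedSq q a u ≤ weightedSq p a u + 4 * M * l := by
  have hi : IntervalIntegrable (fun z => 2 * (z - a) * p z) volume a u :=
    (by fun_prop : Continuous fun z => 2 * (z - a) * p z).intervalIntegrable _ _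
  have hi' : IntervalIntegrable (fun z => 2 * (z - a) * q z) volume a u :=
    (by fun_prop : Continuous fun z => 2 * (z - a) * q z).intervalIntegrable _ _
  set S : Set ℝ := Set.Icc 0 l ∪ Set.Icc (1 - l) 1
  have hS : MeasurableSet S := measurableSet_Icc.union measurableSet_Icc
  have hSv : volume.real S ≤ 2 * l := by
    refine (measureReal_union_le _ _).trans ?_
    rw [Real.volume_real_Icc, Real.volume_real_Icc]
    rw [max_eq_left (by linarith), max_eq_left (by linarith)]
    linarith
  have hSf : volume S ≠ ∞ := ((measure_union_le _ _).trans_lt (by simp)).ne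
  have hsub : Set.uIoc a u ⊆ Set.Icc 0 1 :=
    Set.uIoc_subset_uIcc.trans (Set.uIcc_subset_Icc ha hu)
  have key : ‖∫ z in a..u, (2 * (z - a) * q z - 2 * (z - a) * p z)‖ ≤ 4 * M * l := by
    refine intervalIntegral.norm_integral_le_integral_norm_uIoc.trans ?_
    calc _ ≤ ∫ z in Set.uIoc a u, S.indicator (fun _ => 2 * M) z := by
          refine setIntegral_mono_on ?_ ?_ measurableSet_uIoc fun z hz => ?_
          · exact (intervalIntegrable_iff.1 (hi'.sub hi)).norm
          · exact ((integrable_indicator_iff hS).2 (integrableOn_const hSf)).integrableOn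
          · have hz1 := hsub hz
            have hza : |z - a| ≤ 1 :=
              abs_le.2 ⟨by linarith [hz1.1, ha.2], by linarith [hz1.2, ha.1]⟩
            rw [← mul_sub, Real.norm_eq_abs, abs_mul, abs_mul, abs_two]
            by_cases hzS : z ∈ S
            · rw [Set.indicator_of_mem hzS]
              nlinarith [hpq z hz1, abs_nonneg (q z - p z), abs_nonneg (z - a)]
            · rw [Set.indicator_of_notMem hzS, hpq' z, sub_self, abs_zero, mul_zero]
              · by_contra hcon
                exact hzS (Or.inl ⟨hz1.1, by linarith⟩)
              · by_contra hcon
                exact hzS (Or.inr ⟨by linarith, hz1.2⟩)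
      _ ≤ ∫ z, S.indicator (fun _ => 2 * M) z := by
          refine setIntegral_le_integral
            ((integrable_indicator_iff hS).2 (integrableOn_const hSf))
            (ae_of_all _ fun z => Set.indicator_nonneg (fun _ _ => by positivity) z)
      _ = volume.real S * (2 * M) := by
          rw [integral_indicator hS, setIntegral_const, smul_eq_mul]
      _ ≤ 2 * l * (2 * M) := by gcongr
      _ = _ := by ring
  rw [intervalIntegral.integral_sub hi' hi, Real.norm_eq_abs] at key
  have := (le_abs_self _).trans key
  unfold weightedSq
  linarith

end weightedSq

/-! ### The uniform distribution on the sphere -/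

section sphere

variable {d : ℕ}

/-- The action of a linear isometry on the unit sphere. -/
def sphereMap (e : E d ≃ₗᵢ[ℝ] E d) (w : Metric.sphere (0 : E d) 1) : Metric.sphere (0 : E d) 1 :=
  ⟨e w, by simp [e.norm_map]⟩

theorem measurable_sphereMap (e : E d ≃ₗᵢ[ℝ] E d) : Measurable (sphereMap e) :=
  Continuous.measurable
    (Continuous.subtype_mk (e.continuous.comp continuous_subtype_val) _)

/-- Surface measure is, up to a constant, the volume of the cone over a set; an isometry commutes
with forming cones and preserves volume. -/
theorem measurePreserving_sphereMap (e : E d ≃ₗᵢ[ℝ] E d) :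
    MeasurePreserving (sphereMap e) (uniformSphere d) (uniformSphere d) := by
  refine ⟨measurable_sphereMap e, ?_⟩
  unfold uniformSphere
  rw [Measure.map_smul]
  congr 1
  ext s hs
  rw [Measure.map_apply (measurable_sphereMap e) hs,
    Measure.toSphere_apply' _ (measurable_sphereMap e hs), Measure.toSphere_apply' _ hs]
  congr 1
  refine Eq.trans ?_ (e.measurePreserving.measure_preimage_equiv (f := e.toMeasurableEquiv) _)
  congr 1
  ext x
  simp only [Set.mem_smul, Set.mem_image, Set.mem_preimage]
  constructor
  · rintro ⟨r, hr, _, ⟨w, hw, rfl⟩, rfl⟩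
    exact ⟨r, hr, _, ⟨_, hw, rfl⟩, by simp [sphereMap]⟩
  · rintro ⟨r, hr, _, ⟨w, hw, rfl⟩, h⟩
    refine ⟨r, hr, _, ⟨sphereMap e.symm w, ?_, rfl⟩, ?_⟩
    · have : sphereMap e (sphereMap e.symm w) = w := by ext1; simp [sphereMap]
      rwa [this]
    · apply e.injective
      simpa [sphereMap] using h

/-- The change of sign of one coordinate. -/
def flip (i : Fin d) : E d ≃ₗᵢ[ℝ] E d :=
  LinearIsometryEquiv.piLpCongrRight 2 fun j =>
    if j = i then LinearIsometryEquiv.neg ℝ else LinearIsometryEquiv.refl ℝ ℝ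

theorem flip_apply (i j : Fin d) (x : E d) : flip i x j = if j = i then -x j else x j := by
  unfold flip
  simp only [LinearIsometryEquiv.piLpCongrRight_apply]
  split_ifs <;> simp

theorem abs_sphere_apply_le (w : Metric.sphere (0 : E d) 1) (i : Fin d) : |(w : E d) i| ≤ 1 := by
  have := PiLp.norm_apply_le (w : E d) i
  rwa [norm_eq_of_mem_sphere, Real.norm_eq_abs] at this

theorem measurable_sphere_apply (i : Fin d) :
    Measurable fun w : Metric.sphere (0 : E d) 1 => (w : E d) i := by
  fun_prop

theorem sum_sphere_sq (w : Metric.sphere (0 : E d) 1) : ∑ i, (w : E d) i ^ 2 = 1 := by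
  have := EuclideanSpace.norm_sq_eq (w : E d)
  rw [norm_eq_of_mem_sphere] at this
  simpa using this.symm

/-- An expression that is odd in a coordinate of the direction averages to zero. -/
theorem integral_uniformSphere_eq_zero (i : Fin d) {f : Metric.sphere (0 : E d) 1 → ℝ}
    (hf : ∀ w, f (sphereMap (flip i) w) = -f w) (hfm : Measurable f) :
    ∫ w, f w ∂uniformSphere d = 0 := by
  have h := integral_map (μ := uniformSphere d) (measurable_sphereMap (flip i)).aemeasurable
    (f := f) hfm.aestronglyMeasurable
  rw [(measurePreserving_sphereMap (flip i)).map_eq] at h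
  simp only [hf, integral_neg] at h
  linarith

/-- The integrand is continuous and nonzero at the `i`-th basis vector, and surface measure charges
nonempty open sets. -/
theorem integral_sphere_sq_pos [IsProbabilityMeasure (uniformSphere d)] (i : Fin d) :
    0 < ∫ w, (w : E d) i ^ 2 ∂uniformSphere d := by
  have hi : Integrable (fun w : Metric.sphere (0 : E d) 1 => (w : E d) i ^ 2)
      (uniformSphere d) := by
    refine Integrable.of_bound (C := 1) (by fun_prop) (ae_of_all _ fun w => ?_)
    rw [norm_pow, Real.norm_eq_abs]
    exact pow_le_one₀ (abs_nonneg _) (abs_sphere_apply_le w i)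
  rw [integral_pos_iff_support_of_nonneg (fun w => sq_nonneg _) hi]
  have ho : IsOpen (Function.support fun w : Metric.sphere (0 : E d) 1 => (w : E d) i ^ 2) := by
    apply Continuous.isOpen_support
    fun_prop
  have hne : (Function.support fun w : Metric.sphere (0 : E d) 1 => (w : E d) i ^ 2).Nonempty :=
    ⟨⟨EuclideanSpace.single i 1, by simp⟩, by simp⟩
  unfold uniformSphere
  rw [Measure.smul_apply, smul_eq_mul, pos_iff_ne_zero]
  refine mul_ne_zero ?_ (ho.measure_ne_zero _ hne)
  exact ENNReal.inv_ne_zero.2 (measure_ne_top _ _)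

end sphere

/-! ### Independence and Fubini's theorem -/

section indep

variable {Ω α β γ δ : Type*} [MeasurableSpace Ω] [MeasurableSpace α] [MeasurableSpace β]
  [MeasurableSpace γ] [MeasurableSpace δ] {P : Measure Ω} [IsProbabilityMeasure P]

/-- On rectangles the probability factors first by independence of `R` from the pair, then by
independence of `X` and `Y`. This is the tool for regrouping inputs that are only known to be
independent in blocks. -/
theorem indepFun_prodMk_left {X : Ω → α} {Y : Ω → β} {R : Ω → γ} (hX : Measurable X)
    (hY : Measurable Y) (hR : Measurable R) (hXY : IndepFun X Y P)
    (hR' : IndepFun (fun ω => (X ω, Y ω)) R P) : IndepFun (fun ω => (X ω, R ω)) Y P := by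
  have hXR : IndepFun X R P := hR'.comp measurable_fst measurable_id
  rw [indepFun_iff_map_prod_eq_prod_map_map (by fun_prop) (by fun_prop), Measure.ext_prod₃_iff']
  have := Measure.isProbabilityMeasure_map (μ := P) hY.aemeasurable
  intro s t u hs ht hu
  have e1 : (fun ω => ((X ω, R ω), Y ω)) ⁻¹' ((s ×ˢ t) ×ˢ u)
      = (fun ω => (X ω, Y ω)) ⁻¹' (s ×ˢ u) ∩ R ⁻¹' t := by
    ext ω; simp only [Set.mem_preimage, Set.mem_prod, Set.mem_inter_iff]; tauto
  have e2 : (fun ω => (X ω, Y ω)) ⁻¹' (s ×ˢ u) = X ⁻¹' s ∩ Y ⁻¹' u := rfl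
  have e3 : (fun ω => (X ω, R ω)) ⁻¹' (s ×ˢ t) = X ⁻¹' s ∩ R ⁻¹' t := rfl
  rw [Measure.map_apply (by fun_prop) ((hs.prod ht).prod hu), e1,
    hR'.measure_inter_preimage_eq_mul _ _ (hs.prod hu) ht, e2,
    hXY.measure_inter_preimage_eq_mul _ _ hs hu, Measure.prod_prod,
    Measure.map_apply (by fun_prop) (hs.prod ht), Measure.map_apply hY hu, e3,
    hXR.measure_inter_preimage_eq_mul _ _ hs ht, mul_right_comm]

theorem indepFun_prodMk_prodMk {A₁ : Ω → α} {A₂ : Ω → β} {B₁ : Ω → γ} {B₂ : Ω → δ}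
    (hA₁ : Measurable A₁) (hA₂ : Measurable A₂) (hB₁ : Measurable B₁) (hB₂ : Measurable B₂)
    (hA : IndepFun A₁ A₂ P) (hB : IndepFun B₁ B₂ P)
    (hAB : IndepFun (fun ω => (A₁ ω, A₂ ω)) (fun ω => (B₁ ω, B₂ ω)) P) :
    IndepFun (fun ω => (A₁ ω, B₁ ω)) (fun ω => (A₂ ω, B₂ ω)) P := by
  have h1 : IndepFun (fun ω => (A₁ ω, B₁ ω)) A₂ P :=
    indepFun_prodMk_left hA₁ hA₂ hB₁ hA (hAB.comp measurable_id measurable_fst)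
  have h2 : IndepFun (fun ω => (B₁ ω, (A₁ ω, A₂ ω))) B₂ P :=
    indepFun_prodMk_left hB₁ hB₂ (hA₁.prodMk hA₂) hB hAB.symm
  have h3 : IndepFun (fun ω => (A₂ ω, (A₁ ω, B₁ ω))) B₂ P :=
    h2.comp (φ := fun p : γ × (α × β) => (p.2.2, (p.2.1, p.1))) (by fun_prop) measurable_id
  exact (indepFun_prodMk_left hA₂ (hA₁.prodMk hB₁) hB₂ h1.symm h3).symm

/-- Fubini's theorem for independent random variables. -/
theorem integral_comp_indepFun {X : Ω → α} {Y : Ω → β} (hX : Measurable X) (hY : Measurable Y)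
    (h : IndepFun X Y P) {κ : Measure β} (hκ : P.map Y = κ) {H : α × β → ℝ} (hH : Measurable H)
    (hi : Integrable (fun ω => H (X ω, Y ω)) P) :
    ∫ ω, H (X ω, Y ω) ∂P = ∫ ω, ∫ y, H (X ω, y) ∂κ ∂P := by
  subst hκ
  have := Measure.isProbabilityMeasure_map (μ := P) hY.aemeasurable
  have := Measure.isProbabilityMeasure_map (μ := P) hX.aemeasurable
  have hlaw := (indepFun_iff_map_prod_eq_prod_map_map hX.aemeasurable hY.aemeasurable).1 h
  have hi' : Integrable H ((P.map X).prod (P.map Y)) := by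
    rw [← hlaw, integrable_map_measure hH.aestronglyMeasurable (by fun_prop)]
    exact hi
  calc ∫ ω, H (X ω, Y ω) ∂P = ∫ p, H p ∂(P.map fun ω => (X ω, Y ω)) :=
        (integral_map (by fun_prop) hH.aestronglyMeasurable).symm
    _ = ∫ x, ∫ y, H (x, y) ∂(P.map Y) ∂(P.map X) := by rw [hlaw, integral_prod _ hi']
    _ = _ := integral_map hX.aemeasurable
        hH.stronglyMeasurable.integral_prod_right'.aestronglyMeasurable

theorem integrable_comp_indepFun {X : Ω → α} {Y : Ω → β} (hX : Measurable X) (hY : Measurable Y)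
    (h : IndepFun X Y P) {κ : Measure β} (hκ : P.map Y = κ) {H : α × β → ℝ} (hH : Measurable H)
    (hH0 : ∀ p, 0 ≤ H p) (hi : ∀ ω, Integrable (fun y => H (X ω, y)) κ) {C : ℝ}
    (hC : ∀ ω, ∫ y, H (X ω, y) ∂κ ≤ C) :
    Integrable (fun ω => H (X ω, Y ω)) P := by
  subst hκ
  have := Measure.isProbabilityMeasure_map (μ := P) hY.aemeasurable
  have := Measure.isProbabilityMeasure_map (μ := P) hX.aemeasurable
  have hlaw := (indepFun_iff_map_prod_eq_prod_map_map hX.aemeasurable hY.aemeasurable).1 h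
  refine ⟨(hH.comp (hX.prodMk hY)).aestronglyMeasurable, ?_⟩
  rw [hasFiniteIntegral_iff_ofReal (ae_of_all _ fun ω => hH0 _)]
  have hHm : Measurable fun p => ENNReal.ofReal (H p) := hH.ennreal_ofReal
  calc ∫⁻ ω, ENNReal.ofReal (H (X ω, Y ω)) ∂P
      = ∫⁻ p, ENNReal.ofReal (H p) ∂(P.map fun ω => (X ω, Y ω)) :=
        (lintegral_map hHm (hX.prodMk hY)).symm
    _ = ∫⁻ x, ∫⁻ y, ENNReal.ofReal (H (x, y)) ∂(P.map Y) ∂(P.map X) := by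
        rw [hlaw, lintegral_prod _ hHm.aemeasurable]
    _ = ∫⁻ ω, ∫⁻ y, ENNReal.ofReal (H (X ω, y)) ∂(P.map Y) ∂P :=
        lintegral_map hHm.lintegral_prod_right' hX
    _ ≤ ∫⁻ _, ENNReal.ofReal C ∂P := by
        refine lintegral_mono fun ω => ?_
        rw [← ofReal_integral_eq_lintegral_ofReal (hi ω) (ae_of_all _ fun y => hH0 _)]
        exact ENNReal.ofReal_le_ofReal (hC ω)
    _ < ∞ := by simp

/-- The conditional expectation of a function of independent random variables `X`, `Y`, when the
partial integral over `Y` depends on a function `V` of `X` only. -/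
theorem condExp_comp_indepFun {X : Ω → α} {Y : Ω → β} (hX : Measurable X) (hY : Measurable Y)
    (h : IndepFun X Y P) {κ : Measure β} (hκ : P.map Y = κ) {H : α × β → ℝ} (hH : Measurable H)
    (hi : Integrable (fun ω => H (X ω, Y ω)) P) {φ : α → γ} (hφ : Measurable φ) {g : γ → ℝ}
    (hg : Measurable g) {C : ℝ} (hgC : ∀ z, |g z| ≤ C)
    (hHg : ∀ ω, ∫ y, H (X ω, y) ∂κ = g (φ (X ω))) :
    P[fun ω => H (X ω, Y ω) | MeasurableSpace.comap (fun ω => φ (X ω)) inferInstance]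
      =ᵐ[P] fun ω => g (φ (X ω)) := by
  have hle : MeasurableSpace.comap (fun ω => φ (X ω)) inferInstance ≤ ‹MeasurableSpace Ω› :=
    (hφ.comp hX).comap_le
  have hgm : Measurable fun ω => g (φ (X ω)) := hg.comp (hφ.comp hX)
  have hgi : Integrable (fun ω => g (φ (X ω))) P :=
    Integrable.of_bound hgm.aestronglyMeasurable C (ae_of_all _ fun ω => hgC _)
  refine (ae_eq_condExp_of_forall_setIntegral_eq hle hi (fun _ _ _ => hgi.integrableOn) ?_ ?_).symm
  · rintro _ ⟨s, hs, rfl⟩ -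
    have hs' : MeasurableSet ((fun ω => φ (X ω)) ⁻¹' s) := (hφ.comp hX) hs
    have hsα : MeasurableSet (φ ⁻¹' s) := hφ hs
    have hi2 : Integrable (((fun ω => φ (X ω)) ⁻¹' s).indicator fun ω => H (X ω, Y ω)) P :=
      hi.indicator hs'
    -- A set of the conditioning σ-algebra is an event about `X` alone, so its indicator can be
    -- absorbed into `H` before Fubini.
    have := integral_comp_indepFun hX hY h hκ
      (H := ((Prod.fst : α × β → α) ⁻¹' (φ ⁻¹' s)).indicator H)
      (hH.indicator (measurable_fst hsα)) hi2
    rw [← integral_indicator hs', ← integral_indicator hs']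
    refine Eq.trans ?_ this.symm
    refine integral_congr_ae (ae_of_all _ fun ω => ?_)
    by_cases hω : φ (X ω) ∈ s
    · simp [Set.indicator, hω, ← hHg]
    · simp [Set.indicator, hω]
  · exact (hg.comp (comap_measurable _)).aestronglyMeasurable

end indep

/-! ### Linear combinations of the sample means of a round -/

section combination

variable {d : ℕ} {S : Type*} (A : Params d) (M : Model d S) (t : ℕ) (b : Fin 4 → ℝ)

/-- The pairs of subsets of a round. -/
abbrev Design : Type := Finset (Fin (2 * A.m₁)) × Finset (Fin (2 * A.m₂))

/-- The linear combination of the sample means at `θ⁺⁺, θ⁺, θ⁻, θ⁻⁻` with coefficients `b`. -/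
def combination (x : E d) (z : Round A S) : ℝ :=
  b 0 * barPlusPlus A M t x z + b 1 * barPlus A M t x z + b 2 * barMinus A M t x z
    + b 3 * barMinusMinus A M t x z

/-- The signed distance, in units of `c_t`, at which a customer is served. -/
def ratio (R : Design A) : A.Customer → ℝ :=
  Sum.elim (fun i => if i ∈ R.1 then 1 else -1) (fun i => if i ∈ R.2 then A.k else -A.k)

/-- The coefficient of the outcome of a customer in a combination of sample means. -/
def weight (R : Design A) : A.Customer → ℝ :=
  Sum.elim (fun i => if i ∈ R.1 then b 1 / A.m₁ else b 2 / A.m₁)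
    (fun i => if i ∈ R.2 then b 0 / A.m₂ else b 3 / A.m₂)

/-- Each customer contributes one term whose weight and evaluation point are fixed by the iterate,
the direction and the design; once these are frozen the terms are independent. -/
theorem combination_eq_sum (x : E d) (z : Round A S) :
    combination A M t b x z = ∑ j, weight A b (z.R₁, z.R₂) j
      * M.Y (evalPoint A t x z (ratio A (z.R₁, z.R₂) j)) (z.ξ j) := by
  have key : ∀ {n : ℕ} (R : Finset (Fin n)) (f g : Fin n → ℝ),
      ∑ i, (if i ∈ R then f i else g i) = ∑ i ∈ R, f i + ∑ i ∈ Rᶜ, g i := fun R f g => by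
    rw [← Finset.sum_add_sum_compl R]
    congr 1
    · exact Finset.sum_congr rfl fun i hi => if_pos hi
    · exact Finset.sum_congr rfl fun i hi => if_neg (Finset.mem_compl.1 hi)
  have e1 : ∀ i, weight A b (z.R₁, z.R₂) (Sum.inl i)
      * M.Y (evalPoint A t x z (ratio A (z.R₁, z.R₂) (Sum.inl i))) (z.ξ (Sum.inl i))
      = if i ∈ z.R₁ then b 1 / A.m₁ * M.Y (evalPoint A t x z 1) (z.ξ (Sum.inl i))
        else b 2 / A.m₁ * M.Y (evalPoint A t x z (-1)) (z.ξ (Sum.inl i)) := fun i => by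
    simp only [weight, ratio, Sum.elim_inl]; split_ifs <;> rfl
  have e2 : ∀ i, weight A b (z.R₁, z.R₂) (Sum.inr i)
      * M.Y (evalPoint A t x z (ratio A (z.R₁, z.R₂) (Sum.inr i))) (z.ξ (Sum.inr i))
      = if i ∈ z.R₂ then b 0 / A.m₂ * M.Y (evalPoint A t x z A.k) (z.ξ (Sum.inr i))
        else b 3 / A.m₂ * M.Y (evalPoint A t x z (-A.k)) (z.ξ (Sum.inr i)) := fun i => by
    simp only [weight, ratio, Sum.elim_inr]; split_ifs <;> rfl
  rw [Fintype.sum_sum_type]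
  simp only [e1, e2, key, ← Finset.mul_sum]
  unfold combination barPlusPlus barPlus barMinus barMinusMinus
  ring

/-- Only the sizes of a subset and of its complement matter. This removes the design from
conditional means and variances, so that conditioning on `(θ^t, w^t)` is enough. -/
theorem sum_weight_ratio {A : Params d} (R : Design A) (h₁ : R.1.card = A.m₁)
    (h₂ : R.2.card = A.m₂) (f : ℝ → ℝ → ℝ) :
    ∑ j, f (weight A b R j) (ratio A R j)
      = A.m₁ * f (b 1 / A.m₁) 1 + A.m₁ * f (b 2 / A.m₁) (-1)
        + (A.m₂ * f (b 0 / A.m₂) A.k + A.m₂ * f (b 3 / A.m₂) (-A.k)) := by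
  have key : ∀ {n m : ℕ} (R : Finset (Fin (2 * m))) (_ : R.card = m) (u v : ℝ),
      ∑ i, (if i ∈ R then u else v) = m * u + m * v := fun {n m} R hR u v => by
    have hc : Rᶜ.card = m := by rw [Finset.card_compl, hR, Fintype.card_fin]; omega
    rw [← Finset.sum_add_sum_compl R,
      Finset.sum_congr rfl (fun i hi => if_pos hi),
      Finset.sum_congr rfl (fun i hi => if_neg (Finset.mem_compl.1 hi)),
      Finset.sum_const, Finset.sum_const, hR, hc, nsmul_eq_mul, nsmul_eq_mul]
  have e1 : ∀ i, f (weight A b R (Sum.inl i)) (ratio A R (Sum.inl i))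
      = if i ∈ R.1 then f (b 1 / A.m₁) 1 else f (b 2 / A.m₁) (-1) := fun i => by
    simp only [weight, ratio, Sum.elim_inl]; split_ifs <;> rfl
  have e2 : ∀ i, f (weight A b R (Sum.inr i)) (ratio A R (Sum.inr i))
      = if i ∈ R.2 then f (b 0 / A.m₂) A.k else f (b 3 / A.m₂) (-A.k) := fun i => by
    simp only [weight, ratio, Sum.elim_inr]; split_ifs <;> rfl
  rw [Fintype.sum_sum_type]
  simp only [e1, e2]
  -- Nothing in `key` determines the implicit `n`; `0` is an arbitrary choice.
  rw [key (n := 0) _ h₁, key (n := 0) _ h₂]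

/-- The point at signed distance `r c_t` from `x` in direction `w`, projected to the cube. -/
def shifted (x : E d) (w : Metric.sphere (0 : E d) 1) (r : ℝ) : E d :=
  proj (x + (r * A.c t) • (w : E d))

theorem shifted_mem (x : E d) (w : Metric.sphere (0 : E d) 1) (r : ℝ) :
    shifted A t x w r ∈ cube d := proj_mem_cube _

/-- The conditional mean of a combination of sample means. -/
def combMean (p : E d × Metric.sphere (0 : E d) 1) : ℝ :=
  b 0 * M.μ (shifted A t p.1 p.2 A.k) + b 1 * M.μ (shifted A t p.1 p.2 1)
    + b 2 * M.μ (shifted A t p.1 p.2 (-1)) + b 3 * M.μ (shifted A t p.1 p.2 (-A.k))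

/-- The conditional variance of a combination of sample means. -/
def combVar (p : E d × Metric.sphere (0 : E d) 1) : ℝ :=
  b 0 ^ 2 / A.m₂ * M.σ (shifted A t p.1 p.2 A.k) ^ 2
    + b 1 ^ 2 / A.m₁ * M.σ (shifted A t p.1 p.2 1) ^ 2
    + b 2 ^ 2 / A.m₁ * M.σ (shifted A t p.1 p.2 (-1)) ^ 2
    + b 3 ^ 2 / A.m₂ * M.σ (shifted A t p.1 p.2 (-A.k)) ^ 2

/-- The iterate and the design of a round. -/
abbrev State : Type := E d × Design A

/-- The combination of sample means as a function of the iterate, the design, the direction and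
the draws of the customers. -/
def combFun (p : (State A × Metric.sphere (0 : E d) 1) × (A.Customer → S)) : ℝ :=
  combination A M t b p.1.1.1 ⟨p.1.2, p.1.1.2.1, p.1.1.2.2, p.2⟩

/-- The iterate and the direction. -/
def iterateDirection (p : State A × Metric.sphere (0 : E d) 1) : E d × Metric.sphere (0 : E d) 1 :=
  (p.1.1, p.2)

theorem measurable_iterateDirection : Measurable (iterateDirection A) := by
  unfold iterateDirection
  fun_prop

/-! ### Moments for a fixed iterate, design and direction. -/

section moments

variable {A M} [MeasurableSpace S] {ρ : Measure S}

theorem measurable_comp_proj {f : E d → ℝ} (hf : ContinuousOn f (cube d)) :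
    Measurable fun x => f (proj x) :=
  (hf.comp_continuous continuous_proj proj_mem_cube).measurable

theorem measurable_Y_proj (hM : M.IsStandardized ρ) (hμ : ContinuousOn M.μ (cube d))
    (hσ : ContinuousOn M.σ (cube d)) :
    Measurable fun p : E d × S => M.Y (proj p.1) p.2 := by
  unfold Model.Y
  have h1 : Measurable fun p : E d × S => M.μ (proj p.1) :=
    (measurable_comp_proj hμ).comp measurable_fst
  have h2 : Measurable fun p : E d × S => M.σ (proj p.1) :=
    (measurable_comp_proj hσ).comp measurable_fst
  have h3 : Measurable fun p : E d × S => M.ε (proj p.1) p.2 :=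
    hM.measurable.comp
      ((continuous_proj.measurable.comp measurable_fst).prodMk measurable_snd)
  exact h1.add (h2.mul h3)

theorem measurable_combFun (hM : M.IsStandardized ρ) (hμ : ContinuousOn M.μ (cube d))
    (hσ : ContinuousOn M.σ (cube d)) : Measurable (combFun A M t b) := by
  unfold combFun
  simp only [combination_eq_sum]
  refine Finset.measurable_fun_sum _ fun j _ => Measurable.mul ?_ ?_
  · exact (measurable_of_countable fun R : Design A => weight A b R j).comp
      (measurable_snd.comp (measurable_fst.comp measurable_fst))
  · have h1 : Measurable fun p : (State A × Metric.sphere (0 : E d) 1) × (A.Customer → S) =>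
        ratio A p.1.1.2 j :=
      (measurable_of_countable fun R : Design A => ratio A R j).comp
        (measurable_snd.comp (measurable_fst.comp measurable_fst))
    have h2 : Measurable fun p : (State A × Metric.sphere (0 : E d) 1) × (A.Customer → S) =>
        (p.1.1.1 + (ratio A p.1.1.2 j * A.c t) • (p.1.2 : E d), p.2 j) := by
      refine Measurable.prodMk (Measurable.add (by fun_prop) ?_) (by fun_prop)
      exact (h1.mul_const _).smul (by fun_prop)
    exact (measurable_Y_proj hM hμ hσ).comp h2

omit [MeasurableSpace S] in
theorem measurable_combMean (hμ : ContinuousOn M.μ (cube d)) : Measurable (combMean A M t b) := by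
  have h : ∀ r, Measurable fun p : E d × Metric.sphere (0 : E d) 1 =>
      M.μ (shifted A t p.1 p.2 r) := fun r =>
    (measurable_comp_proj hμ).comp (g := fun x => M.μ (proj x)) (by fun_prop :
      Measurable fun p : E d × Metric.sphere (0 : E d) 1 => p.1 + (r * A.c t) • (p.2 : E d))
  unfold combMean
  exact ((((h _).const_mul _).add ((h _).const_mul _)).add ((h _).const_mul _)).add
    ((h _).const_mul _)

omit [MeasurableSpace S] in
theorem measurable_combVar (hσ : ContinuousOn M.σ (cube d)) : Measurable (combVar A M t b) := by
  have h : ∀ r, Measurable fun p : E d × Metric.sphere (0 : E d) 1 =>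
      M.σ (shifted A t p.1 p.2 r) ^ 2 := fun r =>
    ((measurable_comp_proj hσ).comp (g := fun x => M.σ (proj x)) (by fun_prop :
      Measurable fun p : E d × Metric.sphere (0 : E d) 1 =>
        p.1 + (r * A.c t) • (p.2 : E d))).pow_const 2
  unfold combVar
  exact ((((h _).const_mul _).add ((h _).const_mul _)).add ((h _).const_mul _)).add
    ((h _).const_mul _)

variable [IsProbabilityMeasure ρ]

theorem memLp_Y (hM : M.IsStandardized ρ) {x : E d} (hx : x ∈ cube d) : MemLp (M.Y x) 2 ρ :=
  (memLp_const (M.μ x)).add ((hM.memLp x hx).const_mul (M.σ x))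

theorem integral_Y (hM : M.IsStandardized ρ) {x : E d} (hx : x ∈ cube d) :
    ∫ s, M.Y x s ∂ρ = M.μ x := by
  have hi := (hM.memLp x hx).integrable one_le_two
  unfold Model.Y
  rw [integral_add (integrable_const _) (hi.const_mul _), integral_const_mul, hM.mean x hx]
  simp

theorem variance_Y (hM : M.IsStandardized ρ) {x : E d} (hx : x ∈ cube d) :
    Var[M.Y x; ρ] = M.σ x ^ 2 := by
  have hi := (hM.memLp x hx).const_mul (M.σ x)
  have : M.Y x = fun s => M.μ x + M.σ x * M.ε x s := rfl
  rw [this, variance_const_add hi.aestronglyMeasurable, variance_const_mul, hM.variance x hx,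
    mul_one]

variable {t b}

theorem memLp_combFun (hM : M.IsStandardized ρ) (p : State A × Metric.sphere (0 : E d) 1) :
    MemLp (fun y => combFun A M t b (p, y)) 2 (Measure.pi fun _ => ρ) := by
  unfold combFun
  simp only [combination_eq_sum]
  refine memLp_finsetSum _ fun j _ => MemLp.const_mul ?_ _
  exact (memLp_Y hM (shifted_mem A t p.1.1 p.2 (ratio A p.1.2 j))).comp_measurePreserving
    (measurePreserving_eval (fun _ : A.Customer => ρ) j)

theorem integral_combFun (hM : M.IsStandardized ρ) (hm₁ : A.m₁ ≠ 0) (hm₂ : A.m₂ ≠ 0)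
    {p : State A × Metric.sphere (0 : E d) 1} (h₁ : p.1.2.1.card = A.m₁)
    (h₂ : p.1.2.2.card = A.m₂) :
    ∫ y, combFun A M t b (p, y) ∂(Measure.pi fun _ => ρ)
      = combMean A M t b (iterateDirection A p) := by
  unfold combFun
  simp only [combination_eq_sum]
  rw [integral_finsetSum]
  · have h : ∀ j, ∫ y : A.Customer → S, weight A b (p.1.2.1, p.1.2.2) j * M.Y (evalPoint A t p.1.1
        (⟨p.2, p.1.2.1, p.1.2.2, y⟩ : Round A S) (ratio A (p.1.2.1, p.1.2.2) j)) (y j)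
          ∂(Measure.pi fun _ => ρ)
        = weight A b p.1.2 j * M.μ (shifted A t p.1.1 p.2 (ratio A p.1.2 j)) := fun j => by
      rw [integral_const_mul]
      congr 1
      rw [← integral_Y hM (shifted_mem A t p.1.1 p.2 (ratio A p.1.2 j))]
      exact integral_comp_eval (μ := fun _ : A.Customer => ρ) (i := j)
        (memLp_Y hM (shifted_mem A t p.1.1 p.2 (ratio A p.1.2 j))).aestronglyMeasurable
    simp only [h]
    rw [sum_weight_ratio b p.1.2 h₁ h₂ fun u r => u * M.μ (shifted A t p.1.1 p.2 r)]
    unfold combMean iterateDirection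
    have : (A.m₁ : ℝ) ≠ 0 := by exact_mod_cast hm₁
    have : (A.m₂ : ℝ) ≠ 0 := by exact_mod_cast hm₂
    field_simp
    ring
  · intro j _
    refine (MemLp.const_mul ?_ _).integrable one_le_two
    exact (memLp_Y hM (shifted_mem A t p.1.1 p.2 (ratio A p.1.2 j))).comp_measurePreserving
      (measurePreserving_eval (fun _ : A.Customer => ρ) j)

/-- Variances of independent terms add, and `n` customers of weight `b / n` contribute `b ^ 2 / n`
times the variance of one outcome. -/
theorem variance_combFun (hM : M.IsStandardized ρ) (hm₁ : A.m₁ ≠ 0) (hm₂ : A.m₂ ≠ 0)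
    {p : State A × Metric.sphere (0 : E d) 1} (h₁ : p.1.2.1.card = A.m₁)
    (h₂ : p.1.2.2.card = A.m₂) :
    Var[fun y => combFun A M t b (p, y); Measure.pi fun _ => ρ]
      = combVar A M t b (iterateDirection A p) := by
  have e : (fun y => combFun A M t b (p, y)) = ∑ j, fun y : A.Customer → S =>
      (fun s => weight A b p.1.2 j * M.Y (shifted A t p.1.1 p.2 (ratio A p.1.2 j)) s) (y j) := by
    ext y
    rw [Finset.sum_apply]
    exact combination_eq_sum A M t b _ _
  have hv := variance_sum_pi (μ := fun _ : A.Customer => ρ)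
    (X := fun j s => weight A b p.1.2 j * M.Y (shifted A t p.1.1 p.2 (ratio A p.1.2 j)) s)
    fun j => (memLp_Y hM (shifted_mem A t _ _ _)).const_mul _
  rw [e, hv]
  simp only [variance_const_mul, variance_Y hM (shifted_mem A t _ _ _)]
  rw [sum_weight_ratio b p.1.2 h₁ h₂ fun u r => u ^ 2 * M.σ (shifted A t p.1.1 p.2 r) ^ 2]
  unfold combVar iterateDirection
  have : (A.m₁ : ℝ) ≠ 0 := by exact_mod_cast hm₁
  have : (A.m₂ : ℝ) ≠ 0 := by exact_mod_cast hm₂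
  field_simp
  ring

omit [MeasurableSpace S] in
theorem abs_combMean_le {B : ℝ} (hB : ∀ x ∈ cube d, |M.μ x| ≤ B)
    (p : E d × Metric.sphere (0 : E d) 1) : |combMean A M t b p| ≤ (∑ i, |b i|) * B := by
  have h : ∀ i r, |b i * M.μ (shifted A t p.1 p.2 r)| ≤ |b i| * B := fun i r => by
    rw [abs_mul]
    exact mul_le_mul_of_nonneg_left (hB _ (shifted_mem A t _ _ _)) (abs_nonneg _)
  unfold combMean
  rw [Fin.sum_univ_four]
  linarith [abs_add_le (b 0 * M.μ (shifted A t p.1 p.2 A.k) + b 1 * M.μ (shifted A t p.1 p.2 1)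
    + b 2 * M.μ (shifted A t p.1 p.2 (-1))) (b 3 * M.μ (shifted A t p.1 p.2 (-A.k))),
    abs_add_le (b 0 * M.μ (shifted A t p.1 p.2 A.k) + b 1 * M.μ (shifted A t p.1 p.2 1))
      (b 2 * M.μ (shifted A t p.1 p.2 (-1))),
    abs_add_le (b 0 * M.μ (shifted A t p.1 p.2 A.k)) (b 1 * M.μ (shifted A t p.1 p.2 1)),
    h 0 A.k, h 1 1, h 2 (-1), h 3 (-A.k)]

omit [MeasurableSpace S] in
theorem combVar_nonneg (p : E d × Metric.sphere (0 : E d) 1) : 0 ≤ combVar A M t b p := by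
  unfold combVar
  positivity

omit [MeasurableSpace S] in
theorem combVar_le (hm₁ : 1 ≤ A.m₁) (hm₂ : 1 ≤ A.m₂) {B : ℝ} (hB : ∀ x ∈ cube d, |M.σ x| ≤ B)
    (p : E d × Metric.sphere (0 : E d) 1) : combVar A M t b p ≤ (∑ i, b i ^ 2) * B ^ 2 := by
  have h : ∀ (i : Fin 4) (r : ℝ) (m : ℕ), 1 ≤ m →
      b i ^ 2 / m * M.σ (shifted A t p.1 p.2 r) ^ 2 ≤ b i ^ 2 * B ^ 2 := fun i r m hm => by
    have h1 : M.σ (shifted A t p.1 p.2 r) ^ 2 ≤ B ^ 2 :=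
      sq_le_sq' (abs_le.1 (hB _ (shifted_mem A t _ _ _))).1
        (abs_le.1 (hB _ (shifted_mem A t _ _ _))).2
    have h2 : b i ^ 2 / m ≤ b i ^ 2 := div_le_self (sq_nonneg _) (by exact_mod_cast hm)
    exact mul_le_mul h2 h1 (sq_nonneg _) (sq_nonneg _)
  unfold combVar
  rw [Fin.sum_univ_four]
  linarith [h 0 A.k _ hm₂, h 1 1 _ hm₁, h 2 (-1) _ hm₁, h 3 (-A.k) _ hm₂]

theorem integral_combFun_sq_le (hM : M.IsStandardized ρ) (hm₁ : 1 ≤ A.m₁) (hm₂ : 1 ≤ A.m₂)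
    {B : ℝ} (hB : ∀ x ∈ cube d, |M.μ x| ≤ B) (hB' : ∀ x ∈ cube d, |M.σ x| ≤ B)
    {p : State A × Metric.sphere (0 : E d) 1} (h₁ : p.1.2.1.card = A.m₁)
    (h₂ : p.1.2.2.card = A.m₂) :
    ∫ y, combFun A M t b (p, y) ^ 2 ∂(Measure.pi fun _ => ρ)
      ≤ ((∑ i, |b i|) ^ 2 + ∑ i, b i ^ 2) * B ^ 2 := by
  have hv := variance_eq_sub (memLp_combFun (t := t) (b := b) hM p)
  rw [variance_combFun hM (by omega) (by omega) h₁ h₂,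
    integral_combFun hM (by omega) (by omega) h₁ h₂] at hv
  have h1 := combVar_le (t := t) (b := b) hm₁ hm₂ hB' (iterateDirection A p)
  have h2 := abs_combMean_le (A := A) (t := t) (b := b) hB (iterateDirection A p)
  have h3 := sq_le_sq' (abs_le.1 h2).1 (abs_le.1 h2).2
  simp only [Pi.pow_apply] at hv
  rw [mul_pow] at h3
  linarith

end moments

/-- The coefficients of the sample means in the gradient estimator. -/
def gradCoeff : Fin 4 → ℝ :=
  ![-1 / (2 * A.k * (A.k ^ 2 - 1) * A.c t), A.k ^ 3 / (2 * A.k * (A.k ^ 2 - 1) * A.c t),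
    -A.k ^ 3 / (2 * A.k * (A.k ^ 2 - 1) * A.c t), 1 / (2 * A.k * (A.k ^ 2 - 1) * A.c t)]

/-- The coefficients of the sample means in the value estimator. -/
def valueCoeff : Fin 4 → ℝ :=
  ![-1 / (2 * (A.k ^ 2 - 1)), A.k ^ 2 / (2 * (A.k ^ 2 - 1)),
    A.k ^ 2 / (2 * (A.k ^ 2 - 1)), -1 / (2 * (A.k ^ 2 - 1))]

theorem gradEst_eq (x : E d) (z : Round A S) :
    gradEst A M t x z = combination A M t (gradCoeff A t) x z • (z.w : E d) := by
  unfold gradEst combination gradCoeff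
  congr 1
  simp only [Fin.isValue, Matrix.cons_val]
  generalize 2 * A.k * (A.k ^ 2 - 1) * A.c t = D
  ring

theorem valueEst_eq (x : E d) (z : Round A S) :
    valueEst A M t x z = combination A M t (valueCoeff A) x z := by
  unfold valueEst combination valueCoeff
  simp
  ring

end combination

/-! ### The law of a round -/

section run

variable {d : ℕ} {A : Params d} {S Ω : Type*} (Z : Inputs A S Ω) (M : Model d S)

/-- The iterate and the design of round `t`. -/
def Inputs.state (t : ℕ) (ω : Ω) : State A := (iterate Z M t ω, (Z.R₁ t ω, Z.R₂ t ω))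

/-- The draws of the customers of round `t`. -/
def Inputs.draws (t : ℕ) (ω : Ω) : A.Customer → S := fun j => Z.ξ t j ω

variable {Z M}

theorem muHat_eq (t : ℕ) (ω : Ω) :
    muHat Z M t ω
      = combFun A M t (valueCoeff A) ((Z.state M t ω, Z.w t ω), Z.draws t ω) :=
  valueEst_eq A M t _ _

theorem iterate_mem_cube (hθ₀ : A.θ₀ ∈ cube d) (t : ℕ) (ω : Ω) : iterate Z M t ω ∈ cube d := by
  match t with
  | 0 => exact hθ₀
  | 1 => exact hθ₀
  | t + 2 => exact proj_mem_cube _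

theorem iterate_succ {t : ℕ} (ht : 1 ≤ t) (ω : Ω) :
    iterate Z M (t + 1) ω = proj (iterate Z M t ω + (A.α t
      * combFun A M t (gradCoeff A t) ((Z.state M t ω, Z.w t ω), Z.draws t ω)) • (Z.w t ω : E d)) := by
  obtain ⟨s, rfl⟩ : ∃ s, t = s + 1 := ⟨t - 1, by omega⟩
  rw [iterate, gradEst_eq, smul_smul]
  rfl

variable [MeasurableSpace S] {ρ : Measure S}

/-- The σ-algebra on `Ω` is arbitrary and only inputs of rounds before `T` are required to be
measurable, so the lemma also applies to the σ-algebra generated by the past, in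
`indepFun_state_inputs`. -/
theorem measurable_iterate [MeasurableSpace Ω] (hM : M.IsStandardized ρ)
    (hμ : ContinuousOn M.μ (cube d)) (hσ : ContinuousOn M.σ (cube d)) {T : ℕ}
    (hw : ∀ s < T, Measurable (Z.w s)) (hR₁ : ∀ s < T, Measurable (Z.R₁ s))
    (hR₂ : ∀ s < T, Measurable (Z.R₂ s)) (hξ : ∀ s < T, ∀ j, Measurable (Z.ξ s j)) :
    ∀ t ≤ T, Measurable (iterate Z M t)
  | 0, _ => measurable_const
  | 1, _ => measurable_const
  | t + 2, ht => by
    have ih := measurable_iterate hM hμ hσ hw hR₁ hR₂ hξ (t + 1) (by omega)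
    have hs : t + 1 < T := by omega
    have hst : Measurable fun ω => ((Z.state M (t + 1) ω, Z.w (t + 1) ω), Z.draws (t + 1) ω) :=
      ((ih.prodMk ((hR₁ _ hs).prodMk (hR₂ _ hs))).prodMk (hw _ hs)).prodMk
        (measurable_pi_lambda _ fun j => hξ _ hs j)
    have hc := ((measurable_combFun (t + 1) (gradCoeff A (t + 1)) hM hμ hσ).comp hst).const_mul
      (A.α (t + 1))
    have hg : Measurable fun ω => (Z.w (t + 1) ω : E d) :=
      measurable_subtype_coe.comp (hw _ hs)
    have := continuous_proj.measurable.comp (ih.add (hc.smul hg))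
    convert! this using 1
    ext1 ω
    exact iterate_succ (by omega) ω

variable [MeasurableSpace Ω] {P : Measure Ω} [IsProbabilityMeasure P]

/-! ### Independence of a round's inputs from the past. -/

namespace Inputs.IsRandomized

variable (hZ : Z.IsRandomized ρ P)
include hZ

omit [IsProbabilityMeasure P] in
theorem measurable_draws (t : ℕ) : Measurable (Z.draws t) :=
  measurable_pi_lambda _ fun j => hZ.measurable_ξ t j

omit [IsProbabilityMeasure P] in
theorem measurable_state (hM : M.IsStandardized ρ) (hμ : ContinuousOn M.μ (cube d))
    (hσ : ContinuousOn M.σ (cube d)) (t : ℕ) : Measurable (Z.state M t) :=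
  (measurable_iterate hM hμ hσ (fun s _ => hZ.measurable_w s) (fun s _ => hZ.measurable_R₁ s)
    (fun s _ => hZ.measurable_R₂ s) (fun s _ => hZ.measurable_ξ s) t le_rfl).prodMk
    ((hZ.measurable_R₁ t).prodMk (hZ.measurable_R₂ t))

omit [IsProbabilityMeasure P] in
theorem law_draws (t : ℕ) : P.map (Z.draws t) = Measure.pi fun _ => ρ := by
  have hinj : Function.Injective fun j : A.Customer => (t, j) := fun i j h => (Prod.mk.inj h).2
  have hi : iIndepFun (fun j : A.Customer => Z.ξ t j) P :=
    hZ.indep_ξ.precomp (g := fun j : A.Customer => (t, j)) hinj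
  have := hi.map_fun_eq_pi_map fun j => (hZ.measurable_ξ t j).aemeasurable
  simp only [hZ.law_ξ] at this
  exact this

omit [IsProbabilityMeasure P] in
theorem indepFun_w_draws (t : ℕ) : IndepFun (Z.w t) (Z.draws t) P :=
  hZ.indep_w_ξ.comp (φ := fun w : ℕ → Metric.sphere (0 : E d) 1 => w t)
    (ψ := fun (ξ : ℕ × A.Customer → S) (j : A.Customer) => ξ (t, j)) (by fun_prop) (by fun_prop)

/-- The iterate and the current subsets are functions of past directions `A₁`, past draws `B₁` and
the design, all of which are jointly independent of the current direction and draws. -/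
theorem indepFun_state_inputs (hM : M.IsStandardized ρ) (hμ : ContinuousOn M.μ (cube d))
    (hσ : ContinuousOn M.σ (cube d)) (t : ℕ) :
    IndepFun (Z.state M t) (fun ω => (Z.w t ω, Z.draws t ω)) P := by
  have hw := hZ.measurable_w
  have hξ : ∀ p : ℕ × A.Customer, Measurable (Z.ξ p.1 p.2) := fun p => hZ.measurable_ξ p.1 p.2
  have hR : Measurable fun ω t => (Z.R₁ t ω, Z.R₂ t ω) :=
    measurable_pi_lambda _ fun t => (hZ.measurable_R₁ t).prodMk (hZ.measurable_R₂ t)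
  set A₁ : Ω → (Finset.range t → Metric.sphere (0 : E d) 1) := fun ω s => Z.w s ω with hA₁
  set B₁ : Ω → ((Finset.range t ×ˢ (Finset.univ : Finset A.Customer) : Finset _) → S) :=
    fun ω p => Z.ξ p.1.1 p.1.2 ω with hB₁
  have mA₁ : Measurable A₁ := by fun_prop
  have mB₁ : Measurable B₁ := measurable_pi_lambda _ fun p => hξ _
  have iA : IndepFun A₁ (Z.w t) P :=
    (hZ.indep_w.indepFun_finset (Finset.range t) {t} (by simp) hw).comp measurable_id
      (measurable_pi_apply (⟨t, by simp⟩ : ({t} : Finset ℕ)))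
  have iB : IndepFun B₁ (Z.draws t) P :=
    (hZ.indep_ξ.indepFun_finset (Finset.range t ×ˢ Finset.univ) ({t} ×ˢ Finset.univ)
      (Finset.disjoint_product.2 (Or.inl (by simp))) hξ).comp (φ := id)
      (ψ := fun (f : (({t} : Finset ℕ) ×ˢ (Finset.univ : Finset A.Customer) : Finset _) → S)
        (j : A.Customer) => f ⟨(t, j), by simp⟩) measurable_id (by fun_prop)
  have iAB : IndepFun (fun ω => (A₁ ω, Z.w t ω)) (fun ω => (B₁ ω, Z.draws t ω)) P :=
    hZ.indep_w_ξ.comp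
      (φ := fun w : ℕ → Metric.sphere (0 : E d) 1 => ((fun s : Finset.range t => w s), w t))
      (ψ := fun ξ : ℕ × A.Customer → S =>
        ((fun p : (Finset.range t ×ˢ (Finset.univ : Finset A.Customer) : Finset _) => ξ p.1),
          (fun j : A.Customer => ξ (t, j)))) (by fun_prop) (by fun_prop)
  have i1 := indepFun_prodMk_prodMk mA₁ (hw t) mB₁ (hZ.measurable_draws t) iA iB iAB
  have i2 : IndepFun (fun ω => ((A₁ ω, B₁ ω), (Z.w t ω, Z.draws t ω)))
      (fun ω t => (Z.R₁ t ω, Z.R₂ t ω)) P :=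
    hZ.indep_design.comp
      (φ := fun q : (ℕ → Metric.sphere (0 : E d) 1) × (ℕ × A.Customer → S) =>
        (((fun s : Finset.range t => q.1 s),
          (fun p : (Finset.range t ×ˢ (Finset.univ : Finset A.Customer) : Finset _) => q.2 p.1)),
          (q.1 t, (fun j : A.Customer => q.2 (t, j))))) (by fun_prop) measurable_id
  -- The whole design is adjoined, over all rounds, because subsets of different rounds may depend
  -- on each other.
  have i3 := indepFun_prodMk_left (mA₁.prodMk mB₁) ((hw t).prodMk (hZ.measurable_draws t)) hR i1 i2
  rw [IndepFun_iff_Indep] at i3 ⊢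
  refine indep_of_indep_of_le_left i3 ?_
  rw [← measurable_iff_comap_le]
  set m := MeasurableSpace.comap (fun ω => ((A₁ ω, B₁ ω), fun t => (Z.R₁ t ω, Z.R₂ t ω)))
    inferInstance with hm
  have hbase : Measurable[m] fun ω => ((A₁ ω, B₁ ω), fun t => (Z.R₁ t ω, Z.R₂ t ω)) :=
    comap_measurable _
  have hRm : ∀ s, Measurable[m] fun ω => (Z.R₁ s ω, Z.R₂ s ω) := fun s =>
    (measurable_pi_apply s).comp (measurable_snd.comp hbase)
  refine Measurable.prodMk ?_ (hRm t)
  refine @measurable_iterate d A S Ω Z M _ ρ m hM hμ hσ t (fun s hs => ?_)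
    (fun s _ => measurable_fst.comp (hRm s)) (fun s _ => measurable_snd.comp (hRm s))
    (fun s hs j => ?_) t le_rfl
  · exact (measurable_pi_apply (⟨s, Finset.mem_range.2 hs⟩ : Finset.range t)).comp
      (measurable_fst.comp (measurable_fst.comp hbase))
  · exact (measurable_pi_apply (⟨(s, j), by simp [hs]⟩ :
      (Finset.range t ×ˢ (Finset.univ : Finset A.Customer) : Finset _))).comp
      (measurable_snd.comp (measurable_fst.comp hbase))

theorem indepFun_state_w (hM : M.IsStandardized ρ) (hμ : ContinuousOn M.μ (cube d))
    (hσ : ContinuousOn M.σ (cube d)) (t : ℕ) : IndepFun (Z.state M t) (Z.w t) P :=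
  (hZ.indepFun_state_inputs hM hμ hσ t).comp measurable_id measurable_fst

theorem indepFun_draws (hM : M.IsStandardized ρ) (hμ : ContinuousOn M.μ (cube d))
    (hσ : ContinuousOn M.σ (cube d)) (t : ℕ) :
    IndepFun (fun ω => (Z.state M t ω, Z.w t ω)) (Z.draws t) P :=
  (indepFun_prodMk_left (hZ.measurable_w t) (hZ.measurable_draws t)
    (hZ.measurable_state hM hμ hσ t) (hZ.indepFun_w_draws t)
    (hZ.indepFun_state_inputs hM hμ hσ t).symm).comp measurable_swap measurable_id

end Inputs.IsRandomized

end run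

/-! ### The expected gradient estimator -/

section drift

variable {d : ℕ}

theorem clm_eq_sum (L : E d →L[ℝ] ℝ) (v : E d) :
    L v = ∑ j, v j * L (EuclideanSpace.single j 1) := by
  conv_lhs => rw [← (EuclideanSpace.basisFun (Fin d) ℝ).sum_repr v]
  simp

theorem shifted_sub_apply {A : Params d} (t : ℕ) (x : E d) (w : Metric.sphere (0 : E d) 1) (r : ℝ)
    (j : Fin d) : (shifted A t x w r - shifted A t x w (-r)) j
      = spread (x j) (r * (A.c t * (w : E d) j)) := by
  simp only [shifted, PiLp.sub_apply, proj_apply, PiLp.add_apply, PiLp.smul_apply, smul_eq_mul,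
    spread]
  congr 2 <;> ring

/-- The constant in the estimate of the bias of the gradient estimator. -/
def biasBound (k : ℝ) : ℝ := (k ^ 3 + k ^ 2) / (k * (k ^ 2 - 1))

theorem biasBound_nonneg {k : ℝ} (hk : 1 < k) : 0 ≤ biasBound k := by
  have : 0 < k ^ 2 - 1 := by nlinarith
  unfold biasBound
  positivity

variable {S : Type*} {A : Params d} {M : Model d S} {t : ℕ}

/-- Expanding `μ` to first order at `x`, the constant terms cancel and, as projection acts
coordinatewise, the linear terms give the sum of difference quotients. The remainders are of order
`c ^ 2` and the coefficients of order `1 / c`. -/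
theorem abs_combMean_sub_le (hk : 1 < A.k) (hc : 0 < A.c t) {C : ℝ} (hC0 : 0 ≤ C)
    (hC : ∀ x ∈ cube d, ∀ y ∈ cube d,
      |M.μ y - M.μ x - cubeDeriv M.μ x (y - x)| ≤ C * ‖y - x‖ ^ 2)
    {x : E d} (hx : x ∈ cube d) (w : Metric.sphere (0 : E d) 1) :
    |combMean A M t (gradCoeff A t) (x, w) - ∑ j, cubeDeriv M.μ x (EuclideanSpace.single j 1)
      * diffQuot A.k (A.c t) (x j) ((w : E d) j)| ≤ biasBound A.k * C * A.c t := by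
  set k := A.k
  set c := A.c t
  set G := cubeDeriv M.μ x
  have hk2 : 0 < k ^ 2 - 1 := by nlinarith
  have hk0 : 0 < k := by linarith
  have hD : 0 < 2 * k * (k ^ 2 - 1) * c := by positivity
  set R : ℝ → ℝ := fun r => M.μ (shifted A t x w r) - M.μ x - G (shifted A t x w r - x) with hR
  have hRb : ∀ r, |R r| ≤ C * (r ^ 2 * c ^ 2) := fun r => by
    refine (hC x hx _ (shifted_mem A t x w r)).trans (mul_le_mul_of_nonneg_left ?_ hC0)
    have h1 := norm_proj_sub_self_le hx ((r * c) • (w : E d))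
    rw [norm_smul, norm_eq_of_mem_sphere, mul_one, Real.norm_eq_abs] at h1
    calc ‖shifted A t x w r - x‖ ^ 2 ≤ |r * c| ^ 2 := pow_le_pow_left₀ (norm_nonneg _) h1 2
      _ = r ^ 2 * c ^ 2 := by rw [sq_abs, mul_pow]
  have hG : ∀ r, G (shifted A t x w r) - G (shifted A t x w (-r))
      = ∑ j, spread (x j) (r * (c * (w : E d) j)) * G (EuclideanSpace.single j 1) := fun r => by
    rw [← map_sub, clm_eq_sum]
    simp only [shifted_sub_apply]
    rfl
  have e : combMean A M t (gradCoeff A t) (x, w)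
      - ∑ j, G (EuclideanSpace.single j 1) * diffQuot k c (x j) ((w : E d) j)
      = (-R k + k ^ 3 * R 1 - k ^ 3 * R (-1) + R (-k)) / (2 * k * (k ^ 2 - 1) * c) := by
    have e1 : ∑ j, G (EuclideanSpace.single j 1) * diffQuot k c (x j) ((w : E d) j)
        = (k ^ 3 * (G (shifted A t x w 1) - G (shifted A t x w (-1)))
          - (G (shifted A t x w k) - G (shifted A t x w (-k)))) / (2 * k * (k ^ 2 - 1) * c) := by
      rw [hG 1, hG k, Finset.mul_sum, ← Finset.sum_sub_distrib, Finset.sum_div]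
      refine Finset.sum_congr rfl fun j _ => ?_
      unfold diffQuot
      rw [one_mul]
      ring
    rw [e1]
    unfold combMean gradCoeff
    simp only [hR, map_sub, Fin.isValue, Matrix.cons_val]
    -- Once the denominators are written with `k` and `c`, they generalize to a single `D`.
    change _ / (2 * k * (k ^ 2 - 1) * c) * _ + _ / (2 * k * (k ^ 2 - 1) * c) * _
      + _ / (2 * k * (k ^ 2 - 1) * c) * _ + _ / (2 * k * (k ^ 2 - 1) * c) * _ - _ = _
    generalize 2 * k * (k ^ 2 - 1) * c = D
    ring
  rw [e, abs_div, abs_of_pos hD, div_le_iff₀ hD]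
  have e2 : biasBound k * C * c * (2 * k * (k ^ 2 - 1) * c)
      = C * (k ^ 2 * c ^ 2) + k ^ 3 * (C * (1 ^ 2 * c ^ 2)) + k ^ 3 * (C * ((-1) ^ 2 * c ^ 2))
        + C * ((-k) ^ 2 * c ^ 2) := by
    unfold biasBound; field_simp; ring
  rw [e2]
  have hk3 : 0 < k ^ 3 := by positivity
  have b1 := hRb k
  have b2 := mul_le_mul_of_nonneg_left (hRb 1) hk3.le
  have b3 := mul_le_mul_of_nonneg_left (hRb (-1)) hk3.le
  have b4 := hRb (-k)
  rw [abs_le] at b1 b4 ⊢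
  have a2 : |k ^ 3 * R 1| ≤ k ^ 3 * (C * (1 ^ 2 * c ^ 2)) := by rwa [abs_mul, abs_of_pos hk3]
  have a3 : |k ^ 3 * R (-1)| ≤ k ^ 3 * (C * ((-1) ^ 2 * c ^ 2)) := by
    rwa [abs_mul, abs_of_pos hk3]
  rw [abs_le] at a2 a3
  constructor <;> linarith [b1.1, b1.2, b4.1, b4.2, a2.1, a2.2, a3.1, a3.2]

/-- The gain of coordinate `i` under a uniform direction. -/
def sphereGain (k c : ℝ) (i : Fin d) (u : ℝ) : ℝ :=
  gain (uniformSphere d) (fun w => (w : E d) i) k c u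

variable [IsProbabilityMeasure (uniformSphere d)]

theorem integrable_combMean_mul (hμ : ContinuousOn M.μ (cube d)) {B : ℝ}
    (hB : ∀ x ∈ cube d, |M.μ x| ≤ B) (b : Fin 4 → ℝ) (x : E d) (i : Fin d) :
    Integrable (fun w : Metric.sphere (0 : E d) 1 => combMean A M t b (x, w) * (w : E d) i)
      (uniformSphere d) := by
  refine Integrable.of_bound (C := (∑ i, |b i|) * B) ?_ (ae_of_all _ fun w => ?_)
  · exact (((measurable_combMean t b hμ).comp (measurable_const.prodMk measurable_id)).mul
      (measurable_sphere_apply i)).aestronglyMeasurable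
  · rw [Real.norm_eq_abs, abs_mul]
    have h1 := abs_combMean_le (A := A) (t := t) (b := b) hB (x, w)
    calc _ ≤ |combMean A M t b (x, w)| * 1 :=
          mul_le_mul_of_nonneg_left (abs_sphere_apply_le w i) (abs_nonneg _)
      _ ≤ _ := by rwa [mul_one]

theorem abs_integral_combMean_sub_le (hk : 1 < A.k) (hc : 0 < A.c t)
    (hμ : ContinuousOn M.μ (cube d)) {C : ℝ} (hC0 : 0 ≤ C)
    (hC : ∀ x ∈ cube d, ∀ y ∈ cube d,
      |M.μ y - M.μ x - cubeDeriv M.μ x (y - x)| ≤ C * ‖y - x‖ ^ 2)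
    {x : E d} (hx : x ∈ cube d) (i : Fin d) :
    |∫ w, combMean A M t (gradCoeff A t) (x, w) * (w : E d) i ∂uniformSphere d
      - cubeDeriv M.μ x (EuclideanSpace.single i 1) * sphereGain A.k (A.c t) i (x i)|
      ≤ biasBound A.k * C * A.c t := by
  set G := cubeDeriv M.μ x
  obtain ⟨B, hB⟩ := (isCompact_cube d).exists_bound_of_continuousOn hμ
  have hi := integrable_combMean_mul (A := A) (t := t) hμ hB (gradCoeff A t) x i
  have hdm : ∀ j, Measurable fun w : Metric.sphere (0 : E d) 1 =>
      diffQuot A.k (A.c t) (x j) ((w : E d) j) := fun j =>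
    (continuous_diffQuot A.k (A.c t)).measurable.comp
      (measurable_const.prodMk (measurable_sphere_apply j))
  have hdmi : ∀ j, Measurable fun w : Metric.sphere (0 : E d) 1 =>
      diffQuot A.k (A.c t) (x j) ((w : E d) j) * (w : E d) i := fun j =>
    (hdm j).mul (measurable_sphere_apply i)
  have hij : ∀ j, Integrable (fun w : Metric.sphere (0 : E d) 1 =>
      G (EuclideanSpace.single j 1) * (diffQuot A.k (A.c t) (x j) ((w : E d) j) * (w : E d) i))
      (uniformSphere d) := fun j => by
    refine Integrable.const_mul (Integrable.of_bound (C := diffBound A.k)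
      (hdmi j).aestronglyMeasurable (ae_of_all _ fun w => ?_)) _
    rw [Real.norm_eq_abs, abs_mul]
    have h1 := abs_diffQuot_le hk hc (x j) ((w : E d) j)
    have h2 := diffBound_pos hk
    calc _ ≤ diffBound A.k * |(w : E d) j| * |(w : E d) i| :=
          mul_le_mul_of_nonneg_right h1 (abs_nonneg _)
      _ ≤ diffBound A.k * 1 * 1 := by
          gcongr <;> exact abs_sphere_apply_le w _
      _ = _ := by ring
  have hsum : ∫ w : Metric.sphere (0 : E d) 1, ∑ j, G (EuclideanSpace.single j 1)
      * (diffQuot A.k (A.c t) (x j) ((w : E d) j) * (w : E d) i) ∂uniformSphere d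
      = G (EuclideanSpace.single i 1) * sphereGain A.k (A.c t) i (x i) := by
    rw [integral_finsetSum _ fun j _ => hij j]
    rw [Finset.sum_eq_single i]
    · rw [integral_const_mul]; rfl
    -- Reflecting coordinate `i` changes the sign of `w i` and leaves the quotient of coordinate `j`
    -- alone, so mixed terms average to zero.
    · intro j _ hji
      rw [integral_const_mul, integral_uniformSphere_eq_zero i ?_ (hdmi j), mul_zero]
      intro w
      simp only [sphereMap, flip_apply, if_neg hji, if_true, mul_neg]
    · simp
  rw [← hsum, ← integral_sub hi (integrable_finsetSum _ fun j _ => hij j)]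
  have := norm_integral_le_of_norm_le_const (μ := uniformSphere d)
    (f := fun w : Metric.sphere (0 : E d) 1 => combMean A M t (gradCoeff A t) (x, w) * (w : E d) i
      - ∑ j, G (EuclideanSpace.single j 1)
      * (diffQuot A.k (A.c t) (x j) ((w : E d) j) * (w : E d) i))
    (C := biasBound A.k * C * A.c t) (ae_of_all _ fun w => ?_)
  · simpa using this
  · simp only [← mul_assoc]
    rw [← Finset.sum_mul, ← sub_mul, Real.norm_eq_abs, abs_mul]
    have h1 := abs_combMean_sub_le hk hc hC0 hC hx w
    calc _ ≤ _ * 1 := mul_le_mul_of_nonneg_left (abs_sphere_apply_le w i) (abs_nonneg _)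
      _ ≤ _ := by rwa [mul_one]

end drift

/-! ### The Lyapunov function -/

theorem abs_inv_sub_inv_le {x y κ : ℝ} (hκ : 0 < κ) (hx : κ ≤ x) (hy : κ ≤ y) :
    |x⁻¹ - y⁻¹| ≤ |x - y| / κ ^ 2 := by
  have hx0 := hκ.trans_le hx
  have hy0 := hκ.trans_le hy
  rw [inv_sub_inv hx0.ne' hy0.ne', abs_div, abs_of_pos (mul_pos hx0 hy0), abs_sub_comm, sq]
  exact div_le_div_of_nonneg_left (abs_nonneg _) (mul_pos hκ hκ) (mul_le_mul hx hy hκ.le hx0.le)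

section lyapunov

variable {d : ℕ}

/-- The inverse of the gain of a coordinate. -/
def gainInv (k c : ℝ) (i : Fin d) (u : ℝ) : ℝ := (sphereGain k c i (clip u))⁻¹

/-- The squared distance to `a`, in which every coordinate is weighted by its inverse gain. -/
def lyapunov (k c : ℝ) (a x : E d) : ℝ := ∑ i, weightedSq (gainInv k c i) (a i) (x i)

variable [IsProbabilityMeasure (uniformSphere d)]

/-- The lower bound is uniform in `c ≤ b`, in the coordinate and in the position, including the
boundary; it makes the inverse gains bounded for all rounds at once. -/
theorem exists_le_sphereGain {k b : ℝ} (hk : 1 < k) (hb : 1 ≤ b) :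
    ∃ κ > 0, ∀ c, 0 < c → c ≤ b → ∀ (i : Fin d), ∀ u ∈ Set.Icc (0 : ℝ) 1,
      κ ≤ sphereGain k c i u := by
  have hm : ∃ e > 0, ∀ i : Fin d, e ≤ ∫ w, (w : E d) i ^ 2 ∂uniformSphere d := by
    rcases isEmpty_or_nonempty (Fin d) with he | hne
    · exact ⟨1, one_pos, fun i => he.elim i⟩
    · obtain ⟨i, hi⟩ := Finite.exists_min fun i : Fin d => ∫ w, (w : E d) i ^ 2 ∂uniformSphere d
      exact ⟨_, integral_sphere_sq_pos i, hi⟩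
  obtain ⟨e, he, hei⟩ := hm
  refine ⟨e / (2 * b), by positivity, fun c hc hcb i u hu => ?_⟩
  exact (div_le_div_of_nonneg_right (hei i) (by positivity)).trans
    (le_gain (measurable_sphere_apply i) (fun w => abs_sphere_apply_le w i) hk hc hcb hb hu)

variable {k κ c : ℝ} (hk : 1 < k) (hκ : 0 < κ) (hc : 0 < c)
  (hg : ∀ (i : Fin d), ∀ u ∈ Set.Icc (0 : ℝ) 1, κ ≤ sphereGain k c i u)

include hκ hg

omit [IsProbabilityMeasure (uniformSphere d)] in
theorem gainInv_nonneg (i : Fin d) (u : ℝ) : 0 ≤ gainInv k c i u :=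
  inv_nonneg.2 (hκ.le.trans (hg i _ (clip_mem u)))

omit [IsProbabilityMeasure (uniformSphere d)] in
theorem abs_gainInv_le (i : Fin d) (u : ℝ) : |gainInv k c i u| ≤ κ⁻¹ := by
  rw [abs_of_nonneg (gainInv_nonneg hκ hg i u)]
  exact inv_anti₀ hκ (hg i _ (clip_mem u))

omit [IsProbabilityMeasure (uniformSphere d)] in
theorem gainInv_mul {i : Fin d} {u : ℝ} (hu : u ∈ Set.Icc (0 : ℝ) 1) :
    gainInv k c i u * sphereGain k c i u = 1 := by
  unfold gainInv
  rw [clip_of_mem hu]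
  exact inv_mul_cancel₀ (hκ.trans_le (hg i u hu)).ne'

include hk hc

theorem abs_gainInv_sub_le (i : Fin d) (u v : ℝ) :
    |gainInv k c i u - gainInv k c i v| ≤ diffBound k / c / κ ^ 2 * |u - v| := by
  refine (abs_inv_sub_inv_le hκ (hg i _ (clip_mem u)) (hg i _ (clip_mem v))).trans ?_
  have h := abs_gain_sub_le (π := uniformSphere d) (measurable_sphere_apply i)
    (fun w => abs_sphere_apply_le w i) hk hc (clip u) (clip v)
  have h2 : diffBound k / c * |clip u - clip v| ≤ diffBound k / c * |u - v| :=
    mul_le_mul_of_nonneg_left (abs_clip_sub_le u v) (div_nonneg (diffBound_pos hk).le hc.le)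
  calc _ ≤ diffBound k / c * |u - v| / κ ^ 2 :=
        div_le_div_of_nonneg_right (h.trans h2) (sq_nonneg κ)
    _ = _ := by ring

theorem continuous_gainInv (i : Fin d) : Continuous (gainInv k c i) := by
  refine (LipschitzWith.of_dist_le' (K := diffBound k / c / κ ^ 2) fun u v => ?_).continuous
  exact abs_gainInv_sub_le hk hκ hc hg i u v

theorem continuous_lyapunov (a : E d) : Continuous (lyapunov k c a) := by
  unfold lyapunov
  refine continuous_finsetSum _ fun i _ => ?_
  exact (continuous_weightedSq (continuous_gainInv hk hκ hc hg i) _).comp (by fun_prop)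

theorem lyapunov_nonneg (a x : E d) : 0 ≤ lyapunov k c a x :=
  Finset.sum_nonneg fun i _ =>
    weightedSq_nonneg (continuous_gainInv hk hκ hc hg i) (gainInv_nonneg hκ hg i) _ _

theorem lyapunov_proj_le {a : E d} (ha : a ∈ cube d) (x : E d) :
    lyapunov k c a (proj x) ≤ lyapunov k c a x :=
  Finset.sum_le_sum fun i _ => weightedSq_clip_le (continuous_gainInv hk hκ hc hg i)
    (gainInv_nonneg hκ hg i) (ha i) (x i)

theorem lyapunov_add_le {a x : E d} (ha : a ∈ cube d) (hx : x ∈ cube d) (s : ℝ)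
    (w : Metric.sphere (0 : E d) 1) :
    lyapunov k c a (x + s • (w : E d)) ≤ lyapunov k c a x
      + s * ∑ i, 2 * (x i - a i) * gainInv k c i (x i) * (w : E d) i
      + 2 * (κ⁻¹ + diffBound k / c / κ ^ 2) * s ^ 2 := by
  have hL : 0 ≤ diffBound k / c / κ ^ 2 := by
    have := diffBound_pos hk
    positivity
  have h := Finset.sum_le_sum fun (i : Fin d) (_ : i ∈ Finset.univ) =>
    weightedSq_add_le (continuous_gainInv hk hκ hc hg i) hL (abs_gainInv_le hκ hg i)
      (abs_gainInv_sub_le hk hκ hc hg i) (ha i) (hx i) (s * (w : E d) i)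
  rw [Finset.sum_add_distrib, Finset.sum_add_distrib, ← Finset.mul_sum] at h
  have e1 : ∑ i, (s * (w : E d) i) ^ 2 = s ^ 2 := by
    simp only [mul_pow]
    rw [← Finset.mul_sum, sum_sphere_sq, mul_one]
  have e2 : ∑ i, 2 * (x i - a i) * gainInv k c i (x i) * (s * (w : E d) i)
      = s * ∑ i, 2 * (x i - a i) * gainInv k c i (x i) * (w : E d) i := by
    rw [Finset.mul_sum]
    exact Finset.sum_congr rfl fun i _ => by ring
  rw [e1, e2] at h
  exact h

/-- This is `weightedSq_le_add` with strips of width `k * c` and a weight difference of order `(c -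
c') / c`. The result is linear in `c - c'`, hence telescopes over the rounds. -/
theorem lyapunov_le_of_le {c' : ℝ} (hc' : 0 < c') (hcc : c' ≤ c)
    (hg' : ∀ (i : Fin d), ∀ u ∈ Set.Icc (0 : ℝ) 1, κ ≤ sphereGain k c' i u) {a x : E d}
    (ha : a ∈ cube d) (hx : x ∈ cube d) :
    lyapunov k c' a x ≤ lyapunov k c a x + d * (8 * diffBound k * k / κ ^ 2) * (c - c') := by
  have hkc : 0 ≤ k * c := by nlinarith
  have hd := diffBound_pos hk
  have hM : 0 ≤ 2 * diffBound k * ((c - c') / c) / κ ^ 2 := by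
    have : 0 ≤ (c - c') / c := div_nonneg (by linarith) hc.le
    positivity
  have h := Finset.sum_le_sum fun (i : Fin d) (_ : i ∈ Finset.univ) =>
    weightedSq_le_add (continuous_gainInv hk hκ hc hg i) (continuous_gainInv hk hκ hc' hg' i)
      hM hkc (fun v _ => ?_) (fun v h1 h2 => ?_) (ha i) (hx i)
  · rw [Finset.sum_add_distrib, Finset.sum_const, Finset.card_univ, Fintype.card_fin,
      nsmul_eq_mul] at h
    refine h.trans_eq ?_
    unfold lyapunov
    congr 1
    field_simp
    ring
  · refine (abs_inv_sub_inv_le hκ (hg' i _ (clip_mem v)) (hg i _ (clip_mem v))).trans ?_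
    refine div_le_div_of_nonneg_right ?_ (sq_nonneg κ)
    rw [abs_sub_comm]
    exact abs_gain_sub_le_of_le (measurable_sphere_apply i)
      (fun w => abs_sphere_apply_le w i) hk hc' hcc (clip v)
  · have hv : clip v = v := clip_of_mem ⟨by linarith, by linarith⟩
    have hkc' : k * c' ≤ k * c := mul_le_mul_of_nonneg_left hcc (by linarith)
    unfold gainInv sphereGain
    rw [hv, gain_eq (fun w => abs_sphere_apply_le w i) hk hc h1 h2,
      gain_eq (fun w => abs_sphere_apply_le w i) hk hc' (by linarith) (by linarith)]

/-- The drift of the Lyapunov function along the expected gradient estimator. -/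
theorem integral_combMean_mul_le {S : Type*} {A : Params d} {M : Model d S} {t : ℕ} (hkA : A.k = k)
    (hcA : A.c t = c) (hμ : ContinuousOn M.μ (cube d)) {C : ℝ} (hC0 : 0 ≤ C)
    (hC : ∀ x ∈ cube d, ∀ y ∈ cube d,
      |M.μ y - M.μ x - cubeDeriv M.μ x (y - x)| ≤ C * ‖y - x‖ ^ 2)
    {a x : E d} (ha : a ∈ cube d) (hx : x ∈ cube d) :
    ∫ w, combMean A M t (gradCoeff A t) (x, w)
      * ∑ i, 2 * (x i - a i) * gainInv k c i (x i) * (w : E d) i ∂uniformSphere d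
      ≤ -(2 * cubeDeriv M.μ x (a - x)) + 2 * d * κ⁻¹ * (biasBound k * C) * c := by
  subst hkA hcA
  obtain ⟨B, hB⟩ := (isCompact_cube d).exists_bound_of_continuousOn hμ
  have hi := fun i => integrable_combMean_mul (A := A) (t := t) hμ hB (gradCoeff A t) x i
  have e : ∀ w : Metric.sphere (0 : E d) 1, combMean A M t (gradCoeff A t) (x, w)
      * ∑ i, 2 * (x i - a i) * gainInv A.k (A.c t) i (x i) * (w : E d) i
      = ∑ i, 2 * (x i - a i) * gainInv A.k (A.c t) i (x i)
        * (combMean A M t (gradCoeff A t) (x, w) * (w : E d) i) := fun w => by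
    rw [Finset.mul_sum]
    exact Finset.sum_congr rfl fun i _ => by ring
  simp only [e]
  rw [integral_finsetSum _ fun i _ => (hi i).const_mul _]
  simp only [integral_const_mul]
  have hb := biasBound_nonneg hk
  have hterm : ∀ i, 2 * (x i - a i) * gainInv A.k (A.c t) i (x i)
      * ∫ w, combMean A M t (gradCoeff A t) (x, w) * (w : E d) i ∂uniformSphere d
      ≤ 2 * ((x i - a i) * cubeDeriv M.μ x (EuclideanSpace.single i 1))
        + 2 * κ⁻¹ * (biasBound A.k * C * A.c t) := fun i => by
    have h1 := abs_integral_combMean_sub_le (A := A) hk hc hμ hC0 hC hx i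
    set I := ∫ w, combMean A M t (gradCoeff A t) (x, w) * (w : E d) i ∂uniformSphere d
    set D := cubeDeriv M.μ x (EuclideanSpace.single i 1)
    have h2 := gainInv_mul hκ hg (i := i) (hx i)
    have h3 := abs_gainInv_le hκ hg i (x i)
    have h4 : |x i - a i| ≤ 1 :=
      abs_le.2 ⟨by linarith [(hx i).1, (ha i).2], by linarith [(hx i).2, (ha i).1]⟩
    -- The inverse gain turns the main part of the expected estimator back into the partial
    -- derivative `D`.
    have h5 : 2 * (x i - a i) * gainInv A.k (A.c t) i (x i) * I
        = 2 * ((x i - a i) * D) + 2 * ((x i - a i) * gainInv A.k (A.c t) i (x i)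
          * (I - D * sphereGain A.k (A.c t) i (x i))) := by
      linear_combination 2 * (x i - a i) * D * h2
    have h6 : |(x i - a i) * gainInv A.k (A.c t) i (x i)
        * (I - D * sphereGain A.k (A.c t) i (x i))| ≤ 1 * κ⁻¹ * (biasBound A.k * C * A.c t) := by
      rw [abs_mul, abs_mul]
      gcongr
    rw [h5]
    linarith [le_abs_self ((x i - a i) * gainInv A.k (A.c t) i (x i)
        * (I - D * sphereGain A.k (A.c t) i (x i)))]
  refine (Finset.sum_le_sum fun i _ => hterm i).trans_eq ?_
  rw [Finset.sum_add_distrib, ← Finset.mul_sum, Finset.sum_const, Finset.card_univ,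
    Fintype.card_fin, nsmul_eq_mul, ← neg_sub x a, map_neg, clm_eq_sum _ (x - a)]
  simp only [PiLp.sub_apply]
  ring

end lyapunov

/-! ### Moments along the run -/

section moments

variable {d : ℕ} {A : Params d} {S Ω : Type*} {Z : Inputs A S Ω} {M : Model d S}
  [MeasurableSpace S] {ρ : Measure S} [IsProbabilityMeasure ρ]
  [MeasurableSpace Ω] {P : Measure Ω} [IsProbabilityMeasure P]

omit [MeasurableSpace S] in
theorem integrable_comp_of_continuousOn {f : E d → ℝ} (hf : ContinuousOn f (cube d)) {X : Ω → E d}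
    (hX : Measurable X) (hXc : ∀ ω, X ω ∈ cube d) : Integrable (fun ω => f (X ω)) P := by
  obtain ⟨B, hB⟩ := (isCompact_cube d).exists_bound_of_continuousOn hf
  refine Integrable.of_bound (C := B) ?_ (ae_of_all _ fun ω => hB _ (hXc ω))
  have := (measurable_comp_proj hf).comp hX
  refine Measurable.aestronglyMeasurable ?_
  convert! this using 2 with ω
  exact (congrArg f (proj_eq_self (hXc ω))).symm

/-- The combination of sample means along the run. -/
def runComb (Z : Inputs A S Ω) (M : Model d S) (b : Fin 4 → ℝ) (t : ℕ) (ω : Ω) : ℝ :=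
  combFun A M t b ((Z.state M t ω, Z.w t ω), Z.draws t ω)

namespace Inputs.IsRandomized

variable (hZ : Z.IsRandomized ρ P) (hM : M.IsStandardized ρ) (hμ : ContinuousOn M.μ (cube d))
  (hσ : ContinuousOn M.σ (cube d))
include hZ hM hμ hσ

omit [IsProbabilityMeasure ρ] [IsProbabilityMeasure P] in
theorem measurable_run (t : ℕ) : Measurable (iterate Z M t) :=
  measurable_fst.comp (hZ.measurable_state hM hμ hσ t)

omit [IsProbabilityMeasure ρ] [IsProbabilityMeasure P] in
theorem measurable_stateDirection (t : ℕ) :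
    Measurable fun ω => (Z.state M t ω, Z.w t ω) :=
  (hZ.measurable_state hM hμ hσ t).prodMk (hZ.measurable_w t)

variable (hm₁ : 1 ≤ A.m₁) (hm₂ : 1 ≤ A.m₂)
include hm₁ hm₂

theorem integrable_runComb_sq (b : Fin 4 → ℝ) {B : ℝ} (hB : ∀ x ∈ cube d, |M.μ x| ≤ B)
    (hB' : ∀ x ∈ cube d, |M.σ x| ≤ B) (t : ℕ) :
    Integrable (fun ω => runComb Z M b t ω ^ 2) P ∧
      ∫ ω, runComb Z M b t ω ^ 2 ∂P ≤ ((∑ i, |b i|) ^ 2 + ∑ i, b i ^ 2) * B ^ 2 := by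
  have hX := hZ.measurable_stateDirection hM hμ hσ t
  have hY := hZ.measurable_draws t
  have hH : Measurable fun p => combFun A M t b p ^ 2 :=
    (measurable_combFun t b hM hμ hσ).pow_const 2
  have hbound : ∀ ω, ∫ y, combFun A M t b ((Z.state M t ω, Z.w t ω), y) ^ 2
      ∂(Measure.pi fun _ => ρ) ≤ ((∑ i, |b i|) ^ 2 + ∑ i, b i ^ 2) * B ^ 2 := fun ω =>
    integral_combFun_sq_le hM hm₁ hm₂ hB hB' (p := (Z.state M t ω, Z.w t ω))
      (hZ.card_R₁ t ω) (hZ.card_R₂ t ω)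
  have hint := integrable_comp_indepFun hX hY (hZ.indepFun_draws hM hμ hσ t) (hZ.law_draws t) hH
    (fun p => sq_nonneg _) (fun ω => (memLp_combFun hM _).integrable_sq) hbound
  refine ⟨hint, ?_⟩
  have e := integral_comp_indepFun hX hY (hZ.indepFun_draws hM hμ hσ t) (hZ.law_draws t) hH hint
  refine (le_of_eq e).trans ?_
  refine (integral_mono_of_nonneg (ae_of_all _ fun ω => integral_nonneg fun y => sq_nonneg _)
    (integrable_const _) (ae_of_all _ hbound)).trans_eq ?_
  simp

theorem memLp_runComb (b : Fin 4 → ℝ) (t : ℕ) : MemLp (runComb Z M b t) 2 P := by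
  obtain ⟨B₁, hB₁⟩ := (isCompact_cube d).exists_bound_of_continuousOn hμ
  obtain ⟨B₂, hB₂⟩ := (isCompact_cube d).exists_bound_of_continuousOn hσ
  have h := (hZ.integrable_runComb_sq hM hμ hσ hm₁ hm₂ b (B := max B₁ B₂)
    (fun x hx => (hB₁ x hx).trans (le_max_left _ _))
    (fun x hx => (hB₂ x hx).trans (le_max_right _ _)) t).1
  have hm : Measurable (runComb Z M b t) := (measurable_combFun t b hM hμ hσ).comp
    ((hZ.measurable_stateDirection hM hμ hσ t).prodMk (hZ.measurable_draws t))
  exact (memLp_two_iff_integrable_sq hm.aestronglyMeasurable).2 h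

/-- Averaging a combination of sample means, weighted by a bounded function of the iterate and the
direction, over the draws and the direction. -/
theorem integral_runComb_mul (b : Fin 4 → ℝ) (t : ℕ)
    {h : E d × Metric.sphere (0 : E d) 1 → ℝ} (hh : Measurable h) {C : ℝ}
    (hC : ∀ ω, |h (iterate Z M t ω, Z.w t ω)| ≤ C) :
    Integrable (fun ω => runComb Z M b t ω * h (iterate Z M t ω, Z.w t ω)) P ∧
    ∫ ω, runComb Z M b t ω * h (iterate Z M t ω, Z.w t ω) ∂P
      = ∫ ω, ∫ w, combMean A M t b (iterate Z M t ω, w) * h (iterate Z M t ω, w)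
        ∂uniformSphere d ∂P := by
  have hX := hZ.measurable_stateDirection hM hμ hσ t
  have hY := hZ.measurable_draws t
  have hxw : Measurable fun ω => (iterate Z M t ω, Z.w t ω) :=
    (hZ.measurable_run hM hμ hσ t).prodMk (hZ.measurable_w t)
  have hint : Integrable (fun ω => runComb Z M b t ω * h (iterate Z M t ω, Z.w t ω)) P :=
    ((hZ.memLp_runComb hM hμ hσ hm₁ hm₂ b t).integrable one_le_two).mul_bdd (c := C)
      (hh.comp hxw).aestronglyMeasurable (ae_of_all _ hC)
  refine ⟨hint, ?_⟩
  have hH : Measurable fun p : (State A × Metric.sphere (0 : E d) 1) × (A.Customer → S) =>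
      combFun A M t b p * h (iterateDirection A p.1) :=
    (measurable_combFun t b hM hμ hσ).mul
      (hh.comp ((measurable_iterateDirection A).comp measurable_fst))
  have e1 := integral_comp_indepFun hX hY (hZ.indepFun_draws hM hμ hσ t) (hZ.law_draws t) hH hint
  have e2 : ∀ ω, ∫ y, combFun A M t b ((Z.state M t ω, Z.w t ω), y)
      * h (iterateDirection A (Z.state M t ω, Z.w t ω)) ∂(Measure.pi fun _ => ρ)
      = combMean A M t b (iterate Z M t ω, Z.w t ω) * h (iterate Z M t ω, Z.w t ω) := fun ω => by
    rw [integral_mul_const, integral_combFun hM (by omega) (by omega)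
      (p := (Z.state M t ω, Z.w t ω)) (hZ.card_R₁ t ω) (hZ.card_R₂ t ω)]
    rfl
  simp only [e2] at e1
  refine Eq.trans e1 ?_
  obtain ⟨B, hB⟩ := (isCompact_cube d).exists_bound_of_continuousOn hμ
  refine integral_comp_indepFun (hZ.measurable_run hM hμ hσ t) (hZ.measurable_w t)
    ((hZ.indepFun_state_w hM hμ hσ t).comp measurable_fst measurable_id) (hZ.law_w t)
    (H := fun p => combMean A M t b p * h p) ((measurable_combMean t b hμ).mul hh) ?_
  refine Integrable.mul_bdd (c := C) ?_ (hh.comp hxw).aestronglyMeasurable (ae_of_all _ hC)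
  exact Integrable.of_bound (C := (∑ i, |b i|) * B)
    ((measurable_combMean t b hμ).comp hxw).aestronglyMeasurable
    (ae_of_all _ fun ω => abs_combMean_le hB _)

end Inputs.IsRandomized

end moments

/-! ### The expected Lyapunov function -/

section expectation

variable {d : ℕ} {A : Params d}

/-- The constant in the second moment of the gradient estimator. -/
def momentBound (k : ℝ) : ℝ :=
  ((2 + 2 * k ^ 3) ^ 2 + (2 + 2 * k ^ 6)) / (2 * k * (k ^ 2 - 1)) ^ 2

theorem sum_gradCoeff (hk : 1 < A.k) {t : ℕ} (hc : 0 < A.c t) :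
    (∑ i, |gradCoeff A t i|) ^ 2 + ∑ i, gradCoeff A t i ^ 2
      = momentBound A.k / A.c t ^ 2 := by
  have hk2 : 0 < A.k ^ 2 - 1 := by nlinarith
  have hk0 : 0 < A.k := by linarith
  have hD : 0 < 2 * A.k * (A.k ^ 2 - 1) * A.c t := by positivity
  rw [Fin.sum_univ_four, Fin.sum_univ_four]
  unfold gradCoeff momentBound
  simp only [Fin.isValue, Matrix.cons_val, abs_div, abs_neg, abs_one, abs_of_pos hD, abs_pow,
    abs_of_pos hk0]
  field_simp
  ring

variable {S Ω : Type*} {Z : Inputs A S Ω} {M : Model d S}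
  [MeasurableSpace S] {ρ : Measure S} [IsProbabilityMeasure ρ]
  [MeasurableSpace Ω] {P : Measure Ω} [IsProbabilityMeasure P]

theorem SmoothConcave.continuousOn_gap {f : E d → ℝ} (hf : SmoothConcave f) (a : E d) :
    ContinuousOn (fun x => cubeDeriv f x (a - x)) (cube d) :=
  hf.contDiffOn_cubeDeriv.continuousOn.clm_apply (by fun_prop)

/-- Here `v t` is the expected Lyapunov function of round `t`, taken with the gain for `c_t`.
Working with expectations avoids any martingale argument. -/
theorem exists_expected_drift (hZ : Z.IsRandomized ρ P) (hM : M.IsStandardized ρ)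
    (hμ : SmoothConcave M.μ) (hσ : ContinuousOn M.σ (cube d)) (hm₁ : 1 ≤ A.m₁) (hm₂ : 1 ≤ A.m₂)
    (hθ₀ : A.θ₀ ∈ cube d) (hk : 1 < A.k) {a : E d} (ha : a ∈ cube d) {b : ℝ} (hb : 1 ≤ b)
    (hc : ∀ t, 1 ≤ t → 0 < A.c t ∧ A.c t ≤ b) (hcc : ∀ t, 1 ≤ t → A.c (t + 1) ≤ A.c t)
    (hα : ∀ t, 1 ≤ t → 0 ≤ A.α t) :
    ∃ K : ℝ, 0 ≤ K ∧ ∃ v : ℕ → ℝ, (∀ t, 1 ≤ t → 0 ≤ v t) ∧ ∀ t, 1 ≤ t →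
      v (t + 1) + 2 * A.α t
          * ∫ ω, cubeDeriv M.μ (iterate Z M t ω) (a - iterate Z M t ω) ∂P
        ≤ v t + K * (A.α t * A.c t + A.α t ^ 2 / A.c t ^ 3 + (A.c t - A.c (t + 1))) := by
  -- The sphere measure is a probability measure because it is the law of a direction.
  have hprob : IsProbabilityMeasure (uniformSphere d) := by
    rw [← hZ.law_w 0]
    exact Measure.isProbabilityMeasure_map (hZ.measurable_w 0).aemeasurable
  obtain ⟨κ, hκ, hgain⟩ := exists_le_sphereGain (d := d) hk hb
  obtain ⟨C, hC0, hC⟩ := hμ.exists_taylor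
  obtain ⟨B₁, hB₁⟩ := (isCompact_cube d).exists_bound_of_continuousOn hμ.continuousOn
  obtain ⟨B₂, hB₂⟩ := (isCompact_cube d).exists_bound_of_continuousOn hσ
  set B := max B₁ B₂
  have hBμ : ∀ x ∈ cube d, |M.μ x| ≤ B := fun x hx => (hB₁ x hx).trans (le_max_left _ _)
  have hBσ : ∀ x ∈ cube d, |M.σ x| ≤ B := fun x hx => (hB₂ x hx).trans (le_max_right _ _)
  have hμc := hμ.continuousOn
  have hk2 : 0 < A.k ^ 2 - 1 := by nlinarith
  have hk0 : 0 < A.k := by linarith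
  have hdB := diffBound_pos hk
  have hbB := biasBound_nonneg hk
  have hmB : 0 ≤ momentBound A.k := by unfold momentBound; positivity
  set K₁ : ℝ := 2 * d * κ⁻¹ * (biasBound A.k * C) with hK₁
  set K₂ : ℝ := 2 * (κ⁻¹ * b + diffBound A.k / κ ^ 2) * (momentBound A.k * B ^ 2) with hK₂
  set K₃ : ℝ := d * (8 * diffBound A.k * A.k / κ ^ 2) with hK₃
  have hK₁0 : 0 ≤ K₁ := by positivity
  have hK₂0 : 0 ≤ K₂ := by positivity
  have hK₃0 : 0 ≤ K₃ := by positivity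
  -- `K₁` stems from the bias, `K₂` from the second-order term, `K₃` from the change of weights with
  -- `c`.
  refine ⟨K₁ + K₂ + K₃, by positivity,
    fun t => ∫ ω, lyapunov A.k (A.c t) a (iterate Z M t ω) ∂P, fun t ht => ?_, fun t ht => ?_⟩
  · exact integral_nonneg fun ω =>
      lyapunov_nonneg hk hκ (hc t ht).1 (hgain _ (hc t ht).1 (hc t ht).2) _ _
  obtain ⟨hct, hctb⟩ := hc t ht
  obtain ⟨hct', hctb'⟩ := hc (t + 1) (by omega)
  have hg := hgain _ hct hctb
  have hg' := hgain _ hct' hctb'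
  have hαt := hα t ht
  set c := A.c t with hcdef
  set c' := A.c (t + 1)
  set x : Ω → E d := iterate Z M t with hx
  set x' : Ω → E d := iterate Z M (t + 1)
  set γ : Ω → ℝ := runComb Z M (gradCoeff A t) t with hγ
  have hxm : Measurable x := hZ.measurable_run hM hμc hσ t
  have hxm' : Measurable x' := hZ.measurable_run hM hμc hσ (t + 1)
  have hxc : ∀ ω, x ω ∈ cube d := iterate_mem_cube hθ₀ t
  have hxc' : ∀ ω, x' ω ∈ cube d := iterate_mem_cube hθ₀ (t + 1)
  set h : E d × Metric.sphere (0 : E d) 1 → ℝ := fun p =>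
    ∑ i, 2 * (p.1 i - a i) * gainInv A.k c i (p.1 i) * (p.2 : E d) i with hh
  have hhm : Measurable h := by
    refine Finset.measurable_fun_sum _ fun i _ => Measurable.mul (Measurable.mul ?_ ?_) ?_
    · fun_prop
    · exact (continuous_gainInv hk hκ hct hg i).measurable.comp (by fun_prop)
    · fun_prop
  have hhb : ∀ y ∈ cube d, ∀ w, |h (y, w)| ≤ ∑ _i : Fin d, 2 * κ⁻¹ := fun y hy w => by
    refine (Finset.abs_sum_le_sum_abs _ _).trans (Finset.sum_le_sum fun i _ => ?_)
    have h1 : |y i - a i| ≤ 1 :=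
      abs_le.2 ⟨by linarith [(hy i).1, (ha i).2], by linarith [(hy i).2, (ha i).1]⟩
    have h2 := abs_gainInv_le hκ hg i (y i)
    have h3 := abs_sphere_apply_le w i
    rw [abs_mul, abs_mul, abs_mul, abs_two]
    calc 2 * |y i - a i| * |gainInv A.k c i (y i)| * |(w : E d) i|
        ≤ 2 * 1 * κ⁻¹ * 1 := by gcongr
      _ = 2 * κ⁻¹ := by ring
  obtain ⟨hγhi, hγh⟩ := hZ.integral_runComb_mul hM hμc hσ hm₁ hm₂ (gradCoeff A t) t hhm
    fun ω => hhb _ (hxc ω) _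
  obtain ⟨hγi, hγ2⟩ := hZ.integrable_runComb_sq hM hμc hσ hm₁ hm₂ (gradCoeff A t) hBμ hBσ t
  rw [sum_gradCoeff hk hct] at hγ2
  have hLi : Integrable (fun ω => lyapunov A.k c a (x ω)) P :=
    integrable_comp_of_continuousOn (continuous_lyapunov hk hκ hct hg a).continuousOn hxm hxc
  have hLi' : Integrable (fun ω => lyapunov A.k c' a (x' ω)) P :=
    integrable_comp_of_continuousOn (continuous_lyapunov hk hκ hct' hg' a).continuousOn hxm' hxc'
  have hDi : Integrable (fun ω => cubeDeriv M.μ (x ω) (a - x ω)) P :=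
    integrable_comp_of_continuousOn (hμ.continuousOn_gap a) hxm hxc
  set Q : ℝ := 2 * (κ⁻¹ + diffBound A.k / c / κ ^ 2) with hQ
  -- In turn: change of the weights at the new iterate, removal of the projection, and the
  -- second-order bound at the old iterate.
  have hpt : ∀ ω, lyapunov A.k c' a (x' ω) ≤ lyapunov A.k c a (x ω)
      + A.α t * (γ ω * h (x ω, Z.w t ω)) + Q * A.α t ^ 2 * γ ω ^ 2 + K₃ * (c - c') := fun ω => by
    have h1 := lyapunov_le_of_le hk hκ hct hg hct' (hcc t ht) hg' ha (hxc' ω)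
    have h2 : x' ω = proj (x ω + (A.α t * γ ω) • (Z.w t ω : E d)) := iterate_succ ht ω
    have h3 := lyapunov_proj_le hk hκ hct hg ha (x ω + (A.α t * γ ω) • (Z.w t ω : E d))
    have h4 := lyapunov_add_le hk hκ hct hg ha (hxc ω) (A.α t * γ ω) (Z.w t ω)
    rw [← h2] at h3
    have h5 : Q * (A.α t * γ ω) ^ 2 = Q * A.α t ^ 2 * γ ω ^ 2 := by ring
    rw [h5, mul_assoc (A.α t)] at h4
    linarith
  have hint1 : Integrable (fun ω => lyapunov A.k c a (x ω)
      + A.α t * (γ ω * h (x ω, Z.w t ω))) P := hLi.add (hγhi.const_mul (A.α t))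
  have hint2 : Integrable (fun ω => lyapunov A.k c a (x ω) + A.α t * (γ ω * h (x ω, Z.w t ω))
      + Q * A.α t ^ 2 * γ ω ^ 2) P := hint1.add (hγi.const_mul (Q * A.α t ^ 2))
  have hint3 : Integrable (fun ω => lyapunov A.k c a (x ω) + A.α t * (γ ω * h (x ω, Z.w t ω))
      + Q * A.α t ^ 2 * γ ω ^ 2 + K₃ * (c - c')) P := hint2.add (integrable_const _)
  have hmono := integral_mono hLi' hint3 hpt
  rw [integral_add hint2 (integrable_const _), integral_add hint1 (hγi.const_mul _),
    integral_add hLi (hγhi.const_mul _), integral_const_mul, integral_const_mul] at hmono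
  simp only [integral_const, probReal_univ, one_smul] at hmono
  have hdrift : ∫ ω, γ ω * h (x ω, Z.w t ω) ∂P
      ≤ -(2 * ∫ ω, cubeDeriv M.μ (x ω) (a - x ω) ∂P) + K₁ * c := by
    refine (le_of_eq hγh).trans ?_
    have hp : ∀ ω, ∫ w, combMean A M t (gradCoeff A t) (x ω, w) * h (x ω, w) ∂uniformSphere d
        ≤ -(2 * cubeDeriv M.μ (x ω) (a - x ω)) + K₁ * c := fun ω =>
      integral_combMean_mul_le hk hκ hct hg rfl rfl hμc hC0 hC ha (hxc ω)
    have hri : Integrable (fun ω => -(2 * cubeDeriv M.μ (x ω) (a - x ω)) + K₁ * c) P :=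
      (hDi.const_mul 2).neg.add (integrable_const _)
    have hli : Integrable (fun ω => ∫ w, combMean A M t (gradCoeff A t) (x ω, w) * h (x ω, w)
        ∂uniformSphere d) P := by
      refine Integrable.of_bound (C := (∑ i, |gradCoeff A t i|) * B * ∑ _i : Fin d, 2 * κ⁻¹) ?_
        (ae_of_all _ fun ω => ?_)
      · have hm : Measurable fun p : E d × Metric.sphere (0 : E d) 1 =>
            combMean A M t (gradCoeff A t) p * h p := (measurable_combMean t _ hμc).mul hhm
        exact (hm.stronglyMeasurable.integral_prod_right'.measurable.comp hxm).aestronglyMeasurable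
      · have := norm_integral_le_of_norm_le_const (μ := uniformSphere d)
          (f := fun w => combMean A M t (gradCoeff A t) (x ω, w) * h (x ω, w))
          (C := (∑ i, |gradCoeff A t i|) * B * ∑ _i : Fin d, 2 * κ⁻¹) (ae_of_all _ fun w => ?_)
        · simpa using this
        · rw [norm_mul]
          exact mul_le_mul (abs_combMean_le hBμ _) (hhb _ (hxc ω) w) (norm_nonneg _)
            ((abs_nonneg _).trans (abs_combMean_le (A := A) (t := t) hBμ (x ω, w)))
    refine (integral_mono hli hri hp).trans_eq ?_
    rw [integral_add (f := fun ω => -(2 * cubeDeriv M.μ (x ω) (a - x ω)))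
      (hDi.const_mul 2).neg (integrable_const _), integral_neg, integral_const_mul]
    simp
  have h1 := mul_le_mul_of_nonneg_left hdrift hαt
  have h2 : Q * A.α t ^ 2 * ∫ ω, γ ω ^ 2 ∂P ≤ K₂ * (A.α t ^ 2 / c ^ 3) := by
    -- The bound `c ≤ b` puts both parts of `Q` over `c`; with the second moment of order `1 / c ^
    -- 2` this gives `1 / c ^ 3`.
    have hQ' : Q ≤ 2 * (κ⁻¹ * b + diffBound A.k / κ ^ 2) / c := by
      rw [hQ, le_div_iff₀ hct]
      have : κ⁻¹ * c ≤ κ⁻¹ * b := mul_le_mul_of_nonneg_left hctb (by positivity)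
      have e : diffBound A.k / c / κ ^ 2 * c = diffBound A.k / κ ^ 2 := by field_simp
      linarith [show 2 * (κ⁻¹ + diffBound A.k / c / κ ^ 2) * c
        = 2 * (κ⁻¹ * c + diffBound A.k / c / κ ^ 2 * c) by ring]
    have hQ0 : 0 ≤ Q := by positivity
    calc Q * A.α t ^ 2 * ∫ ω, γ ω ^ 2 ∂P
        ≤ 2 * (κ⁻¹ * b + diffBound A.k / κ ^ 2) / c * A.α t ^ 2
          * (momentBound A.k / c ^ 2 * B ^ 2) := by
          gcongr
      _ = K₂ * (A.α t ^ 2 / c ^ 3) := by rw [hK₂]; field_simp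
  have h3 : 0 ≤ A.α t * c := by positivity
  have h4 : 0 ≤ A.α t ^ 2 / c ^ 3 := by positivity
  have h5 : 0 ≤ c - c' := sub_nonneg.2 (hcc t ht)
  have h6 : K₁ * (A.α t * c) + K₂ * (A.α t ^ 2 / c ^ 3) + K₃ * (c - c')
      ≤ (K₁ + K₂ + K₃) * (A.α t * c + A.α t ^ 2 / c ^ 3 + (c - c')) := by
    nlinarith [mul_nonneg hK₁0 h4, mul_nonneg hK₁0 h5, mul_nonneg hK₂0 h3, mul_nonneg hK₂0 h5,
      mul_nonneg hK₃0 h3, mul_nonneg hK₃0 h4]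
  linarith

end expectation

/-! ### Sequences -/

section sequences

theorem summable_of_add_le {v a s : ℕ → ℝ} (hv : ∀ n, 0 ≤ v n) (ha : ∀ n, 0 ≤ a n)
    (hs : ∀ n, 0 ≤ s n) (hsum : Summable s) (h : ∀ n, v (n + 1) + a n ≤ v n + s n) :
    Summable a := by
  have key : ∀ N, v N + ∑ n ∈ Finset.range N, a n ≤ v 0 + ∑ n ∈ Finset.range N, s n := fun N => by
    induction N with
    | zero => simp
    | succ N ih => rw [Finset.sum_range_succ, Finset.sum_range_succ]; linarith [h N]
  refine summable_of_sum_range_le (c := v 0 + ∑' n, s n) ha fun N => ?_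
  linarith [key N, hv N, hsum.sum_le_tsum (Finset.range N) fun n _ => hs n]

/-- Kronecker's lemma for nonnegative terms and the weights `1 / n`. -/
theorem tendsto_average_of_summable_div {a : ℕ → ℝ} (ha : ∀ n, 0 ≤ a n)
    (h : Summable fun n => a n / (n + 1 : ℝ)) :
    Tendsto (fun N : ℕ => (N : ℝ)⁻¹ * ∑ n ∈ Finset.range N, a n) atTop (𝓝 0) := by
  -- The average is a series in `n` truncated at `n < N`; each term tends to zero and is dominated
  -- by `a n / (n + 1)`.
  have key := tendsto_tsum_of_dominated_convergence (𝓕 := atTop)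
    (f := fun (N n : ℕ) => if n < N then (N : ℝ)⁻¹ * a n else 0) (g := fun _ => (0 : ℝ)) h
    (fun n => ?_) (Eventually.of_forall fun N n => ?_)
  · rw [tsum_zero] at key
    refine key.congr fun N => ?_
    rw [tsum_eq_sum (s := Finset.range N) fun n hn => if_neg (by simpa using hn), Finset.mul_sum]
    exact Finset.sum_congr rfl fun n hn => if_pos (Finset.mem_range.1 hn)
  · have : Tendsto (fun N : ℕ => (N : ℝ)⁻¹ * a n) atTop (𝓝 (0 * a n)) :=
      tendsto_inv_atTop_nhds_zero_nat.mul_const _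
    rw [zero_mul] at this
    refine this.congr' ?_
    filter_upwards [eventually_gt_atTop n] with N hN
    rw [if_pos hN]
  · have h0 : 0 ≤ a n / (n + 1 : ℝ) := div_nonneg (ha n) (by positivity)
    split_ifs with hn
    · have hN : (n + 1 : ℝ) ≤ N := by exact_mod_cast hn
      rw [Real.norm_eq_abs, abs_of_nonneg (mul_nonneg (by positivity) (ha n)), inv_mul_eq_div]
      exact div_le_div_of_nonneg_left (ha n) (by positivity) hN
    · simpa using h0

/-- By Tonelli the sum has finite expectation, hence is finite almost surely. -/
theorem ae_summable_of_summable_integral {Ω : Type*} [MeasurableSpace Ω] {P : Measure Ω}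
    {f : ℕ → Ω → ℝ} (hf0 : ∀ n ω, 0 ≤ f n ω) (hf : ∀ n, Integrable (f n) P)
    (h : Summable fun n => ∫ ω, f n ω ∂P) : ∀ᵐ ω ∂P, Summable fun n => f n ω := by
  have h1 : ∫⁻ ω, ∑' n, ENNReal.ofReal (f n ω) ∂P ≠ ∞ := by
    rw [lintegral_tsum fun n => (hf n).aemeasurable.ennreal_ofReal]
    simp only [← ofReal_integral_eq_lintegral_ofReal (hf _) (ae_of_all _ (hf0 _))]
    exact h.tsum_ofReal_ne_top
  filter_upwards [ae_lt_top' (AEMeasurable.tsum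
    fun n => (hf n).aemeasurable.ennreal_ofReal) h1] with ω hω
  have := ENNReal.summable_toReal hω.ne
  simpa only [ENNReal.toReal_ofReal (hf0 _ ω)] using this

/-- Averages of a continuous function along a perturbed sequence, when the averages of a function
that vanishes only at `a` tend to zero. -/
theorem tendsto_average_of_tendsto_gap {d : ℕ} {s : Set (E d)} (hs : IsCompact s) {F D : E d → ℝ}
    (hF : ContinuousOn F s) (hD : ContinuousOn D s) {a : E d} (ha : a ∈ s)
    (hDn : ∀ x ∈ s, 0 ≤ D x) (hpos : ∀ x ∈ s, x ≠ a → 0 < D x) {x y : ℕ → E d}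
    (hx : ∀ n, x n ∈ s) (hy : ∀ n, y n ∈ s)
    (hxy : Tendsto (fun n => ‖y n - x n‖) atTop (𝓝 0))
    (hDx : Tendsto (fun N : ℕ => (N : ℝ)⁻¹ * ∑ n ∈ Finset.range N, D (x n)) atTop (𝓝 0)) :
    Tendsto (fun N : ℕ => (N : ℝ)⁻¹ * ∑ n ∈ Finset.range N, F (y n)) atTop (𝓝 (F a)) := by
  have hFxy : Tendsto (fun n => |F (y n) - F (x n)|) atTop (𝓝 0) := by
    have hu := hs.uniformContinuousOn_of_continuous hF
    rw [Metric.uniformContinuousOn_iff] at hu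
    rw [Metric.tendsto_atTop] at hxy ⊢
    intro ε hε
    obtain ⟨δ, hδ, hδ'⟩ := hu ε hε
    obtain ⟨N, hN⟩ := hxy δ hδ
    refine ⟨N, fun n hn => ?_⟩
    have := hN n hn
    rw [Real.dist_eq, sub_zero, abs_norm] at this
    rw [Real.dist_eq, sub_zero, abs_abs, ← Real.dist_eq]
    exact hδ' _ (hy n) _ (hx n) (by rwa [dist_eq_norm])
  have hces := hFxy.cesaro
  rw [Metric.tendsto_atTop]
  intro ε hε
  -- The error is split into `ε / 2`, a multiple of the averaged gap, and a Cesàro mean of the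
  -- perturbations `|F (y n) - F (x n)|`.
  obtain ⟨K, hK, hKb⟩ := exists_abs_sub_le_add_mul hs hF hD ha hDn hpos (half_pos hε)
  have hlim : Tendsto (fun N : ℕ => (N : ℝ)⁻¹ * ∑ n ∈ Finset.range N, |F (y n) - F (x n)|
      + K * ((N : ℝ)⁻¹ * ∑ n ∈ Finset.range N, D (x n))) atTop (𝓝 0) := by
    simpa using hces.add (hDx.const_mul K)
  obtain ⟨N₀, hN₀⟩ := (Metric.tendsto_atTop.1 hlim) (ε / 2) (half_pos hε)
  refine ⟨max N₀ 1, fun N hN => ?_⟩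
  have hN1 : 0 < N := (le_max_right N₀ 1).trans hN
  have hN1' : (0 : ℝ) < N := by exact_mod_cast hN1
  have h1 := hN₀ N ((le_max_left _ _).trans hN)
  rw [Real.dist_eq, sub_zero] at h1
  have h2 : (N : ℝ)⁻¹ * ∑ n ∈ Finset.range N, F (y n) - F a
      = (N : ℝ)⁻¹ * ∑ n ∈ Finset.range N, (F (y n) - F a) := by
    rw [Finset.sum_sub_distrib, Finset.sum_const, Finset.card_range, nsmul_eq_mul]
    field_simp
  have h3 : ∑ n ∈ Finset.range N, |F (y n) - F a| ≤ ∑ n ∈ Finset.range N,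
      (|F (y n) - F (x n)| + K * D (x n) + ε / 2) := Finset.sum_le_sum fun n _ => by
    linarith [abs_sub_le (F (y n)) (F (x n)) (F a), hKb (x n) (hx n)]
  rw [Finset.sum_add_distrib, Finset.sum_add_distrib, ← Finset.mul_sum, Finset.sum_const,
    Finset.card_range, nsmul_eq_mul] at h3
  have hinv : 0 ≤ (N : ℝ)⁻¹ := by positivity
  have h4 := mul_le_mul_of_nonneg_left h3 hinv
  have h5 : (N : ℝ)⁻¹ * (N * (ε / 2)) = ε / 2 := by field_simp
  rw [Real.dist_eq, h2, abs_mul, abs_of_nonneg hinv]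
  have h6 := mul_le_mul_of_nonneg_left
    (Finset.abs_sum_le_sum_abs (fun n => F (y n) - F a) (Finset.range N)) hinv
  have h7 := (le_abs_self _).trans_lt h1
  linarith [mul_add (N : ℝ)⁻¹ (∑ n ∈ Finset.range N, |F (y n) - F (x n)|)
      (K * ∑ n ∈ Finset.range N, D (x n)),
    mul_add (N : ℝ)⁻¹ (∑ n ∈ Finset.range N, |F (y n) - F (x n)|
      + K * ∑ n ∈ Finset.range N, D (x n)) (N * (ε / 2)),
    mul_left_comm (N : ℝ)⁻¹ K (∑ n ∈ Finset.range N, D (x n))]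

end sequences

/-! ### Almost sure convergence of averages along the run -/

section convergence

variable {d : ℕ} {A : Params d} {S Ω : Type*} {Z : Inputs A S Ω} {M : Model d S}
  [MeasurableSpace S] {ρ : Measure S} [IsProbabilityMeasure ρ]
  [MeasurableSpace Ω] {P : Measure Ω} [IsProbabilityMeasure P]

theorem tendsto_const_div_rpow (C : ℝ) {ν : ℝ} (hν : 0 < ν) :
    Tendsto (fun n : ℕ => C / ((n + 1 : ℕ) : ℝ) ^ ν) atTop (𝓝 0) :=
  ((tendsto_rpow_atTop hν).comp
    (tendsto_natCast_atTop_atTop.comp (tendsto_add_atTop_nat 1))).const_div_atTop C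

theorem div_rpow_antitone {C ν : ℝ} (hC : 0 < C) (hν : 0 < ν) (n : ℕ) :
    C / ((n + 1 + 1 : ℕ) : ℝ) ^ ν ≤ C / ((n + 1 : ℕ) : ℝ) ^ ν := by
  refine div_le_div_of_nonneg_left hC.le (by positivity) ?_
  exact Real.rpow_le_rpow (by positivity) (by exact_mod_cast (n + 1).le_succ) hν.le

/-- The first two terms decay with exponents `1 + ν` and `2 - 3 * ν`, both above `1`; the third
telescopes. -/
theorem summable_step_sizes {C₀ C₁ ν : ℝ} (hC₀ : 0 < C₀) (hC₁ : 0 < C₁) (hν₀ : 0 < ν)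
    (hν₁ : ν < 1 / 4) :
    Summable fun n : ℕ => C₀ / ((n + 1 : ℕ) : ℝ) * (C₁ / ((n + 1 : ℕ) : ℝ) ^ ν)
      + (C₀ / ((n + 1 : ℕ) : ℝ)) ^ 2 / (C₁ / ((n + 1 : ℕ) : ℝ) ^ ν) ^ 3
      + (C₁ / ((n + 1 : ℕ) : ℝ) ^ ν - C₁ / ((n + 1 + 1 : ℕ) : ℝ) ^ ν) := by
  refine Summable.add (Summable.add ?_ ?_) ?_
  · have : Summable fun n : ℕ => C₀ * C₁ * (1 / ((n + 1 : ℕ) : ℝ) ^ (1 + ν)) :=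
      ((summable_nat_add_iff 1).2 (Real.summable_one_div_nat_rpow.2
        (by linarith : 1 < 1 + ν))).mul_left _
    refine this.congr fun n => ?_
    have hn : (0 : ℝ) < ((n + 1 : ℕ) : ℝ) := by positivity
    rw [Real.rpow_add hn, Real.rpow_one]
    field_simp
  · have : Summable fun n : ℕ => C₀ ^ 2 / C₁ ^ 3 * (1 / ((n + 1 : ℕ) : ℝ) ^ (2 - 3 * ν)) :=
      ((summable_nat_add_iff 1).2 (Real.summable_one_div_nat_rpow.2
        (by linarith : 1 < 2 - 3 * ν))).mul_left _
    refine this.congr fun n => ?_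
    have hn : (0 : ℝ) < ((n + 1 : ℕ) : ℝ) := by positivity
    generalize ((n + 1 : ℕ) : ℝ) = r at hn
    have hp : 0 < r ^ ν := by positivity
    have e : r ^ (2 - 3 * ν) = r ^ 2 / (r ^ ν) ^ 3 := by
      rw [Real.rpow_sub hn, mul_comm 3 ν, Real.rpow_mul hn.le]
      norm_cast
    rw [e]
    field_simp
  · refine summable_of_sum_range_le (c := C₁)
      (fun n => sub_nonneg.2 (div_rpow_antitone hC₁ hν₀ n)) fun N => ?_
    rw [Finset.sum_range_sub' fun n : ℕ => C₁ / ((n + 1 : ℕ) : ℝ) ^ ν]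
    have : 0 < C₁ / ((N + 1 : ℕ) : ℝ) ^ ν := by positivity
    simp only [zero_add, Nat.cast_one, Real.one_rpow, div_one]
    linarith

/-- Since `α_t` is proportional to `1 / t`, the summed drift inequality is exactly the hypothesis of
Kronecker's lemma, in expectation and therefore almost surely. -/
theorem ae_tendsto_average_gap (hZ : Z.IsRandomized ρ P) (hM : M.IsStandardized ρ)
    (hμ : SmoothConcave M.μ) (hσ : ContinuousOn M.σ (cube d)) (hm₁ : 1 ≤ A.m₁) (hm₂ : 1 ≤ A.m₂)
    (hθ₀ : A.θ₀ ∈ cube d) (hk : 1 < A.k) {a : E d} (ha : a ∈ cube d)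
    (hgap : ∀ x ∈ cube d, 0 ≤ cubeDeriv M.μ x (a - x)) {C₀ C₁ ν : ℝ} (hC₀ : 0 < C₀)
    (hC₁ : 0 < C₁) (hν₀ : 0 < ν) (hν₁ : ν < 1 / 4)
    (hα : ∀ t : ℕ, 1 ≤ t → A.α t = C₀ / t)
    (hc : ∀ t : ℕ, 1 ≤ t → A.c t = C₁ / (t : ℝ) ^ ν) :
    ∀ᵐ ω ∂P, Tendsto (fun N : ℕ => (N : ℝ)⁻¹ * ∑ n ∈ Finset.range N,
      cubeDeriv M.μ (iterate Z M (n + 1) ω) (a - iterate Z M (n + 1) ω)) atTop (𝓝 0) := by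
  have hpow : ∀ t : ℕ, 1 ≤ t → 1 ≤ (t : ℝ) ^ ν := fun t ht =>
    Real.one_le_rpow (by exact_mod_cast ht) hν₀.le
  have hc1 : ∀ t, 1 ≤ t → 0 < A.c t ∧ A.c t ≤ max 1 C₁ := fun t ht => by
    have := hpow t ht
    rw [hc t ht]
    exact ⟨by positivity, (div_le_self hC₁.le this).trans (le_max_right _ _)⟩
  have hcc : ∀ t, 1 ≤ t → A.c (t + 1) ≤ A.c t := fun t ht => by
    obtain ⟨n, rfl⟩ : ∃ n, t = n + 1 := ⟨t - 1, by omega⟩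
    rw [hc _ ht, hc _ (by omega)]
    exact div_rpow_antitone hC₁ hν₀ n
  have hα0 : ∀ t, 1 ≤ t → 0 ≤ A.α t := fun t ht => by rw [hα t ht]; positivity
  obtain ⟨K, hK, v, hv, hdrift⟩ := exists_expected_drift hZ hM hμ hσ hm₁ hm₂ hθ₀ hk ha
    (le_max_left 1 C₁) hc1 hcc hα0
  set D : ℕ → Ω → ℝ := fun n ω =>
    cubeDeriv M.μ (iterate Z M (n + 1) ω) (a - iterate Z M (n + 1) ω) with hD
  have hD0 : ∀ n ω, 0 ≤ D n ω := fun n ω => hgap _ (iterate_mem_cube hθ₀ _ ω)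
  have hDi : ∀ n, Integrable (D n) P := fun n =>
    integrable_comp_of_continuousOn (hμ.continuousOn_gap a)
      (hZ.measurable_run hM hμ.continuousOn hσ (n + 1)) (iterate_mem_cube hθ₀ _)
  have hsum : Summable fun n => A.α (n + 1) * A.c (n + 1) + A.α (n + 1) ^ 2 / A.c (n + 1) ^ 3
      + (A.c (n + 1) - A.c (n + 1 + 1)) := (summable_step_sizes hC₀ hC₁ hν₀ hν₁).congr fun n => by
    rw [← hα (n + 1) (by omega), ← hc (n + 1) (by omega), ← hc (n + 1 + 1) (by omega)]
  have hsumE : Summable fun n => 2 * A.α (n + 1) * ∫ ω, D n ω ∂P := by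
    have hstep : ∀ n, v (n + 1 + 1) + 2 * A.α (n + 1) * ∫ ω, D n ω ∂P ≤ v (n + 1)
        + K * (A.α (n + 1) * A.c (n + 1) + A.α (n + 1) ^ 2 / A.c (n + 1) ^ 3
          + (A.c (n + 1) - A.c (n + 1 + 1))) := fun n => hdrift (n + 1) (by omega)
    refine summable_of_add_le (v := fun n => v (n + 1)) (fun n => hv _ (by omega)) (fun n => ?_)
      (fun n => ?_) (hsum.mul_left K) hstep
    · exact mul_nonneg (mul_nonneg zero_le_two (hα0 _ (by omega)))
        (integral_nonneg fun ω => hD0 n ω)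
    · have h1 := hα0 (n + 1) (by omega)
      have h2 := (hc1 (n + 1) (by omega)).1
      have h3 := sub_nonneg.2 (hcc (n + 1) (by omega))
      positivity
  have hsumE' : Summable fun n : ℕ => ∫ ω, D n ω / (n + 1 : ℝ) ∂P := by
    refine (hsumE.mul_left (2 * C₀)⁻¹).congr fun n => ?_
    rw [integral_div, hα _ (by omega)]
    push_cast
    field_simp
  have hae := ae_summable_of_summable_integral (f := fun n ω => D n ω / (n + 1 : ℝ))
    (fun n ω => div_nonneg (hD0 n ω) (by positivity)) (fun n => (hDi n).div_const _) hsumE'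
  filter_upwards [hae] with ω hω
  exact tendsto_average_of_summable_div (a := fun n => D n ω) (fun n => hD0 n ω) hω

theorem ae_tendsto_average_combVar (hZ : Z.IsRandomized ρ P) (hM : M.IsStandardized ρ)
    (hμ : SmoothConcave M.μ) (hσ : ContinuousOn M.σ (cube d)) (hm₁ : 1 ≤ A.m₁) (hm₂ : 1 ≤ A.m₂)
    (hθ₀ : A.θ₀ ∈ cube d) (hk : 1 < A.k) {a : E d} (ha : a ∈ cube d)
    (hmax : IsMaxOn M.μ (cube d) a) {C₀ C₁ ν : ℝ} (hC₀ : 0 < C₀)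
    (hC₁ : 0 < C₁) (hν₀ : 0 < ν) (hν₁ : ν < 1 / 4)
    (hα : ∀ t : ℕ, 1 ≤ t → A.α t = C₀ / t)
    (hc : ∀ t : ℕ, 1 ≤ t → A.c t = C₁ / (t : ℝ) ^ ν) (b : Fin 4 → ℝ) :
    ∀ᵐ ω ∂P, Tendsto (fun N : ℕ => (N : ℝ)⁻¹ * ∑ n ∈ Finset.range N,
      combVar A M (n + 1) b (iterate Z M (n + 1) ω, Z.w (n + 1) ω)) atTop
      (𝓝 ((b 0 ^ 2 / A.m₂ + b 1 ^ 2 / A.m₁ + b 2 ^ 2 / A.m₁ + b 3 ^ 2 / A.m₂) * M.σ a ^ 2)) := by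
  have hpos : ∀ x ∈ cube d, x ≠ a → 0 < cubeDeriv M.μ x (a - x) := fun x hx hxa =>
    hμ.deriv_pos ha hmax hx hxa
  have hgap : ∀ x ∈ cube d, 0 ≤ cubeDeriv M.μ x (a - x) := fun x hx => by
    rcases eq_or_ne x a with rfl | hxa
    · simp
    · exact (hpos x hx hxa).le
  filter_upwards [ae_tendsto_average_gap hZ hM hμ hσ hm₁ hm₂ hθ₀ hk ha hgap hC₀ hC₁ hν₀ hν₁ hα hc]
    with ω hω
  have hr : ∀ r : ℝ, Tendsto (fun N : ℕ => (N : ℝ)⁻¹ * ∑ n ∈ Finset.range N,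
      M.σ (shifted A (n + 1) (iterate Z M (n + 1) ω) (Z.w (n + 1) ω) r) ^ 2) atTop
      (𝓝 (M.σ a ^ 2)) := fun r => by
    refine tendsto_average_of_tendsto_gap (isCompact_cube d) (F := fun x => M.σ x ^ 2) (hσ.pow 2)
      (hμ.continuousOn_gap a) ha hgap hpos (fun n => iterate_mem_cube hθ₀ (n + 1) ω)
      (fun n => shifted_mem A (n + 1) _ _ r) ?_ hω
    have hlim : Tendsto (fun n : ℕ => |r| * |A.c (n + 1)|) atTop (𝓝 0) := by
      have h1 := ((tendsto_const_div_rpow C₁ hν₀).abs).const_mul |r|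
      rw [abs_zero, mul_zero] at h1
      exact h1.congr fun n => by rw [hc _ (by omega)]
    -- Projection does not increase the distance to a point of the cube, so an evaluation point lies
    -- within `|r| * |c_t|` of the iterate.
    refine squeeze_zero (fun n => norm_nonneg _) (fun n => ?_) hlim
    refine (norm_proj_sub_self_le (iterate_mem_cube hθ₀ _ ω) _).trans_eq ?_
    rw [norm_smul, norm_eq_of_mem_sphere, mul_one, Real.norm_eq_abs, abs_mul]
  have hall := ((((hr A.k).const_mul (b 0 ^ 2 / A.m₂)).add
    ((hr 1).const_mul (b 1 ^ 2 / A.m₁))).add ((hr (-1)).const_mul (b 2 ^ 2 / A.m₁))).add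
    ((hr (-A.k)).const_mul (b 3 ^ 2 / A.m₂))
  refine (hall.congr fun N => ?_).trans_eq ?_
  · unfold combVar
    simp only [Finset.sum_add_distrib, ← Finset.mul_sum]
    ring
  · congr 1
    ring

end convergence

/-! ### The conditional variance -/

section condVar

variable {d : ℕ} {A : Params d} {S Ω : Type*} {Z : Inputs A S Ω} {M : Model d S}
  [MeasurableSpace S] {ρ : Measure S} [IsProbabilityMeasure ρ]
  [MeasurableSpace Ω] {P : Measure Ω} [IsProbabilityMeasure P]

/-- The draws are independent of iterate, design and direction, so conditioning amounts to
integrating them out, and the result no longer involves the design. -/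
theorem condVar_runComb (hZ : Z.IsRandomized ρ P) (hM : M.IsStandardized ρ)
    (hμ : ContinuousOn M.μ (cube d)) (hσ : ContinuousOn M.σ (cube d)) (hm₁ : 1 ≤ A.m₁)
    (hm₂ : 1 ≤ A.m₂) (b : Fin 4 → ℝ) (t : ℕ) :
    Var[runComb Z M b t; P | sigmaAlg Z M t]
      =ᵐ[P] fun ω => combVar A M t b (iterate Z M t ω, Z.w t ω) := by
  have hX := hZ.measurable_stateDirection hM hμ hσ t
  have hY := hZ.measurable_draws t
  have hF := measurable_combFun (A := A) t b hM hμ hσ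
  have hL2 := hZ.memLp_runComb hM hμ hσ hm₁ hm₂ b t
  have hφ := measurable_iterateDirection A
  obtain ⟨B₁, hB₁⟩ := (isCompact_cube d).exists_bound_of_continuousOn hμ
  obtain ⟨B₂, hB₂⟩ := (isCompact_cube d).exists_bound_of_continuousOn hσ
  have hmean := measurable_combMean (A := A) t b hμ
  have hcard := fun ω => And.intro (hZ.card_R₁ t ω) (hZ.card_R₂ t ω)
  have hE : P[runComb Z M b t | sigmaAlg Z M t]
      =ᵐ[P] fun ω => combMean A M t b (iterate Z M t ω, Z.w t ω) :=
    condExp_comp_indepFun hX hY (hZ.indepFun_draws hM hμ hσ t) (hZ.law_draws t) hF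
      (hL2.integrable one_le_two) hφ hmean (fun p => abs_combMean_le hB₁ p)
      fun ω => integral_combFun hM (by omega) (by omega) (p := (Z.state M t ω, Z.w t ω))
        (hcard ω).1 (hcard ω).2
  have hmeanL2 : MemLp (fun ω => combMean A M t b (iterate Z M t ω, Z.w t ω)) 2 P :=
    MemLp.of_bound (C := (∑ i, |b i|) * B₁) ((hmean.comp hφ).comp hX).aestronglyMeasurable
      (ae_of_all _ fun ω => abs_combMean_le hB₁ _)
  have hV : P[fun ω => (runComb Z M b t ω - combMean A M t b (iterate Z M t ω, Z.w t ω)) ^ 2 |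
      sigmaAlg Z M t] =ᵐ[P] fun ω => combVar A M t b (iterate Z M t ω, Z.w t ω) := by
    refine condExp_comp_indepFun hX hY (hZ.indepFun_draws hM hμ hσ t) (hZ.law_draws t)
      (H := fun p => (combFun A M t b p - combMean A M t b (iterateDirection A p.1)) ^ 2)
      ((hF.sub (hmean.comp (hφ.comp measurable_fst))).pow_const 2)
      (hL2.sub hmeanL2).integrable_sq hφ (measurable_combVar t b hσ)
      (C := (∑ i, b i ^ 2) * B₂ ^ 2) (fun p => ?_) fun ω => ?_
    · rw [abs_of_nonneg (combVar_nonneg p)]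
      exact combVar_le hm₁ hm₂ hB₂ p
    · rw [← variance_combFun hM (by omega) (by omega) (p := (Z.state M t ω, Z.w t ω))
        (hcard ω).1 (hcard ω).2,
        variance_eq_integral (memLp_combFun hM _).aestronglyMeasurable.aemeasurable,
        integral_combFun hM (by omega) (by omega) (p := (Z.state M t ω, Z.w t ω))
        (hcard ω).1 (hcard ω).2]
  -- In the definition of the conditional variance the conditional mean may be replaced by
  -- `combMean`, to which it is almost surely equal.
  refine EventuallyEq.trans (condExp_congr_ae ?_) hV
  filter_upwards [hE] with ω hω
  simp only [Pi.pow_apply, Pi.sub_apply, hω]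

theorem sum_Icc_one {β : Type*} [AddCommMonoid β] (f : ℕ → β) (n : ℕ) :
    ∑ t ∈ Finset.Icc 1 n, f t = ∑ i ∈ Finset.range n, f (i + 1) := by
  induction n with
  | zero => simp
  | succ n ih => rw [Finset.sum_Icc_succ_top (by omega), ih, Finset.sum_range_succ]

/-- Conditional variances are defined up to null sets; there are countably many pairs `(T, t)`, so
one null set serves all budgets. -/
theorem varFinalEst_ae_eq (hZ : Z.IsRandomized ρ P) (hM : M.IsStandardized ρ)
    (hμ : ContinuousOn M.μ (cube d)) (hσ : ContinuousOn M.σ (cube d)) (hm₁ : 1 ≤ A.m₁)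
    (hm₂ : 1 ≤ A.m₂) :
    ∀ᵐ ω ∂P, ∀ T : ℕ, varFinalEst Z M P T ω = (2 * A.m / T : ℝ) ^ 2
      * ∑ n ∈ Finset.range (T / (2 * A.m)),
        combVar A M (n + 1) (valueCoeff A) (iterate Z M (n + 1) ω, Z.w (n + 1) ω) := by
  have h : ∀ T t : ℕ, Var[fun ω' => (2 * A.m / T : ℝ) * muHat Z M t ω'; P | sigmaAlg Z M t]
      =ᵐ[P] fun ω => (2 * A.m / T : ℝ) ^ 2
        * combVar A M t (valueCoeff A) (iterate Z M t ω, Z.w t ω) := fun T t => by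
    have e : (fun ω' => (2 * A.m / T : ℝ) * muHat Z M t ω')
        = (2 * A.m / T : ℝ) • runComb Z M (valueCoeff A) t := by
      ext ω
      simp only [muHat_eq, Pi.smul_apply, smul_eq_mul, runComb]
    rw [e]
    filter_upwards [condVar_smul (m := sigmaAlg Z M t) (μ := P) (2 * A.m / T : ℝ)
      (runComb Z M (valueCoeff A) t), condVar_runComb hZ hM hμ hσ hm₁ hm₂ (valueCoeff A) t]
      with ω h1 h2
    rw [h1, Pi.smul_apply, h2, smul_eq_mul]
  have h' := ae_all_iff.2 fun T => ae_all_iff.2 (h T)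
  filter_upwards [h'] with ω hω T
  unfold varFinalEst
  rw [Finset.sum_congr rfl fun t _ => hω T t, ← Finset.mul_sum, sum_Icc_one]

end condVar

/-! ### Optimal subsample sizes -/

section allocation

variable {k m x y : ℝ}

/-- The excess over the minimum is a square over a positive quantity, which yields the minimum and,
through `x = k ^ 2 * y`, its unique location. -/
theorem allocation_sub (hk : 1 < k) (hx : 0 < x) (hy : 0 < y) (h : x + y = m) :
    m / (k ^ 2 - 1) ^ 2 * (k ^ 4 / x + 1 / y) - (k ^ 2 + 1) ^ 2 / (k ^ 2 - 1) ^ 2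
      = (k ^ 2 * y - x) ^ 2 / ((k ^ 2 - 1) ^ 2 * x * y) := by
  have hk2 : 0 < k ^ 2 - 1 := by nlinarith
  subst h
  field_simp
  ring

theorem allocation_eq_iff (hk : 1 < k) (hx : 0 < x) (hy : 0 < y) (h : x + y = m) :
    m / (k ^ 2 - 1) ^ 2 * (k ^ 4 / x + 1 / y) = (k ^ 2 + 1) ^ 2 / (k ^ 2 - 1) ^ 2 ↔
      x = k ^ 2 / (k ^ 2 + 1) * m ∧ y = 1 / (k ^ 2 + 1) * m := by
  have hk2 : 0 < k ^ 2 - 1 := by nlinarith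
  have hD : (k ^ 2 - 1) ^ 2 * x * y ≠ 0 := by positivity
  rw [← sub_eq_zero, allocation_sub hk hx hy h, div_eq_zero_iff, or_iff_left hD,
    sq_eq_zero_iff, sub_eq_zero]
  subst h
  constructor
  · intro e
    constructor
    · field_simp; linarith
    · field_simp; linarith
  · rintro ⟨-, e⟩
    field_simp at e
    linarith

theorem isLeast_allocation (hk : 1 < k) (hm : 0 < m) :
    IsLeast {v : ℝ | ∃ x y : ℝ, 0 < x ∧ 0 < y ∧ x + y = m ∧
        v = m / (k ^ 2 - 1) ^ 2 * (k ^ 4 / x + 1 / y)}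
      ((k ^ 2 + 1) ^ 2 / (k ^ 2 - 1) ^ 2) := by
  have hk2 : 0 < k ^ 2 - 1 := by nlinarith
  constructor
  · have hx : 0 < k ^ 2 / (k ^ 2 + 1) * m := by positivity
    have hy : 0 < 1 / (k ^ 2 + 1) * m := by positivity
    have h : k ^ 2 / (k ^ 2 + 1) * m + 1 / (k ^ 2 + 1) * m = m := by field_simp
    exact ⟨_, _, hx, hy, h, ((allocation_eq_iff hk hx hy h).2 ⟨rfl, rfl⟩).symm⟩
  · rintro _ ⟨x, y, hx, hy, h, rfl⟩
    rw [← sub_nonneg, allocation_sub hk hx hy h]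
    positivity

end allocation

end

end AdaptiveAB

/-! ### The proposition. -/

theorem mainTheorem3 {d : ℕ} (hd : 1 ≤ d) {S Ω : Type*} [MeasurableSpace S] [MeasurableSpace Ω]
    (ρ : Measure S) [IsProbabilityMeasure ρ] (P : Measure Ω) [IsProbabilityMeasure P]
    (M : AdaptiveAB.Model d S) (hM : M.IsStandardized ρ)
    (hμ : AdaptiveAB.SmoothConcave M.μ)
    (hσ : ContinuousOn M.σ (AdaptiveAB.cube d))
    (hode : AdaptiveAB.ODEWellPosed M.μ)
    (hε : AdaptiveAB.UniformMoment M ρ)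
    (θstar : AdaptiveAB.E d) (hθstar : θstar ∈ AdaptiveAB.cube d)
    (hmax : IsMaxOn M.μ (AdaptiveAB.cube d) θstar)
    (A : AdaptiveAB.Params d) (hk : 1 < A.k) (hm₁ : 1 ≤ A.m₁) (hm₂ : 1 ≤ A.m₂)
    (hθ₀ : A.θ₀ ∈ AdaptiveAB.cube d)
    (C₀ C₁ ν : ℝ) (hC₀ : 0 < C₀) (hC₁ : 0 < C₁) (hν₁ : 1 / 6 < ν) (hν₂ : ν < 1 / 4)
    (hα : ∀ t : ℕ, 1 ≤ t → A.α t = C₀ / t)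
    (hc : ∀ t : ℕ, 1 ≤ t → A.c t = C₁ / (t : ℝ) ^ ν)
    (Z : AdaptiveAB.Inputs A S Ω) (hZ : Z.IsRandomized ρ P) :
    ((∀ t : ℕ, 1 ≤ t → MemLp (AdaptiveAB.muHat Z M t) 2 P) ∧
      ∀ᵐ ω ∂P, Tendsto (fun T : ℕ => (T : ℝ) * AdaptiveAB.varFinalEst Z M P T ω)
        (atTop ⊓ 𝓟 {T : ℕ | 2 * A.m ∣ T})
        (𝓝 ((A.m : ℝ) / (A.k ^ 2 - 1) ^ 2 * (A.k ^ 4 / A.m₁ + 1 / A.m₂) * M.σ θstar ^ 2))) ∧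
    (IsLeast {v : ℝ | ∃ x y : ℝ, 0 < x ∧ 0 < y ∧ x + y = A.m ∧
          v = (A.m : ℝ) / (A.k ^ 2 - 1) ^ 2 * (A.k ^ 4 / x + 1 / y)}
        ((A.k ^ 2 + 1) ^ 2 / (A.k ^ 2 - 1) ^ 2) ∧
      ∀ x y : ℝ, 0 < x → 0 < y → x + y = A.m →
        ((A.m : ℝ) / (A.k ^ 2 - 1) ^ 2 * (A.k ^ 4 / x + 1 / y)
            = (A.k ^ 2 + 1) ^ 2 / (A.k ^ 2 - 1) ^ 2 ↔
          x = A.k ^ 2 / (A.k ^ 2 + 1) * A.m ∧ y = 1 / (A.k ^ 2 + 1) * A.m)) := by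
  refine ⟨⟨fun t _ => ?_, ?_⟩, AdaptiveAB.isLeast_allocation hk ?_,
    fun x y hx hy h => AdaptiveAB.allocation_eq_iff hk hx hy h⟩
  · have e : AdaptiveAB.muHat Z M t = AdaptiveAB.runComb Z M (AdaptiveAB.valueCoeff A) t :=
      funext fun ω => AdaptiveAB.muHat_eq t ω
    rw [e]
    exact hZ.memLp_runComb hM hμ.continuousOn hσ hm₁ hm₂ _ t
  · have hm : 0 < 2 * A.m := by unfold AdaptiveAB.Params.m; omega
    have hk2 : 0 < A.k ^ 2 - 1 := by nlinarith
    filter_upwards [AdaptiveAB.varFinalEst_ae_eq hZ hM hμ.continuousOn hσ hm₁ hm₂,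
      AdaptiveAB.ae_tendsto_average_combVar hZ hM hμ hσ hm₁ hm₂ hθ₀ hk hθstar hmax hC₀ hC₁
        (by linarith) hν₂ hα hc (AdaptiveAB.valueCoeff A)] with ω h1 h2
    have hdiv : Tendsto (fun T : ℕ => T / (2 * A.m)) (atTop ⊓ 𝓟 {T : ℕ | 2 * A.m ∣ T}) atTop :=
      (Nat.tendsto_div_const_atTop hm.ne').mono_left inf_le_left
    -- With `T = 2 * m * n`, the factor `T * (2 * m / T) ^ 2` equals `2 * m / n`.
    have h3 := (h2.comp hdiv).const_mul (2 * A.m : ℝ)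
    refine (h3.congr' ?_).trans_eq ?_
    · filter_upwards [mem_inf_of_right (mem_principal_self _),
        mem_inf_of_left (eventually_gt_atTop 0)] with T hT hT0
      obtain ⟨n, rfl⟩ := hT
      have hn : n ≠ 0 := by rintro rfl; simp at hT0
      have hn' : (n : ℝ) ≠ 0 := by exact_mod_cast hn
      have hm' : (A.m : ℝ) ≠ 0 := by
        have : A.m ≠ 0 := by omega
        exact_mod_cast this
      rw [h1, Function.comp_apply, Nat.mul_div_cancel_left n hm]
      push_cast
      field_simp
    -- The four squared coefficients combine to `(k ^ 4 / m₁ + 1 / m₂) / (2 * (k ^ 2 - 1) ^ 2)`, and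
    -- the factor `2 * m` gives the stated constant.
    · congr 1
      unfold AdaptiveAB.valueCoeff
      simp only [Fin.isValue, Matrix.cons_val]
      have h4 : (A.m₁ : ℝ) ≠ 0 := by exact_mod_cast (by omega : A.m₁ ≠ 0)
      have h5 : (A.m₂ : ℝ) ≠ 0 := by exact_mod_cast (by omega : A.m₂ ≠ 0)
      field_simp
      ring
  · have : 0 < A.m := by unfold AdaptiveAB.Params.m; omega
    exact_mod_cast this
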